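/- **Setting.** Let $\mathcal X,\mathcal Y$ be measurable spaces, let $Q$ be a Markov kernel on $\mathcal X$ with invariant probability measure $Q_0$, so that $(X_t)$ is a stationary Markov process with transition law $Q$ and $(X_t,X_{t+1})\sim Q_0\otimes Q$, and let $R$ be a Markov kernel giving the conditional law of $Y_{t+1}\in\mathcal Y$ given $(X_t,X_{t+1})$ (so the law of $(X_{t+1},Y_{t+1})$ given the past depends only on $X_t$). Write $\mathbb E^Q$ for conditional expectation under this model. Let $u:\mathcal X^2\to\mathbb R$ (utility growth) and $\boldsymbol g:\mathcal X^2\times\mathcal Y\to\mathbb R^{d}$ be measurable. For $r\ge 1$ put $\phi_r(x)=\exp(x^r)-1$. For a probability measure $\mu$, the Orlicz heart $E^{\phi_r}(\mu)$ is the space of ($\mu$-a.e. classes of) measurable $f$ with $\mathbb E^\mu[\phi_r(|f|/c)]<\infty$ for every $c>0$, with norm $\|f\|_{\phi_r}=\inf\{c>0:\mathbb E^\mu[\phi_r(|f|/c)]\le 1\}$. Write $E^{\phi_r}=E^{\phi_r}(Q_0)$. For preference parameters $\beta\in(0,1)$, $\theta>0$ let $\alpha=-\frac1{\theta(1-\beta)}$,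 and for $(\alpha,\beta)\in\mathcal A=(-\infty,0)\times(0,1)$ let $$\mathbb T f(x)=\mathbb T(\alpha,\beta,f)(x)=\beta\log\mathbb E^Q\big[e^{f(X_{t+1})+\alpha u(X_t,X_{t+1})}\,\big|\,X_t=x\big].$$ **Assumption U.** $u\in E^{\phi_r}(Q_0\otimes Q)$ for some $r>1$. Under this assumption $\mathbb T(\alpha,\beta,\cdot)$ maps $E^{\phi_s}$ to itself for $1\le s\le r$ and has a unique fixed point $v_{(\alpha,\beta)}$ in $E^{\phi_r}$, the continuation value. The worst-case belief distortion is $$m_v(x,x')=\frac{e^{v(x')+\alpha u(x,x')}}{\mathbb E^Q[e^{v(X_{t+1})+\alpha u(X_t,X_{t+1})}\mid X_t=x]},$$ and the conditional moment restriction at $(\beta,\theta)$ is $$\mathbb E^Q\big[m_v(X_t,X_{t+1})\,\beta\,\boldsymbol g(X_t,X_{t+1},Y_{t+1})-\boldsymbol 1\,\big|\,X_t\big]=\boldsymbol 0\quad Q_0\text{-a.e.},\qquad v=v_{(\alpha,\beta)}.$$ Two parameters $(\beta,\theta)$ and $(\beta',\theta')$ are observationally equivalent if this restriction holds at both. The parameter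 $(\beta_0,\theta_0)$ is locally identified if it has a neighborhood $\mathcal N\subseteq(0,1)\times(0,\infty)$ such that no $(\beta,\theta)\in\mathcal N$ with $(\beta,\theta)\ne(\beta_0,\theta_0)$ is observationally equivalent to $(\beta_0,\theta_0)$. Fix $(\beta_0,\theta_0)\in(0,1)\times(0,\infty)$, and put $\alpha_0=-\frac1{\theta_0(1-\beta_0)}$, $v_0=v_{(\alpha_0,\beta_0)}$, $\boldsymbol g_{t+1}=\mathbb E^Q[\boldsymbol g(X_t,X_{t+1},Y_{t+1})\mid X_t,X_{t+1}]$ (assumed to exist). Write $\mathbb E_{v_0}[h(X_t,X_{t+1})\mid X_t]=\mathbb E^Q[m_{v_0}(X_t,X_{t+1})h(X_t,X_{t+1})\mid X_t]$, taken with $\alpha=\alpha_0$, and let $\mathbb E_{v_0}^n$ be the iterated expectations: $\mathbb E_{v_0}^1h(x)=\mathbb E_{v_0}[h\mid X_t=x]$ and $\mathbb E_{v_0}^{n+1}h(x)=\mathbb E_{v_0}[\mathbb E^n_{v_0}h(X_{t+1})\mid X_t=x]$. The derivatives at $(\alpha_0,\beta_0)$ of the conditional moment map (the left-hand side of the moment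 restriction, as a function of $(\alpha,\beta)$) are $$\partial_\alpha\rho(X_t)=\mathbb E_{v_0}\Big[(\beta_0\boldsymbol g_{t+1}-\boldsymbol 1)\Big(u(X_t,X_{t+1})+\sum_{n\ge1}\beta_0^n\mathbb E_{v_0}^nu(X_{t+1})\Big)\Big|X_t\Big],$$ $$\partial_\beta\rho(X_t)=\frac1{\beta_0}\Big(\mathbb E_{v_0}\Big[(\beta_0\boldsymbol g_{t+1}-\boldsymbol 1)\Big(v_0(X_{t+1})+\sum_{n\ge1}\beta_0^n\mathbb E_{v_0}^nv_0(X_{t+1})\Big)\Big|X_t\Big]+\boldsymbol 1\Big)$$ (here $v_0$ is read as the function $(x,x')\mapsto v_0(x')$ inside $\mathbb E^n_{v_0}$). Let $\mathfrak V=\mathbb E^{Q_0}[D(X_t)D(X_t)']$, where $D(x)$ is the $2\times d$ matrix with rows $\partial_\alpha\rho(x)'$ and $\partial_\beta\rho(x)'$. **Proposition.** Let Assumption U hold with some $r>1$; for some $1<s\le r$ let $\mathbb T:\mathcal A\times E^{\phi_s}\to E^{\phi_s}$ be continuously Fréchet differentiable at $(\alpha_0,\beta_0,v_0)$ (differentiable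 in a neighborhood, with derivative continuous at this point); let each element of $\boldsymbol g_{t+1}$ have finite $(2+\varepsilon)$-th moment under $Q_0\otimes Q$ for some $\varepsilon>0$; and let $\mathfrak V$ be positive definite. Then $(\beta_0,\theta_0)$ is locally identified. -/

import Mathlib

open MeasureTheory ProbabilityTheory Filter Topology Set
open scoped ENNReal

namespace WorstCase

section Orlicz

variable {Ω : Type*} [MeasurableSpace Ω]

/-- The Young function `φ_r(t) = exp(t ^ r) - 1`, used for `t ≥ 0`. -/
noncomputable def youngFun (r t : ℝ) : ℝ := Real.exp (t ^ r) - 1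

/-- The modular `E[φ_r(|f| / c)]`, with value `∞` when the expectation is infinite. -/
noncomputable def orliczModular (r : ℝ) (μ : Measure Ω) (f : Ω → ℝ) (c : ℝ) : ℝ≥0∞ :=
  ∫⁻ x, ENNReal.ofReal (youngFun r (|f x| / c)) ∂μ

/-- `f` belongs to the Orlicz heart `E^{φ_r}(μ)`: it is measurable and `E[φ_r(|f| / c)] < ∞` for
every `c > 0`. -/
def MemOrliczHeart (r : ℝ) (μ : Measure Ω) (f : Ω → ℝ) : Prop :=
  AEStronglyMeasurable f μ ∧ ∀ c : ℝ, 0 < c → orliczModular r μ f c < ∞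

/-- The Luxemburg norm `inf {c > 0 : E[φ_r(|f| / c)] ≤ 1}`. -/
noncomputable def luxemburgNorm (r : ℝ) (μ : Measure Ω) (f : Ω → ℝ) : ℝ :=
  sInf {c : ℝ | 0 < c ∧ orliczModular r μ f c ≤ 1}

theorem youngFun_mono {r s t : ℝ} (hr : 1 ≤ r) (hs : 0 ≤ s) (hst : s ≤ t) :
    youngFun r s ≤ youngFun r t := by
  unfold youngFun
  have := Real.rpow_le_rpow hs hst (by linarith : (0 : ℝ) ≤ r)
  have := Real.exp_le_exp.2 this
  linarith

theorem youngFun_zero {r : ℝ} (hr : 1 ≤ r) : youngFun r 0 = 0 := by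
  unfold youngFun
  rw [Real.zero_rpow (by linarith)]
  simp

theorem youngFun_nonneg {r t : ℝ} (ht : 0 ≤ t) : 0 ≤ youngFun r t := by
  unfold youngFun
  have := Real.one_le_exp (Real.rpow_nonneg ht r)
  linarith

theorem youngFun_pos {r t : ℝ} (ht : 0 < t) : 0 < youngFun r t := by
  unfold youngFun
  have := Real.one_lt_exp_iff.2 (Real.rpow_pos_of_pos ht r)
  linarith

theorem youngFun_convex {r a b x y : ℝ} (hr : 1 ≤ r) (ha : 0 ≤ a) (hb : 0 ≤ b) (hab : a + b = 1)
    (hx : 0 ≤ x) (hy : 0 ≤ y) :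
    youngFun r (a * x + b * y) ≤ a * youngFun r x + b * youngFun r y := by
  unfold youngFun
  have h1 := (convexOn_rpow hr).2 (mem_Ici.2 hx) (mem_Ici.2 hy) ha hb hab
  have h2 := convexOn_exp.2 (mem_univ (x ^ r)) (mem_univ (y ^ r)) ha hb hab
  simp only [smul_eq_mul] at h1 h2
  have h3 := (Real.exp_le_exp.2 h1).trans h2
  nlinarith

theorem youngFun_measurable (r : ℝ) : Measurable (youngFun r) := by
  unfold youngFun
  fun_prop

theorem orliczModular_congr {r : ℝ} {μ : Measure Ω} {f g : Ω → ℝ} (h : f =ᵐ[μ] g) (c : ℝ) :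
    orliczModular r μ f c = orliczModular r μ g c := by
  unfold orliczModular
  apply lintegral_congr_ae
  filter_upwards [h] with x hx
  rw [hx]

theorem MemOrliczHeart.congr {r : ℝ} {μ : Measure Ω} {f g : Ω → ℝ} (hf : MemOrliczHeart r μ f)
    (h : f =ᵐ[μ] g) : MemOrliczHeart r μ g :=
  ⟨hf.1.congr h, fun c hc => orliczModular_congr (r := r) h c ▸ hf.2 c hc⟩

theorem luxemburgNorm_congr {r : ℝ} {μ : Measure Ω} {f g : Ω → ℝ} (h : f =ᵐ[μ] g) :
    luxemburgNorm r μ f = luxemburgNorm r μ g := by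
  unfold luxemburgNorm
  simp_rw [orliczModular_congr (r := r) h]

theorem orliczModular_add_le {r : ℝ} (hr : 1 ≤ r) {μ : Measure Ω} {f g : Ω → ℝ}
    (hf : AEStronglyMeasurable f μ) {a b : ℝ} (ha : 0 < a) (hb : 0 < b) :
    orliczModular r μ (f + g) (a + b) ≤
      ENNReal.ofReal (a / (a + b)) * orliczModular r μ f a +
        ENNReal.ofReal (b / (a + b)) * orliczModular r μ g b := by
  unfold orliczModular
  have hab : 0 < a + b := by linarith
  rw [← lintegral_const_mul' _ _ ENNReal.ofReal_ne_top,
    ← lintegral_const_mul' _ _ ENNReal.ofReal_ne_top, ← lintegral_add_left']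
  · apply lintegral_mono
    intro x
    simp only [Pi.add_apply]
    rw [← ENNReal.ofReal_mul (by positivity), ← ENNReal.ofReal_mul (by positivity),
      ← ENNReal.ofReal_add
        (mul_nonneg (by positivity) (youngFun_nonneg (by positivity)))
        (mul_nonneg (by positivity) (youngFun_nonneg (by positivity)))]
    apply ENNReal.ofReal_le_ofReal
    refine le_trans (youngFun_mono hr (by positivity) ?_)
      (youngFun_convex hr (by positivity) (by positivity) (by field_simp)
        (by positivity) (by positivity))
    have h1 : a / (a + b) * (|f x| / a) + b / (a + b) * (|g x| / b) = (|f x| + |g x|) / (a + b) := by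
      field_simp
    rw [h1]
    gcongr
    exact abs_add_le _ _
  · apply AEMeasurable.const_mul
    apply AEMeasurable.ennreal_ofReal
    exact (youngFun_measurable r).comp_aemeasurable
      ((continuous_abs.measurable.comp_aemeasurable hf.aemeasurable).div_const a)

theorem orliczModular_smul {r : ℝ} {μ : Measure Ω} {f : Ω → ℝ} {k : ℝ} (hk : k ≠ 0) (c : ℝ) :
    orliczModular r μ (k • f) (|k| * c) = orliczModular r μ f c := by
  unfold orliczModular
  have hk' : |k| ≠ 0 := abs_ne_zero.2 hk
  congr 1
  ext x
  simp only [Pi.smul_apply, smul_eq_mul, abs_mul]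
  rw [mul_div_mul_left _ _ hk']

theorem orliczModular_zero {r : ℝ} (hr : 1 ≤ r) {μ : Measure Ω} (c : ℝ) :
    orliczModular r μ (0 : Ω → ℝ) c = 0 := by
  unfold orliczModular
  simp [youngFun_zero hr]

theorem orliczModular_div_le {r : ℝ} (hr : 1 ≤ r) {μ : Measure Ω} {f : Ω → ℝ} {l c : ℝ}
    (hc : 0 < c) (hl : 0 < l) (hl1 : l ≤ 1) :
    orliczModular r μ f (c / l) ≤ ENNReal.ofReal l * orliczModular r μ f c := by
  unfold orliczModular
  rw [← lintegral_const_mul' _ _ ENNReal.ofReal_ne_top]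
  apply lintegral_mono
  intro x
  simp only
  rw [← ENNReal.ofReal_mul hl.le]
  apply ENNReal.ofReal_le_ofReal
  have h := youngFun_convex (x := |f x| / c) (y := 0) hr hl.le (sub_nonneg.2 hl1) (by ring)
    (by positivity) le_rfl
  rw [youngFun_zero hr] at h
  have h1 : |f x| / (c / l) = l * (|f x| / c) + (1 - l) * 0 := by field_simp; ring
  rw [h1]
  linarith

theorem MemOrliczHeart.add {r : ℝ} (hr : 1 ≤ r) {μ : Measure Ω} {f g : Ω → ℝ}
    (hf : MemOrliczHeart r μ f) (hg : MemOrliczHeart r μ g) : MemOrliczHeart r μ (f + g) := by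
  refine ⟨hf.1.add hg.1, fun c hc => ?_⟩
  have h := orliczModular_add_le (g := g) hr hf.1 (half_pos hc) (half_pos hc)
  rw [add_halves] at h
  refine h.trans_lt (ENNReal.add_lt_top.2 ⟨?_, ?_⟩)
  · exact ENNReal.mul_lt_top ENNReal.ofReal_lt_top (hf.2 _ (half_pos hc))
  · exact ENNReal.mul_lt_top ENNReal.ofReal_lt_top (hg.2 _ (half_pos hc))

theorem memOrliczHeart_zero {r : ℝ} (hr : 1 ≤ r) {μ : Measure Ω} :
    MemOrliczHeart r μ (0 : Ω → ℝ) :=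
  ⟨aestronglyMeasurable_zero, fun c _ => by rw [orliczModular_zero hr]; exact ENNReal.zero_lt_top⟩

theorem MemOrliczHeart.smul {r : ℝ} (hr : 1 ≤ r) {μ : Measure Ω} {f : Ω → ℝ}
    (hf : MemOrliczHeart r μ f) (k : ℝ) : MemOrliczHeart r μ (k • f) := by
  rcases eq_or_ne k 0 with rfl | hk
  · rw [zero_smul]
    exact memOrliczHeart_zero hr
  · refine ⟨hf.1.const_smul k, fun c hc => ?_⟩
    have hk' : 0 < |k| := abs_pos.2 hk
    have h : c = |k| * (c / |k|) := by field_simp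
    rw [h, orliczModular_smul hk]
    exact hf.2 _ (by positivity)

theorem luxemburgSet_nonempty {r : ℝ} (hr : 1 ≤ r) {μ : Measure Ω} {f : Ω → ℝ}
    (hf : MemOrliczHeart r μ f) : {c : ℝ | 0 < c ∧ orliczModular r μ f c ≤ 1}.Nonempty := by
  have hK := hf.2 1 one_pos
  set K := (orliczModular r μ f 1).toReal with hKdef
  have hKK : orliczModular r μ f 1 = ENNReal.ofReal K := (ENNReal.ofReal_toReal hK.ne).symm
  have hm : 0 < max 1 K := lt_max_of_lt_left one_pos
  refine ⟨1 / (1 / max 1 K), by positivity, ?_⟩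
  refine (orliczModular_div_le hr one_pos (by positivity) ?_).trans ?_
  · rw [div_le_one hm]
    exact le_max_left _ _
  · rw [hKK, ← ENNReal.ofReal_mul (by positivity)]
    apply ENNReal.ofReal_le_one.2
    rw [one_div, inv_mul_le_one₀ hm]
    exact le_max_right _ _

theorem luxemburgSet_bddBelow (r : ℝ) (μ : Measure Ω) (f : Ω → ℝ) :
    BddBelow {c : ℝ | 0 < c ∧ orliczModular r μ f c ≤ 1} :=
  ⟨0, fun _ hc => hc.1.le⟩

theorem luxemburgNorm_nonneg (r : ℝ) (μ : Measure Ω) (f : Ω → ℝ) : 0 ≤ luxemburgNorm r μ f :=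
  Real.sInf_nonneg fun _ hc => hc.1.le

theorem luxemburgNorm_add_le {r : ℝ} (hr : 1 ≤ r) {μ : Measure Ω} {f g : Ω → ℝ}
    (hf : MemOrliczHeart r μ f) (hg : MemOrliczHeart r μ g) :
    luxemburgNorm r μ (f + g) ≤ luxemburgNorm r μ f + luxemburgNorm r μ g := by
  unfold luxemburgNorm
  refine le_of_forall_pos_le_add fun ε hε => ?_
  obtain ⟨a, ha, ha'⟩ := Real.lt_sInf_add_pos (luxemburgSet_nonempty hr hf) (half_pos hε)
  obtain ⟨b, hb, hb'⟩ := Real.lt_sInf_add_pos (luxemburgSet_nonempty hr hg) (half_pos hε)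
  have hpa := ha.1
  have hpb := hb.1
  have hab : a + b ∈ {c : ℝ | 0 < c ∧ orliczModular r μ (f + g) c ≤ 1} := by
    refine ⟨by linarith, (orliczModular_add_le hr hf.1 hpa hpb).trans ?_⟩
    calc ENNReal.ofReal (a / (a + b)) * orliczModular r μ f a +
          ENNReal.ofReal (b / (a + b)) * orliczModular r μ g b
        ≤ ENNReal.ofReal (a / (a + b)) * 1 + ENNReal.ofReal (b / (a + b)) * 1 := by
          gcongr
          · exact ha.2
          · exact hb.2
      _ = 1 := by
          rw [mul_one, mul_one, ← ENNReal.ofReal_add (by positivity) (by positivity), ← add_div,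
            div_self (by positivity), ENNReal.ofReal_one]
  have := csInf_le (luxemburgSet_bddBelow r μ (f + g)) hab
  linarith

theorem luxemburgNorm_smul_le {r : ℝ} (hr : 1 ≤ r) {μ : Measure Ω} {f : Ω → ℝ}
    (hf : MemOrliczHeart r μ f) (k : ℝ) (hk : k ≠ 0) :
    luxemburgNorm r μ (k • f) ≤ |k| * luxemburgNorm r μ f := by
  have hk' : 0 < |k| := abs_pos.2 hk
  rw [mul_comm, ← div_le_iff₀ hk']
  refine le_csInf (luxemburgSet_nonempty hr hf) fun c hc => ?_
  rw [div_le_iff₀ hk', mul_comm]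
  refine csInf_le (luxemburgSet_bddBelow r μ _) ⟨mul_pos hk' hc.1, ?_⟩
  rw [orliczModular_smul hk]
  exact hc.2

theorem luxemburgNorm_zero {r : ℝ} (hr : 1 ≤ r) {μ : Measure Ω} :
    luxemburgNorm r μ (0 : Ω → ℝ) = 0 := by
  refine le_antisymm (le_of_forall_pos_le_add fun ε hε => ?_) (luxemburgNorm_nonneg _ _ _)
  rw [zero_add]
  refine csInf_le (luxemburgSet_bddBelow r μ _) ⟨hε, ?_⟩
  rw [orliczModular_zero hr]
  exact zero_le_one

theorem luxemburgNorm_smul {r : ℝ} (hr : 1 ≤ r) {μ : Measure Ω} {f : Ω → ℝ}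
    (hf : MemOrliczHeart r μ f) (k : ℝ) :
    luxemburgNorm r μ (k • f) = |k| * luxemburgNorm r μ f := by
  rcases eq_or_ne k 0 with rfl | hk
  · rw [zero_smul, luxemburgNorm_zero hr, abs_zero, zero_mul]
  · refine le_antisymm (luxemburgNorm_smul_le hr hf k hk) ?_
    have h := luxemburgNorm_smul_le hr (hf.smul hr k) k⁻¹ (inv_ne_zero hk)
    rw [smul_smul, inv_mul_cancel₀ hk, one_smul, abs_inv] at h
    have hk' : 0 < |k| := abs_pos.2 hk
    calc |k| * luxemburgNorm r μ f ≤ |k| * (|k|⁻¹ * luxemburgNorm r μ (k • f)) := by gcongr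
      _ = luxemburgNorm r μ (k • f) := by field_simp

theorem ae_eq_zero_of_luxemburgNorm_eq_zero {r : ℝ} (hr : 1 ≤ r) {μ : Measure Ω} {f : Ω → ℝ}
    (hf : MemOrliczHeart r μ f) (h : luxemburgNorm r μ f = 0) : f =ᵐ[μ] 0 := by
  have hsmall : ∀ ε : ℝ, 0 < ε → ε ≤ 1 → orliczModular r μ f 1 ≤ ENNReal.ofReal ε := by
    intro ε hε hε1
    obtain ⟨c, hc, hc'⟩ := Real.lt_sInf_add_pos (luxemburgSet_nonempty hr hf) hε
    have hcε : c < ε := by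
      have : sInf {c : ℝ | 0 < c ∧ orliczModular r μ f c ≤ 1} = 0 := h
      linarith
    have h1 := orliczModular_div_le (f := f) (μ := μ) hr hc.1 hc.1 (hcε.le.trans hε1)
    rw [div_self hc.1.ne'] at h1
    calc orliczModular r μ f 1 ≤ ENNReal.ofReal c * orliczModular r μ f c := h1
      _ ≤ ENNReal.ofReal c * 1 := by gcongr; exact hc.2
      _ ≤ ENNReal.ofReal ε := by rw [mul_one]; exact ENNReal.ofReal_le_ofReal hcε.le
  have hzero : orliczModular r μ f 1 = 0 := by
    by_contra hne
    have hpos : 0 < (orliczModular r μ f 1).toReal :=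
      ENNReal.toReal_pos hne (hf.2 1 one_pos).ne
    have h2 := hsmall (min 1 ((orliczModular r μ f 1).toReal / 2)) (by positivity)
      (min_le_left _ _)
    have h3 := ENNReal.toReal_le_of_le_ofReal (by positivity) h2
    have h4 := min_le_right 1 ((orliczModular r μ f 1).toReal / 2)
    linarith
  unfold orliczModular at hzero
  have hmeas : AEMeasurable (fun x => ENNReal.ofReal (youngFun r (|f x| / 1))) μ :=
    AEMeasurable.ennreal_ofReal ((youngFun_measurable r).comp_aemeasurable
      ((continuous_abs.measurable.comp_aemeasurable hf.1.aemeasurable).div_const 1))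
  rw [lintegral_eq_zero_iff' hmeas] at hzero
  filter_upwards [hzero] with x hx
  by_contra hne
  have hpos : 0 < |f x| / 1 := by
    rw [div_one]
    exact abs_pos.2 hne
  have h5 := youngFun_pos (r := r) hpos
  simp only [Pi.zero_apply, ENNReal.ofReal_eq_zero] at hx
  linarith

/-- The Orlicz heart `E^{φ_r}(μ)`, as a space of almost-everywhere classes of functions. -/
def OrliczHeart (r : ℝ) (hr : 1 ≤ r) (μ : Measure Ω) : Submodule ℝ (Ω →ₘ[μ] ℝ) where
  carrier := {f | MemOrliczHeart r μ f}
  zero_mem' := (memOrliczHeart_zero hr).congr AEEqFun.coeFn_zero.symm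
  add_mem' {f g} hf hg :=
    (MemOrliczHeart.add hr hf hg).congr (AEEqFun.coeFn_add f g).symm
  smul_mem' k f hf := (MemOrliczHeart.smul hr hf k).congr (AEEqFun.coeFn_smul k f).symm

noncomputable instance (r : ℝ) (hr : 1 ≤ r) (μ : Measure Ω) : Norm (OrliczHeart r hr μ) :=
  ⟨fun f => luxemburgNorm r μ f.1⟩

theorem orliczHeart_core (r : ℝ) (hr : 1 ≤ r) (μ : Measure Ω) :
    NormedSpace.Core ℝ (OrliczHeart r hr μ) where
  norm_nonneg f := luxemburgNorm_nonneg r μ f.1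
  norm_smul k f := by
    change luxemburgNorm r μ (k • f).1 = |k| * luxemburgNorm r μ f.1
    rw [← luxemburgNorm_smul hr f.2]
    exact luxemburgNorm_congr (AEEqFun.coeFn_smul k f.1)
  norm_triangle f g := by
    change luxemburgNorm r μ (f + g).1 ≤ luxemburgNorm r μ f.1 + luxemburgNorm r μ g.1
    refine le_trans (le_of_eq ?_) (luxemburgNorm_add_le hr f.2 g.2)
    exact luxemburgNorm_congr (AEEqFun.coeFn_add f.1 g.1)
  norm_eq_zero_iff f := by
    change luxemburgNorm r μ f.1 = 0 ↔ f = 0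
    constructor
    · intro h
      apply Subtype.ext
      apply AEEqFun.ext
      exact (ae_eq_zero_of_luxemburgNorm_eq_zero hr f.2 h).trans AEEqFun.coeFn_zero.symm
    · rintro rfl
      rw [← luxemburgNorm_zero (μ := μ) hr]
      exact luxemburgNorm_congr AEEqFun.coeFn_zero

/-- The Orlicz heart carries the Luxemburg norm. -/
noncomputable instance (r : ℝ) (hr : 1 ≤ r) (μ : Measure Ω) :
    NormedAddCommGroup (OrliczHeart r hr μ) :=
  NormedAddCommGroup.ofCore (orliczHeart_core r hr μ)

noncomputable instance (r : ℝ) (hr : 1 ≤ r) (μ : Measure Ω) :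
    NormedSpace ℝ (OrliczHeart r hr μ) :=
  NormedSpace.ofCore (orliczHeart_core r hr μ)

open Classical in
/-- The element of the Orlicz heart represented by the function `f`. The value is `0` when `f` does
not belong to the Orlicz heart. -/
noncomputable def toOrliczHeart (r : ℝ) (hr : 1 ≤ r) (μ : Measure Ω) (f : Ω → ℝ) :
    OrliczHeart r hr μ :=
  if h : MemOrliczHeart r μ f then
    ⟨AEEqFun.mk f h.1, h.congr (AEEqFun.coeFn_mk f h.1).symm⟩
  else 0

end Orlicz

section Model

variable {𝓧 𝓨 : Type*} [MeasurableSpace 𝓧] [MeasurableSpace 𝓨]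

/-- The composite parameter `α = -1 / (θ (1 - β))`. -/
noncomputable def alphaOf (β θ : ℝ) : ℝ := -(1 / (θ * (1 - β)))

/-- The continuation value operator
`T f(x) = β log E^Q[exp(f(X_{t+1}) + α u(X_t, X_{t+1})) | X_t = x]` on functions. -/
noncomputable def recursionOp (Q : Kernel 𝓧 𝓧) (u : 𝓧 × 𝓧 → ℝ) (α β : ℝ) (f : 𝓧 → ℝ) (x : 𝓧) : ℝ :=
  β * Real.log (∫ x', Real.exp (f x' + α * u (x, x')) ∂(Q x))

/-- The continuation value operator `((α, β), f) ↦ T f` as a map into the Orlicz heart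
`E^{φ_s}(Q₀)`. If `u` belongs to the Orlicz heart `E^{φ_s}` of the law of `(X_t, X_{t+1})`, then the
function `T f` does belong to `E^{φ_s}(Q₀)`, so that the default value of `toOrliczHeart` is not
used. -/
noncomputable def recursionMap (s : ℝ) (hs : 1 ≤ s) (Q₀ : Measure 𝓧) (Q : Kernel 𝓧 𝓧)
    (u : 𝓧 × 𝓧 → ℝ) (p : (ℝ × ℝ) × OrliczHeart s hs Q₀) : OrliczHeart s hs Q₀ :=
  toOrliczHeart s hs Q₀ (recursionOp Q u p.1.1 p.1.2 p.2.1)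

/-- `F` is continuously Fréchet differentiable at `p`: it is Fréchet differentiable in a neighborhood
of `p`, and the derivative is continuous at `p` in the operator norm. -/
def ContFrechetDifferentiableAt {E G : Type*} [NormedAddCommGroup E] [NormedSpace ℝ E]
    [NormedAddCommGroup G] [NormedSpace ℝ G] (F : E → G) (p : E) : Prop :=
  (∀ᶠ q in 𝓝 p, DifferentiableAt ℝ F q) ∧ ContinuousAt (fderiv ℝ F) p

/-- `v` is a continuation value for the parameters `(α, β)`: it belongs to `E^{φ_r}(Q₀)` and solves
`v = T v`. -/
def IsContinuationValue (r : ℝ) (Q₀ : Measure 𝓧) (Q : Kernel 𝓧 𝓧) (u : 𝓧 × 𝓧 → ℝ) (α β : ℝ)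
    (v : 𝓧 → ℝ) : Prop :=
  Measurable v ∧ MemOrliczHeart r Q₀ v ∧ v =ᵐ[Q₀] recursionOp Q u α β v

open Classical in
/-- The continuation value `v_{(α, β)}` (determined up to `Q₀`-null sets). -/
noncomputable def continuationValue (r : ℝ) (Q₀ : Measure 𝓧) (Q : Kernel 𝓧 𝓧) (u : 𝓧 × 𝓧 → ℝ)
    (α β : ℝ) : 𝓧 → ℝ :=
  if h : ∃ v, IsContinuationValue r Q₀ Q u α β v then h.choose else 0

/-- The worst-case belief distortion
`m_v(x, x') = exp(v(x') + α u(x, x')) / E^Q[exp(v(X_{t+1}) + α u(X_t, X_{t+1})) | X_t = x]`. -/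
noncomputable def worstCaseDistortion (Q : Kernel 𝓧 𝓧) (u : 𝓧 × 𝓧 → ℝ) (α : ℝ) (v : 𝓧 → ℝ)
    (p : 𝓧 × 𝓧) : ℝ :=
  Real.exp (v p.2 + α * u p) / ∫ x', Real.exp (v x' + α * u (p.1, x')) ∂(Q p.1)

/-- The conditional moment restriction `E^Q[m*_{t+1} β g(X_t, X_{t+1}, Y_{t+1}) - 1 | X_t] = 0` under
the worst-case model for the parameters `(β, θ)`, where `m*_{t+1} = m_v(X_t, X_{t+1})` for the
continuation value `v`. Given `X_t = x`, the state `X_{t+1}` has law `Q x`, and given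
`(X_t, X_{t+1}) = p`, the variable `Y_{t+1}` has law `R p`. -/
def MomentRestriction {d : ℕ} (r : ℝ) (Q₀ : Measure 𝓧) (Q : Kernel 𝓧 𝓧) (R : Kernel (𝓧 × 𝓧) 𝓨)
    (u : 𝓧 × 𝓧 → ℝ) (g : (𝓧 × 𝓧) × 𝓨 → Fin d → ℝ) (β θ : ℝ) : Prop :=
  ∃ v : 𝓧 → ℝ, IsContinuationValue r Q₀ Q u (alphaOf β θ) β v ∧
    ∀ᵐ x ∂Q₀, ∀ i : Fin d,
      Integrable (fun z : 𝓧 × 𝓨 => worstCaseDistortion Q u (alphaOf β θ) v (x, z.1) *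
        (β * g ((x, z.1), z.2) i)) ((Q ⊗ₖ R) x) ∧
      ∫ z : 𝓧 × 𝓨, (worstCaseDistortion Q u (alphaOf β θ) v (x, z.1) *
        (β * g ((x, z.1), z.2) i) - 1) ∂((Q ⊗ₖ R) x) = 0

/-- Given the benchmark model and the period utility, the parameters `(β, θ)` and `(β', θ')` are
observationally equivalent if the conditional moment restriction holds under both. -/
def ObservationallyEquivalent {d : ℕ} (r : ℝ) (Q₀ : Measure 𝓧) (Q : Kernel 𝓧 𝓧)
    (R : Kernel (𝓧 × 𝓧) 𝓨) (u : 𝓧 × 𝓧 → ℝ) (g : (𝓧 × 𝓧) × 𝓨 → Fin d → ℝ) (p p' : ℝ × ℝ) : Prop :=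
  MomentRestriction r Q₀ Q R u g p.1 p.2 ∧ MomentRestriction r Q₀ Q R u g p'.1 p'.2

/-- `p₀ = (β₀, θ₀)` is locally identified: some neighborhood of it in `(0, 1) × (0, ∞)` contains no
other parameter that is observationally equivalent to it. -/
def LocallyIdentified {d : ℕ} (r : ℝ) (Q₀ : Measure 𝓧) (Q : Kernel 𝓧 𝓧)
    (R : Kernel (𝓧 × 𝓧) 𝓨) (u : 𝓧 × 𝓧 → ℝ) (g : (𝓧 × 𝓧) × 𝓨 → Fin d → ℝ) (p₀ : ℝ × ℝ) : Prop :=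
  ∃ N ∈ 𝓝 p₀, N ⊆ Ioo 0 1 ×ˢ Ioi 0 ∧
    ∀ p ∈ N, p ≠ p₀ → ¬ ObservationallyEquivalent r Q₀ Q R u g p p₀

/-- `g_{t+1} = E^Q[g(X_t, X_{t+1}, Y_{t+1}) | X_t, X_{t+1}]`. -/
noncomputable def condMoment {d : ℕ} (R : Kernel (𝓧 × 𝓧) 𝓨) (g : (𝓧 × 𝓧) × 𝓨 → Fin d → ℝ)
    (i : Fin d) (p : 𝓧 × 𝓧) : ℝ :=
  ∫ y, g (p, y) i ∂(R p)

/-- The worst-case conditional expectation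
`E_v[h(X_t, X_{t+1}) | X_t = x] = E^Q[m_v(X_t, X_{t+1}) h(X_t, X_{t+1}) | X_t = x]`. -/
noncomputable def worstCaseExp (Q : Kernel 𝓧 𝓧) (u : 𝓧 × 𝓧 → ℝ) (α : ℝ) (v : 𝓧 → ℝ)
    (h : 𝓧 × 𝓧 → ℝ) (x : 𝓧) : ℝ :=
  ∫ x', worstCaseDistortion Q u α v (x, x') * h (x, x') ∂(Q x)

/-- The iterated worst-case conditional expectation: `iterWorstCaseExp Q u α v h n` is `E_v^{n+1} h`,
where `E_v^1 h(x) = E_v[h(X_t, X_{t+1}) | X_t = x]` and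
`E_v^{n+1} h(x) = E_v[E_v^n h(X_{t+1}) | X_t = x]`. -/
noncomputable def iterWorstCaseExp (Q : Kernel 𝓧 𝓧) (u : 𝓧 × 𝓧 → ℝ) (α : ℝ) (v : 𝓧 → ℝ)
    (h : 𝓧 × 𝓧 → ℝ) : ℕ → 𝓧 → ℝ
  | 0 => worstCaseExp Q u α v h
  | n + 1 => worstCaseExp Q u α v (fun p => iterWorstCaseExp Q u α v h n p.2)

/-- The discounted sum `∑_{n ≥ 1} β^n E_v^n h(x)`. -/
noncomputable def discountedSum (Q : Kernel 𝓧 𝓧) (u : 𝓧 × 𝓧 → ℝ) (α β : ℝ) (v : 𝓧 → ℝ)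
    (h : 𝓧 × 𝓧 → ℝ) (x : 𝓧) : ℝ :=
  ∑' n : ℕ, β ^ (n + 1) * iterWorstCaseExp Q u α v h n x

/-- The derivative with respect to `α` of the `i`-th component of the conditional moment map,
`E_v[(β g_{t+1} - 1) (u(X_t, X_{t+1}) + ∑_{n ≥ 1} β^n E_v^n u(X_{t+1})) | X_t = x]`. -/
noncomputable def momentDerivAlpha {d : ℕ} (Q : Kernel 𝓧 𝓧) (R : Kernel (𝓧 × 𝓧) 𝓨)
    (u : 𝓧 × 𝓧 → ℝ) (g : (𝓧 × 𝓧) × 𝓨 → Fin d → ℝ) (α β : ℝ) (v : 𝓧 → ℝ) (i : Fin d) (x : 𝓧) : ℝ :=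
  worstCaseExp Q u α v
    (fun p => (β * condMoment R g i p - 1) * (u p + discountedSum Q u α β v u p.2)) x

/-- The derivative with respect to `β` of the `i`-th component of the conditional moment map,
`β⁻¹ (E_v[(β g_{t+1} - 1) (v(X_{t+1}) + ∑_{n ≥ 1} β^n E_v^n v(X_{t+1})) | X_t = x] + 1)`; here `v` is
read as the function `(x, x') ↦ v(x')`. -/
noncomputable def momentDerivBeta {d : ℕ} (Q : Kernel 𝓧 𝓧) (R : Kernel (𝓧 × 𝓧) 𝓨)
    (u : 𝓧 × 𝓧 → ℝ) (g : (𝓧 × 𝓧) × 𝓨 → Fin d → ℝ) (α β : ℝ) (v : 𝓧 → ℝ) (i : Fin d) (x : 𝓧) : ℝ :=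
  β⁻¹ * (worstCaseExp Q u α v
    (fun p => (β * condMoment R g i p - 1) *
      (v p.2 + discountedSum Q u α β v (fun q => v q.2) p.2)) x + 1)

/-- The matrix `E^{Q₀}[D(X_t) D(X_t)']`, where the two rows of the `2 × d` matrix `D(x)` are the
derivatives of the conditional moment map with respect to `α` and `β`. -/
noncomputable def momentMatrix {d : ℕ} (Q₀ : Measure 𝓧) (Q : Kernel 𝓧 𝓧) (R : Kernel (𝓧 × 𝓧) 𝓨)
    (u : 𝓧 × 𝓧 → ℝ) (g : (𝓧 × 𝓧) × 𝓨 → Fin d → ℝ) (α β : ℝ) (v : 𝓧 → ℝ) :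
    Matrix (Fin 2) (Fin 2) ℝ :=
  let D : 𝓧 → Matrix (Fin 2) (Fin d) ℝ := fun x =>
    Matrix.of ![fun i => momentDerivAlpha Q R u g α β v i x,
      fun i => momentDerivBeta Q R u g α β v i x]
  Matrix.of fun a b => ∫ x, (D x * (D x).transpose) a b ∂Q₀

end Model

end WorstCase

open WorstCase

namespace WorstCase

/-! ### Orlicz hearts: exponential moments and comparison of norms. -/

section OrliczLemmas

variable {Ω Ω' : Type*} [MeasurableSpace Ω] [MeasurableSpace Ω']

/-! If `(β₀, θ₀)` is not locally identified, observationally equivalent parameters accumulate at it,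
and their images `q = (α, β)` accumulate at `q₀ = (α₀, β₀)` without meeting it. The restriction
holds at each such `q` with its own continuation value `v_q`. Dividing its increments by `‖q - q₀‖`
and passing to a limit direction `e ≠ 0` gives `e₁ ∂_α ρ + e₂ ∂_β ρ = 0` almost everywhere. The rows
of `D` are then proportional and the moment matrix is singular.

This needs `v_q` to be differentiable in `q` at `q₀`. The derivative of the recursion in `f` at `v₀`
is `β₀ E_{v₀}`, so the implicit function theorem applies once `1 - β₀ E_{v₀}` is invertible on
`E^{φ_s}`. The worst-case expectation need not be a contraction there, since the distorted law does
not in general preserve `Q₀`. But Jensen's inequality under the distorted law, followed by Hölder's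
inequality with exponent `2n` against the distortion, bounds its `n`-th iterate by a polynomial in
`n` (`exists_stateExp_iterate_bound`). This is where `s > 1` enters: the log-distortion lies in
`E^{φ_s}`, so `E exp(N |κ|)` is at most a constant times the exponential of a power of `N`.
Discounting by `β₀ ^ n` makes the Neumann series converge, and its terms are the discounted sums in
the derivative formulas (`exists_continuationValue_branch`).

The same bound gives uniqueness of fixed points (`recursionOp_fixedPoint_unique`), which places
every nearby `v_q` on the differentiable branch.

The moment map itself is never differentiated as a map between function spaces. A convergent
sequence in an Orlicz heart has a subsequence converging almost everywhere under a majorant in the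
heart, so the limit is taken by dominated convergence for almost every fixed `x`
(`exists_direction_of_momentEquation`). The derivative of the recursion is identified by the same
device (`fderiv_recursionMap_coe`). -/

theorem le_one_add_rpow {s t : ℝ} (hs : 1 ≤ s) (ht : 0 ≤ t) : t ≤ 1 + t ^ s := by
  rcases le_total t 1 with h | h
  · have := Real.rpow_nonneg ht s
    linarith
  · have := Real.self_le_rpow_of_one_le h hs
    linarith

theorem aemeasurable_youngFun {s : ℝ} {μ : Measure Ω} {f : Ω → ℝ}
    (hf : AEStronglyMeasurable f μ) (c : ℝ) :
    AEMeasurable (fun x => ENNReal.ofReal (youngFun s (|f x| / c))) μ :=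
  AEMeasurable.ennreal_ofReal ((youngFun_measurable s).comp_aemeasurable
    ((continuous_abs.measurable.comp_aemeasurable hf.aemeasurable).div_const c))

theorem orliczModular_mono {s : ℝ} (hs : 1 ≤ s) {μ : Measure Ω} {f g : Ω → ℝ}
    (h : ∀ᵐ x ∂μ, |f x| ≤ |g x|) {c c' : ℝ} (hc : 0 < c) (hcc : c ≤ c') :
    orliczModular s μ f c' ≤ orliczModular s μ g c := by
  unfold orliczModular
  apply lintegral_mono_ae
  filter_upwards [h] with x hx
  apply ENNReal.ofReal_le_ofReal
  apply youngFun_mono hs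
  · have : 0 < c' := by linarith
    positivity
  · gcongr

theorem MemOrliczHeart.mono {s : ℝ} (hs : 1 ≤ s) {μ : Measure Ω} {f g : Ω → ℝ}
    (hg : MemOrliczHeart s μ g) (hf : AEStronglyMeasurable f μ) (h : ∀ᵐ x ∂μ, |f x| ≤ |g x|) :
    MemOrliczHeart s μ f :=
  ⟨hf, fun c hc => (orliczModular_mono hs h hc le_rfl).trans_lt (hg.2 c hc)⟩

theorem MemOrliczHeart.abs {s : ℝ} (hs : 1 ≤ s) {μ : Measure Ω} {f : Ω → ℝ}
    (hf : MemOrliczHeart s μ f) : MemOrliczHeart s μ (fun x => |f x|) :=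
  hf.mono hs (continuous_abs.comp_aestronglyMeasurable hf.1) (by simp)

theorem MemOrliczHeart.sum {s : ℝ} (hs : 1 ≤ s) {μ : Measure Ω} {ι : Type*} (t : Finset ι)
    {f : ι → Ω → ℝ} (hf : ∀ i ∈ t, MemOrliczHeart s μ (f i)) :
    MemOrliczHeart s μ (fun x => ∑ i ∈ t, f i x) := by
  classical
  induction t using Finset.induction_on with
  | empty => exact memOrliczHeart_zero hs
  | insert a t ha ih =>
    simp only [Finset.sum_insert ha]
    exact (hf a (by simp)).add hs (ih fun i hi => hf i (by simp [hi]))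

/-- The summand 1 is the total mass. Pure exponentials are compatible with products, powers and
Hölder's inequality, so the later estimates use them in place of the modular. -/
theorem lintegral_exp_rpow {s : ℝ} {μ : Measure Ω} [IsProbabilityMeasure μ]
    {f : Ω → ℝ} {c : ℝ} (hc : 0 < c) :
    ∫⁻ x, ENNReal.ofReal (Real.exp ((|f x| / c) ^ s)) ∂μ = orliczModular s μ f c + 1 := by
  unfold orliczModular
  have h1 : (1 : ℝ≥0∞) = ∫⁻ _, 1 ∂μ := by simp
  rw [h1, ← lintegral_add_right _ measurable_const]
  apply lintegral_congr
  intro x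
  have h := youngFun_nonneg (r := s) (t := |f x| / c) (by positivity)
  rw [← ENNReal.ofReal_one, ← ENNReal.ofReal_add h zero_le_one]
  simp [youngFun]

theorem MemOrliczHeart.lintegral_exp_rpow_lt_top {s : ℝ} (hs : 1 ≤ s) {μ : Measure Ω}
    [IsProbabilityMeasure μ] {f : Ω → ℝ} (hf : MemOrliczHeart s μ f) {K : ℝ} (hK : 0 < K) :
    ∫⁻ x, ENNReal.ofReal (Real.exp (K * |f x| ^ s)) ∂μ < ∞ := by
  -- The scale `c = K ^ (-1/s)` turns `(|f| / c) ^ s` into `K |f| ^ s`.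
  have h0 : 0 < K ^ (-(1 / s)) := Real.rpow_pos_of_pos hK _
  have h := hf.2 _ h0
  have h1 := lintegral_exp_rpow (s := s) (μ := μ) (f := f) h0
  have h2 : ∀ x, (|f x| / K ^ (-(1 / s))) ^ s = K * |f x| ^ s := by
    intro x
    rw [Real.div_rpow (abs_nonneg _) h0.le, ← Real.rpow_mul hK.le]
    have : -(1 / s) * s = -1 := by field_simp
    rw [this, Real.rpow_neg_one, div_inv_eq_mul, mul_comm]
  simp only [h2] at h1
  rw [h1]
  exact ENNReal.add_lt_top.2 ⟨h, ENNReal.one_lt_top⟩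

theorem memOrliczHeart_of_lintegral_exp_rpow_lt_top {s : ℝ} {μ : Measure Ω}
    [IsProbabilityMeasure μ] {f : Ω → ℝ} (hf : AEStronglyMeasurable f μ) (K₀ : ℝ)
    (h : ∀ K : ℝ, K₀ ≤ K → ∫⁻ x, ENNReal.ofReal (Real.exp (K * |f x| ^ s)) ∂μ < ∞) :
    MemOrliczHeart s μ f := by
  refine ⟨hf, fun c hc => ?_⟩
  have h1 := lintegral_exp_rpow (s := s) (μ := μ) (f := f) hc
  refine lt_of_le_of_lt (le_self_add (b := (1 : ℝ≥0∞))) ?_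
  rw [← h1]
  refine lt_of_le_of_lt (lintegral_mono fun x => ?_) (h (max K₀ ((c ^ s)⁻¹)) (le_max_left _ _))
  apply ENNReal.ofReal_le_ofReal
  apply Real.exp_le_exp.2
  rw [Real.div_rpow (abs_nonneg _) hc.le, div_eq_inv_mul]
  gcongr
  exact le_max_right _ _

/-- Pointwise `c |f| ≤ 1 + ((|c| + 1) |f|) ^ s`, and the rescaled function is still in the heart. -/
theorem MemOrliczHeart.integrable_exp {s : ℝ} (hs : 1 ≤ s) {μ : Measure Ω}
    [IsProbabilityMeasure μ] {f : Ω → ℝ} (hf : MemOrliczHeart s μ f) (c : ℝ) :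
    Integrable (fun x => Real.exp (c * |f x|)) μ := by
  have hm : AEStronglyMeasurable (fun x => Real.exp (c * |f x|)) μ :=
    (Real.continuous_exp.comp (continuous_const.mul continuous_abs)).comp_aestronglyMeasurable hf.1
  refine ⟨hm, ?_⟩
  rw [hasFiniteIntegral_iff_ofReal (Eventually.of_forall fun x => (Real.exp_pos _).le)]
  have h := (hf.smul hs (|c| + 1)).lintegral_exp_rpow_lt_top hs one_pos
  refine lt_of_le_of_lt (lintegral_mono (g := fun x => ENNReal.ofReal (Real.exp 1) *
      ENNReal.ofReal (Real.exp (1 * |((|c| + 1) • f) x| ^ s))) fun x => ?_) ?_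
  · beta_reduce
    rw [← ENNReal.ofReal_mul (Real.exp_pos _).le, ← Real.exp_add]
    apply ENNReal.ofReal_le_ofReal
    apply Real.exp_le_exp.2
    simp only [Pi.smul_apply, smul_eq_mul, one_mul]
    refine le_trans ?_ (le_one_add_rpow hs (abs_nonneg _))
    rw [abs_mul, abs_of_pos (by positivity : 0 < |c| + 1)]
    have := le_abs_self c
    gcongr
    linarith
  · rw [lintegral_const_mul' _ _ ENNReal.ofReal_ne_top]
    exact ENNReal.mul_lt_top ENNReal.ofReal_lt_top h

/-- For `t ≥ 0` one has `t ^ s ≤ 1 + t ^ r`, which costs only a factor `e`. -/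
theorem MemOrliczHeart.of_le {r s : ℝ} (hs : 1 ≤ s) (hsr : s ≤ r) {μ : Measure Ω}
    [IsProbabilityMeasure μ] {f : Ω → ℝ} (hf : MemOrliczHeart r μ f) : MemOrliczHeart s μ f := by
  refine ⟨hf.1, fun c hc => ?_⟩
  have h := hf.2 c hc
  refine lt_of_le_of_lt (le_self_add (b := (1 : ℝ≥0∞))) ?_
  rw [← lintegral_exp_rpow (s := s) (μ := μ) (f := f) hc]
  have h1 := lintegral_exp_rpow (s := r) (μ := μ) (f := f) hc
  refine lt_of_le_of_lt (lintegral_mono (g := fun x => ENNReal.ofReal (Real.exp 1) *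
    ENNReal.ofReal (Real.exp ((|f x| / c) ^ r))) fun x => ?_) ?_
  · beta_reduce
    rw [← ENNReal.ofReal_mul (Real.exp_pos _).le, ← Real.exp_add]
    apply ENNReal.ofReal_le_ofReal
    apply Real.exp_le_exp.2
    rcases le_total (|f x| / c) 1 with h | h
    · have h2 := Real.rpow_le_one (by positivity) h (by linarith : 0 ≤ s)
      have h3 : 0 ≤ (|f x| / c) ^ r := by positivity
      linarith
    · have := Real.rpow_le_rpow_of_exponent_le h hsr
      linarith
  · rw [lintegral_const_mul' _ _ ENNReal.ofReal_ne_top, h1]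
    exact ENNReal.mul_lt_top ENNReal.ofReal_lt_top (ENNReal.add_lt_top.2 ⟨h, ENNReal.one_lt_top⟩)

theorem MemOrliczHeart.comp_measurePreserving {s : ℝ} {μ : Measure Ω} {ν : Measure Ω'}
    {f : Ω' → ℝ} (hf : MemOrliczHeart s ν f) {T : Ω → Ω'} (hT : MeasurePreserving T μ ν) :
    MemOrliczHeart s μ (f ∘ T) := by
  refine ⟨hf.1.comp_measurePreserving hT, fun c hc => ?_⟩
  have h := hf.2 c hc
  unfold orliczModular at h ⊢
  rw [← hT.map_eq, lintegral_map' ] at h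
  · exact h
  · rw [hT.map_eq]; exact aemeasurable_youngFun hf.1 c
  · exact hT.aemeasurable

theorem orliczModular_le_one_of_lt {s : ℝ} (hs : 1 ≤ s) {μ : Measure Ω} {f : Ω → ℝ}
    (hf : MemOrliczHeart s μ f) {c : ℝ} (hc : luxemburgNorm s μ f < c) :
    orliczModular s μ f c ≤ 1 := by
  obtain ⟨a, ha, hac⟩ := exists_lt_of_csInf_lt (luxemburgSet_nonempty hs hf) hc
  exact (orliczModular_mono hs (by simp) ha.1 hac.le).trans ha.2

theorem luxemburgNorm_le {s : ℝ} {μ : Measure Ω} {f : Ω → ℝ} {c : ℝ} (hc : 0 < c)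
    (h : orliczModular s μ f c ≤ 1) : luxemburgNorm s μ f ≤ c :=
  csInf_le (luxemburgSet_bddBelow s μ f) ⟨hc, h⟩

theorem luxemburgNorm_mono {s : ℝ} (hs : 1 ≤ s) {μ : Measure Ω} {f g : Ω → ℝ}
    (hg : MemOrliczHeart s μ g) (h : ∀ᵐ x ∂μ, |f x| ≤ |g x|) :
    luxemburgNorm s μ f ≤ luxemburgNorm s μ g :=
  le_csInf (luxemburgSet_nonempty hs hg) fun _ hc =>
    luxemburgNorm_le hc.1 ((orliczModular_mono hs h hc.1 le_rfl).trans hc.2)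

/-- With `y = |f| / c`, one has `y ≤ 1 + y ^ s ≤ exp (y ^ s)`, and the integral of the last term is
at most 2. -/
theorem lintegral_abs_le {s : ℝ} (hs : 1 ≤ s) {μ : Measure Ω} [IsProbabilityMeasure μ]
    {f : Ω → ℝ} {c : ℝ} (hc : 0 < c) (h : orliczModular s μ f c ≤ 1) :
    ∫⁻ x, ENNReal.ofReal |f x| ∂μ ≤ ENNReal.ofReal (2 * c) := by
  have h1 := lintegral_exp_rpow (s := s) (μ := μ) (f := f) hc
  have h2 : ∫⁻ x, ENNReal.ofReal |f x| ∂μ ≤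
      ∫⁻ x, ENNReal.ofReal c * ENNReal.ofReal (Real.exp ((|f x| / c) ^ s)) ∂μ := by
    apply lintegral_mono
    intro x
    beta_reduce
    rw [← ENNReal.ofReal_mul hc.le]
    apply ENNReal.ofReal_le_ofReal
    have h3 := le_one_add_rpow hs (by positivity : 0 ≤ |f x| / c)
    have h4 := Real.add_one_le_exp ((|f x| / c) ^ s)
    rw [← div_le_iff₀' hc]
    linarith
  refine h2.trans ?_
  rw [lintegral_const_mul' _ _ ENNReal.ofReal_ne_top, h1, mul_comm 2 c, ENNReal.ofReal_mul hc.le]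
  gcongr
  calc orliczModular s μ f c + 1 ≤ 1 + 1 := by gcongr
    _ = ENNReal.ofReal 2 := by norm_num

theorem toOrliczHeart_coe {s : ℝ} {hs : 1 ≤ s} {μ : Measure Ω} {f : Ω → ℝ}
    (hf : MemOrliczHeart s μ f) : ((toOrliczHeart s hs μ f).1 : Ω → ℝ) =ᵐ[μ] f := by
  unfold toOrliczHeart
  rw [dif_pos hf]
  exact AEEqFun.coeFn_mk f hf.1

theorem orliczHeart_ext {s : ℝ} {hs : 1 ≤ s} {μ : Measure Ω} {f g : OrliczHeart s hs μ}
    (h : (f.1 : Ω → ℝ) =ᵐ[μ] g.1) : f = g :=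
  Subtype.ext (AEEqFun.ext h)

theorem OrliczHeart.norm_def {s : ℝ} {hs : 1 ≤ s} {μ : Measure Ω} (f : OrliczHeart s hs μ) :
    ‖f‖ = luxemburgNorm s μ f.1 := rfl

theorem OrliczHeart.measurable_coe {s : ℝ} {hs : 1 ≤ s} {μ : Measure Ω} (f : OrliczHeart s hs μ) :
    Measurable (f.1 : Ω → ℝ) := f.1.stronglyMeasurable.measurable

theorem OrliczHeart.coeFn_add {s : ℝ} {hs : 1 ≤ s} {μ : Measure Ω} (f g : OrliczHeart s hs μ) :
    ((f + g).1 : Ω → ℝ) =ᵐ[μ] fun x => f.1 x + g.1 x := AEEqFun.coeFn_add f.1 g.1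

theorem OrliczHeart.coeFn_sub {s : ℝ} {hs : 1 ≤ s} {μ : Measure Ω} (f g : OrliczHeart s hs μ) :
    ((f - g).1 : Ω → ℝ) =ᵐ[μ] fun x => f.1 x - g.1 x := AEEqFun.coeFn_sub f.1 g.1

theorem OrliczHeart.coeFn_smul {s : ℝ} {hs : 1 ≤ s} {μ : Measure Ω} (k : ℝ)
    (f : OrliczHeart s hs μ) :
    ((k • f).1 : Ω → ℝ) =ᵐ[μ] fun x => k * f.1 x := AEEqFun.coeFn_smul k f.1

theorem OrliczHeart.coeFn_zero {s : ℝ} {hs : 1 ≤ s} {μ : Measure Ω} :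
    ((0 : OrliczHeart s hs μ).1 : Ω → ℝ) =ᵐ[μ] fun _ => 0 := AEEqFun.coeFn_zero

theorem OrliczHeart.coeFn_sum {s : ℝ} {hs : 1 ≤ s} {μ : Measure Ω} {ι : Type*} (t : Finset ι)
    (f : ι → OrliczHeart s hs μ) :
    ((∑ i ∈ t, f i).1 : Ω → ℝ) =ᵐ[μ] fun x => ∑ i ∈ t, (f i).1 x := by
  classical
  induction t using Finset.induction_on with
  | empty => exact OrliczHeart.coeFn_zero (hs := hs)
  | insert a t ha ih =>
    rw [Finset.sum_insert ha]
    filter_upwards [OrliczHeart.coeFn_add (f a) (∑ i ∈ t, f i), ih] with x h1 h2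
    rw [h1, h2, Finset.sum_insert ha]

end OrliczLemmas

/-! ### Completeness of the Orlicz heart and dominated subsequences. -/

section RieszFischer

variable {Ω : Type*} [MeasurableSpace Ω]

theorem continuous_youngFun {s : ℝ} (hs : 1 ≤ s) : Continuous (youngFun s) := by
  unfold youngFun
  exact (Real.continuous_exp.comp (Real.continuous_rpow_const (by linarith))).sub continuous_const

theorem orliczModular_sum_range_le {s : ℝ} (hs : 1 ≤ s) {μ : Measure Ω} {g : ℕ → Ω → ℝ}
    (hg : ∀ n, AEStronglyMeasurable (g n) μ) {c : ℕ → ℝ} (hc : ∀ n, 0 < c n)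
    (h : ∀ n, orliczModular s μ (g n) (c n) ≤ 1) (M : ℕ) :
    orliczModular s μ (fun x => ∑ i ∈ Finset.range M, |g i x|) (∑ i ∈ Finset.range M, c i) ≤ 1 := by
  have habs : ∀ n, orliczModular s μ (fun x => |g n x|) (c n) ≤ 1 := fun n =>
    (orliczModular_mono hs (by simp) (hc n) le_rfl).trans (h n)
  have hm : ∀ n, AEStronglyMeasurable (fun x => |g n x|) μ := fun n =>
    continuous_abs.comp_aestronglyMeasurable (hg n)
  induction M with
  | zero =>
    simp only [Finset.range_zero, Finset.sum_empty]
    exact (orliczModular_zero hs (μ := μ) 0).le.trans zero_le_one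
  | succ M ih =>
    -- The convexity bound needs two positive scales, and the empty sum has scale 0, so the first
    -- summand is treated apart.
    rcases Nat.eq_zero_or_pos M with rfl | hM
    · simpa using habs 0
    · simp only [Finset.sum_range_succ]
      have ha : 0 < ∑ i ∈ Finset.range M, c i :=
        Finset.sum_pos (fun i _ => hc i) (Finset.nonempty_range_iff.2 hM.ne')
      have hb := hc M
      refine (orliczModular_add_le (f := fun x => ∑ i ∈ Finset.range M, |g i x|)
        (g := fun x => |g M x|) hs ?_ ha hb).trans ?_
      · exact Finset.aestronglyMeasurable_fun_sum _ fun i _ => hm i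
      · set a := ∑ i ∈ Finset.range M, c i
        set b := c M
        calc _ ≤ ENNReal.ofReal (a / (a + b)) * 1 + ENNReal.ofReal (b / (a + b)) * 1 := by
              gcongr
              exact habs M
          _ = 1 := by
              rw [mul_one, mul_one, ← ENNReal.ofReal_add (by positivity) (by positivity),
                ← add_div, div_self (by positivity), ENNReal.ofReal_one]

theorem ae_summable_of_orliczModular_le_one {s : ℝ} (hs : 1 ≤ s) {μ : Measure Ω}
    [IsProbabilityMeasure μ] {g : ℕ → Ω → ℝ}
    (hg : ∀ n, AEStronglyMeasurable (g n) μ) {c : ℕ → ℝ} (hc : ∀ n, 0 < c n)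
    (h : ∀ n, orliczModular s μ (g n) (c n) ≤ 1) (hsum : Summable c) :
    ∀ᵐ x ∂μ, Summable fun n => |g n x| := by
  have hm : ∀ n, AEMeasurable (fun x => ENNReal.ofReal |g n x|) μ := fun n =>
    (continuous_abs.comp_aestronglyMeasurable (hg n)).aemeasurable.ennreal_ofReal
  have hfin : ∫⁻ x, ∑' n, ENNReal.ofReal |g n x| ∂μ ≠ ∞ := by
    rw [lintegral_tsum hm]
    refine ne_top_of_le_ne_top ?_ (ENNReal.tsum_le_tsum fun n => lintegral_abs_le hs (hc n) (h n))
    exact (hsum.mul_left 2).tsum_ofReal_ne_top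
  filter_upwards [ae_lt_top' (AEMeasurable.tsum hm) hfin] with x hx
  have := ENNReal.summable_toReal hx.ne
  simpa [ENNReal.toReal_ofReal] using this

/-- Fatou's lemma applied to the partial sums, whose modular at the total scale is at most 1 by
convexity. -/
theorem orliczModular_tsum_le {s : ℝ} (hs : 1 ≤ s) {μ : Measure Ω}
    [IsProbabilityMeasure μ] {g : ℕ → Ω → ℝ}
    (hg : ∀ n, AEStronglyMeasurable (g n) μ) {c : ℕ → ℝ} (hc : ∀ n, 0 < c n)
    (h : ∀ n, orliczModular s μ (g n) (c n) ≤ 1) (hsum : Summable c) :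
    orliczModular s μ (fun x => ∑' n, |g n x|) (∑' n, c n) ≤ 1 := by
  have hS := ae_summable_of_orliczModular_le_one hs hg hc h hsum
  have hC : 0 < ∑' n, c n := hsum.tsum_pos (fun n => (hc n).le) 0 (hc 0)
  have hm : ∀ n, AEStronglyMeasurable (fun x => |g n x|) μ := fun n =>
    continuous_abs.comp_aestronglyMeasurable (hg n)
  set F : ℕ → Ω → ℝ≥0∞ := fun M x =>
    ENNReal.ofReal (youngFun s (|(∑ i ∈ Finset.range M, |g i x|)| / ∑' n, c n))
  have hF : ∀ M, ∫⁻ x, F M x ∂μ ≤ 1 := by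
    intro M
    rcases Nat.eq_zero_or_pos M with rfl | hM
    · simp [F, youngFun_zero hs]
    · have ha : 0 < ∑ i ∈ Finset.range M, c i :=
        Finset.sum_pos (fun i _ => hc i) (Finset.nonempty_range_iff.2 hM.ne')
      refine le_trans ?_ (orliczModular_sum_range_le hs hg hc h M)
      exact orliczModular_mono hs (by simp) ha (hsum.sum_le_tsum _ fun i _ => (hc i).le)
  have hFm : ∀ M, AEMeasurable (F M) μ := fun M =>
    aemeasurable_youngFun (f := fun x => ∑ i ∈ Finset.range M, |g i x|)
      (Finset.aestronglyMeasurable_fun_sum _ fun i _ => hm i) _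
  unfold orliczModular
  calc ∫⁻ x, ENNReal.ofReal (youngFun s (|(∑' n, |g n x|)| / ∑' n, c n)) ∂μ
      = ∫⁻ x, liminf (fun M => F M x) atTop ∂μ := by
        apply lintegral_congr_ae
        filter_upwards [hS] with x hx
        have h1 : Tendsto (fun M => ∑ i ∈ Finset.range M, |g i x|) atTop (𝓝 (∑' n, |g n x|)) :=
          hx.hasSum.tendsto_sum_nat
        have h2 : Continuous fun y : ℝ => ENNReal.ofReal (youngFun s (|y| / ∑' n, c n)) :=
          ENNReal.continuous_ofReal.comp ((continuous_youngFun hs).comp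
            (continuous_abs.div_const _))
        exact ((h2.tendsto _).comp h1).liminf_eq.symm
    _ ≤ liminf (fun M => ∫⁻ x, F M x ∂μ) atTop := lintegral_liminf_le' hFm
    _ ≤ 1 := by
        refine (liminf_le_liminf (Eventually.of_forall hF)).trans ?_
        simp

/-- The geometric slack gives positive, summable scales strictly above the norms; at such scales the
modular is at most 1 whether or not the infimum in the norm is attained. -/
theorem summable_norm_add_geometric {E : Type*} [SeminormedAddCommGroup E] {f : ℕ → E}
    (hf : Summable fun n => ‖f n‖) : Summable fun n => ‖f n‖ + (1 / 2 : ℝ) ^ n :=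
  hf.add summable_geometric_two

theorem OrliczHeart.modular_norm_add_le {s : ℝ} {hs : 1 ≤ s} {μ : Measure Ω}
    (f : OrliczHeart s hs μ) {ε : ℝ} (hε : 0 < ε) : orliczModular s μ f.1 (‖f‖ + ε) ≤ 1 :=
  orliczModular_le_one_of_lt hs f.2 (by rw [← OrliczHeart.norm_def]; linarith)

theorem OrliczHeart.ae_summable {s : ℝ} {hs : 1 ≤ s} {μ : Measure Ω} [IsProbabilityMeasure μ]
    {f : ℕ → OrliczHeart s hs μ} (hf : Summable fun n => ‖f n‖) :
    ∀ᵐ x ∂μ, Summable fun n => |(f n).1 x| :=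
  ae_summable_of_orliczModular_le_one hs (fun n => (f n).2.1) (fun n => by positivity)
    (fun n => OrliczHeart.modular_norm_add_le (f n) (by positivity)) (summable_norm_add_geometric hf)

theorem OrliczHeart.modular_tail_le {s : ℝ} {hs : 1 ≤ s} {μ : Measure Ω} [IsProbabilityMeasure μ]
    {f : ℕ → OrliczHeart s hs μ} (hf : Summable fun n => ‖f n‖) (N : ℕ) :
    orliczModular s μ (fun x => ∑' n, |(f (n + N)).1 x|)
      (∑' n, (‖f (n + N)‖ + (1 / 2 : ℝ) ^ (n + N))) ≤ 1 :=
  orliczModular_tsum_le hs (fun n => (f (n + N)).2.1) (fun n => by positivity)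
    (fun n => OrliczHeart.modular_norm_add_le (f (n + N)) (by positivity))
    ((summable_nat_add_iff N).2 (summable_norm_add_geometric hf))

/-- A finite modular at one scale is not enough for the heart. For a given scale `c`, the series
splits into a finite head, which lies in the heart, and a tail whose total scale is below `c / 2`.
-/
theorem OrliczHeart.memOrliczHeart_tsum_abs {s : ℝ} {hs : 1 ≤ s} {μ : Measure Ω}
    [IsProbabilityMeasure μ] {f : ℕ → OrliczHeart s hs μ} (hf : Summable fun n => ‖f n‖) :
    MemOrliczHeart s μ (fun x => ∑' n, |(f n).1 x|) := by
  have hS := OrliczHeart.ae_summable hf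
  have hm : ∀ n, AEStronglyMeasurable (fun x => |(f n).1 x|) μ := fun n =>
    continuous_abs.comp_aestronglyMeasurable (f n).2.1
  have hmt : AEStronglyMeasurable (fun x => ∑' n, |(f n).1 x|) μ := by
    refine aestronglyMeasurable_of_tendsto_ae atTop
      (f := fun M x => ∑ i ∈ Finset.range M, |(f i).1 x|)
      (fun M => Finset.aestronglyMeasurable_fun_sum _ fun i _ => hm i) ?_
    filter_upwards [hS] with x hx using hx.hasSum.tendsto_sum_nat
  refine ⟨hmt, fun c hc => ?_⟩
  have htail := tendsto_sum_nat_add fun n => ‖f n‖ + (1 / 2 : ℝ) ^ n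
  obtain ⟨N, hN⟩ := (htail.eventually (gt_mem_nhds (half_pos hc))).exists
  have hpos : 0 < ∑' n, (‖f (n + N)‖ + (1 / 2 : ℝ) ^ (n + N)) :=
    ((summable_nat_add_iff N).2 (summable_norm_add_geometric hf)).tsum_pos
      (fun n => by positivity) 0 (by positivity)
  have h1 : orliczModular s μ (fun x => ∑' n, |(f (n + N)).1 x|) (c / 2) ≤ 1 :=
    (orliczModular_mono hs (by simp) hpos hN.le).trans (OrliczHeart.modular_tail_le hf N)
  have h2 : MemOrliczHeart s μ (fun x => ∑ i ∈ Finset.range N, |(f i).1 x|) :=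
    MemOrliczHeart.sum hs _ fun i _ => (f i).2.abs hs
  have h3 := orliczModular_add_le (g := fun x => ∑' n, |(f (n + N)).1 x|) hs h2.1
    (half_pos hc) (half_pos hc)
  rw [add_halves] at h3
  have h4 : (fun x => ∑' n, |(f n).1 x|) =ᵐ[μ]
      ((fun x => ∑ i ∈ Finset.range N, |(f i).1 x|) + fun x => ∑' n, |(f (n + N)).1 x|) := by
    filter_upwards [hS] with x hx using (hx.sum_add_tsum_nat_add N).symm
  rw [orliczModular_congr h4]
  refine h3.trans_lt (ENNReal.add_lt_top.2 ⟨?_, ?_⟩)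
  · exact ENNReal.mul_lt_top ENNReal.ofReal_lt_top (h2.2 _ (half_pos hc))
  · exact ENNReal.mul_lt_top ENNReal.ofReal_lt_top (h1.trans_lt ENNReal.one_lt_top)

/-- Riesz–Fischer: an absolutely convergent series in the Orlicz heart converges in norm to its
pointwise almost-everywhere sum. -/
theorem OrliczHeart.exists_tendsto_sum {s : ℝ} {hs : 1 ≤ s} {μ : Measure Ω}
    [IsProbabilityMeasure μ] {f : ℕ → OrliczHeart s hs μ} (hf : Summable fun n => ‖f n‖) :
    ∃ F : OrliczHeart s hs μ, Tendsto (fun n => ∑ i ∈ Finset.range n, f i) atTop (𝓝 F) ∧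
      ∀ᵐ x ∂μ, HasSum (fun n => (f n).1 x) (F.1 x) := by
  have hS := OrliczHeart.ae_summable hf
  have hmt : AEStronglyMeasurable (fun x => ∑' n, (f n).1 x) μ := by
    refine aestronglyMeasurable_of_tendsto_ae atTop
      (f := fun M x => ∑ i ∈ Finset.range M, (f i).1 x)
      (fun M => Finset.aestronglyMeasurable_fun_sum _ fun i _ => (f i).2.1) ?_
    filter_upwards [hS] with x hx using (Summable.of_abs hx).hasSum.tendsto_sum_nat
  have hF : MemOrliczHeart s μ (fun x => ∑' n, (f n).1 x) := by
    refine (OrliczHeart.memOrliczHeart_tsum_abs hf).mono hs hmt ?_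
    filter_upwards [hS] with x hx
    rw [abs_of_nonneg (a := ∑' n, |(f n).1 x|) (tsum_nonneg fun n => abs_nonneg _)]
    exact norm_tsum_le_tsum_norm (f := fun n => (f n).1 x) hx
  have hco := toOrliczHeart_coe (hs := hs) hF
  refine ⟨toOrliczHeart s hs μ fun x => ∑' n, (f n).1 x, ?_, ?_⟩
  · rw [tendsto_iff_norm_sub_tendsto_zero]
    have htail := tendsto_sum_nat_add fun n => ‖f n‖ + (1 / 2 : ℝ) ^ n
    refine squeeze_zero (fun n => norm_nonneg _) (fun N => ?_) htail
    have hpos : 0 < ∑' n, (‖f (n + N)‖ + (1 / 2 : ℝ) ^ (n + N)) :=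
      ((summable_nat_add_iff N).2 (summable_norm_add_geometric hf)).tsum_pos
        (fun n => by positivity) 0 (by positivity)
    refine luxemburgNorm_le hpos (le_trans ?_ (OrliczHeart.modular_tail_le hf N))
    refine orliczModular_mono hs ?_ hpos le_rfl
    filter_upwards [hS, hco, OrliczHeart.coeFn_sub (∑ i ∈ Finset.range N, f i)
      (toOrliczHeart s hs μ fun x => ∑' n, (f n).1 x),
      OrliczHeart.coeFn_sum (Finset.range N) f] with x hx h1 h2 h3
    rw [h2, h1, h3, ← (Summable.of_abs hx).sum_add_tsum_nat_add N, sub_add_cancel_left, abs_neg,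
      abs_of_nonneg (a := ∑' n, |(f (n + N)).1 x|) (tsum_nonneg fun n => abs_nonneg _)]
    exact norm_tsum_le_tsum_norm (f := fun n => (f (n + N)).1 x) ((summable_nat_add_iff N).2 hx)
  · filter_upwards [hS, hco] with x hx h1
    rw [h1]
    exact (Summable.of_abs hx).hasSum

instance (s : ℝ) (hs : 1 ≤ s) (μ : Measure Ω) [IsProbabilityMeasure μ] :
    CompleteSpace (OrliczHeart s hs μ) :=
  NormedAddCommGroup.completeSpace_of_summable_imp_tendsto fun _ hf =>
    let ⟨F, hF, _⟩ := OrliczHeart.exists_tendsto_sum hf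
    ⟨F, hF⟩

theorem OrliczHeart.ae_hasSum {s : ℝ} {hs : 1 ≤ s} {μ : Measure Ω}
    [IsProbabilityMeasure μ] {f : ℕ → OrliczHeart s hs μ} (hf : Summable fun n => ‖f n‖) :
    ∀ᵐ x ∂μ, HasSum (fun n => (f n).1 x) ((∑' n, f n : OrliczHeart s hs μ).1 x) := by
  obtain ⟨F, hF, h⟩ := OrliczHeart.exists_tendsto_sum hf
  have : ∑' n, f n = F := tendsto_nhds_unique hf.of_norm.hasSum.tendsto_sum_nat hF
  rwa [this]

/-- A convergent sequence in the Orlicz heart has a subsequence that converges almost everywhere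
and is dominated by an element of the Orlicz heart. -/
theorem OrliczHeart.exists_subseq_dominated {s : ℝ} {hs : 1 ≤ s} {μ : Measure Ω}
    [IsProbabilityMeasure μ] {f : ℕ → OrliczHeart s hs μ} {F : OrliczHeart s hs μ}
    (hf : Tendsto f atTop (𝓝 F)) :
    ∃ φ : ℕ → ℕ, StrictMono φ ∧ ∃ S : Ω → ℝ, MemOrliczHeart s μ S ∧
      ∀ᵐ x ∂μ, (∀ n, |(f (φ n)).1 x| ≤ S x) ∧
        Tendsto (fun n => (f (φ n)).1 x) atTop (𝓝 (F.1 x)) := by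
  have h0 : Tendsto (fun n => ‖f n - F‖) atTop (𝓝 0) := tendsto_iff_norm_sub_tendsto_zero.1 hf
  -- A geometric rate makes the distances to `F` summable, so `|F| + ∑ |f (φ n) - F|` is a majorant
  -- in the heart and the summands tend to 0 almost everywhere.
  have hex : ∀ n : ℕ, ∀ᶠ k in atTop, ‖f k - F‖ < (1 / 2 : ℝ) ^ n := fun n =>
    h0.eventually (gt_mem_nhds (by positivity))
  obtain ⟨φ, hφ, hφ'⟩ := extraction_forall_of_eventually hex
  have hsum : Summable fun n => ‖f (φ n) - F‖ :=
    Summable.of_nonneg_of_le (fun n => norm_nonneg _) (fun n => (hφ' n).le) summable_geometric_two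
  refine ⟨φ, hφ, _, ((OrliczHeart.memOrliczHeart_tsum_abs hsum).add hs (F.2.abs hs)), ?_⟩
  filter_upwards [OrliczHeart.ae_summable hsum,
    ae_all_iff.2 fun n => OrliczHeart.coeFn_sub (f (φ n)) F] with x hx h1
  simp only [h1] at hx
  simp only [Pi.add_apply, h1]
  constructor
  · intro n
    have h2 := hx.le_tsum n fun j _ => abs_nonneg _
    have h3 := abs_add_le ((f (φ n)).1 x - F.1 x) (F.1 x)
    rw [sub_add_cancel] at h3
    linarith
  · have h2 := hx.tendsto_atTop_zero
    rw [tendsto_iff_norm_sub_tendsto_zero]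
    exact h2

end RieszFischer

/-! ### Bounds for logarithms of exponential integrals, and their difference quotients. -/

section ExponentialMoments

variable {Ω : Type*} [MeasurableSpace Ω]

/-- The case `x ≤ t + 1` is immediate. Beyond it `x ≥ 1`, and `x ^ s - t ^ s ≥ x ^ (s - 1) (x - t) ≥
x - t`. The free parameter `t` is later tuned to the size of an integral. -/
theorem exp_le_exp_add_one_mul {s K t x : ℝ} (hs : 1 ≤ s) (hK : 1 ≤ K) (ht : 0 ≤ t) :
    Real.exp x ≤ Real.exp (t + 1) * (1 + Real.exp (K * x ^ s - K * t ^ s)) := by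
  have he := Real.exp_pos (t + 1)
  have he' := Real.exp_pos (K * x ^ s - K * t ^ s)
  rcases le_total x (t + 1) with h | h
  · have := Real.exp_le_exp.2 h
    nlinarith
  · have hx1 : 1 ≤ x := by linarith
    have h1 : x ^ s = x ^ (s - 1) * x := by
      rw [← Real.rpow_add_one (by positivity), sub_add_cancel]
    have h2 : t ^ s ≤ x ^ (s - 1) * t := by
      rcases ht.eq_or_lt with rfl | ht'
      · rw [Real.zero_rpow (by linarith), mul_zero]
      · have : t ^ s = t ^ (s - 1) * t := by
          rw [← Real.rpow_add_one (by positivity), sub_add_cancel]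
        rw [this]
        have := Real.rpow_le_rpow ht (by linarith : t ≤ x) (by linarith : 0 ≤ s - 1)
        gcongr
    have h3 : 1 ≤ x ^ (s - 1) := Real.one_le_rpow hx1 (by linarith)
    have h4 : x - t ≤ x ^ s - t ^ s := by nlinarith
    have h5 : x ≤ t + 1 + (K * x ^ s - K * t ^ s) := by nlinarith
    have h6 := Real.exp_le_exp.2 h5
    rw [Real.exp_add] at h6
    nlinarith

theorem abs_log_integral_exp_le {μ : Measure Ω} [IsProbabilityMeasure μ] {Z : Ω → ℝ}
    (hZ : AEStronglyMeasurable Z μ) (hint : Integrable (fun x => Real.exp |Z x|) μ) :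
    |Real.log (∫ x, Real.exp (Z x) ∂μ)| ≤ Real.log (∫ x, Real.exp |Z x| ∂μ) := by
  have hi : Integrable (fun x => Real.exp (Z x)) μ :=
    hint.mono' (Real.continuous_exp.comp_aestronglyMeasurable hZ) (Eventually.of_forall fun x => by
      rw [Real.norm_of_nonneg (Real.exp_pos _).le]
      exact Real.exp_le_exp.2 (le_abs_self _))
  have hpos : 0 < ∫ x, Real.exp (Z x) ∂μ := integral_exp_pos hi
  have hpos' : 0 < ∫ x, Real.exp |Z x| ∂μ := integral_exp_pos hint
  rw [abs_le]
  constructor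
  · rw [← Real.log_inv]
    apply Real.log_le_log (by positivity)
    -- The claim is `∫ exp Z ≥ c`. Expanding `(exp Z - c)² exp (-Z) ≥ 0` gives `exp Z ≥ 2c - c² exp
    -- |Z|`, and the right side integrates to `2c - c`.
    set c := (∫ x, Real.exp |Z x| ∂μ)⁻¹ with hc
    have h1 : ∫ x, (2 * c - c ^ 2 * Real.exp |Z x|) ∂μ ≤ ∫ x, Real.exp (Z x) ∂μ := by
      apply integral_mono ((integrable_const _).sub (hint.const_mul _)) hi
      intro x
      have h2 : Real.exp (-(Z x)) ≤ Real.exp |Z x| := Real.exp_le_exp.2 (neg_le_abs _)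
      have h3 : Real.exp (Z x) * Real.exp (-(Z x)) = 1 := by rw [← Real.exp_add]; simp
      have h4 := Real.exp_pos (Z x)
      have h5 := Real.exp_pos (-(Z x))
      beta_reduce
      have h6 : 2 * c ≤ Real.exp (Z x) + c ^ 2 * Real.exp (-(Z x)) := by
        have h7 : 0 ≤ (Real.exp (Z x) - c) ^ 2 * Real.exp (-(Z x)) := by positivity
        have h8 : (Real.exp (Z x) - c) ^ 2 * Real.exp (-(Z x)) =
          Real.exp (Z x) * (Real.exp (Z x) * Real.exp (-(Z x)))
            - 2 * c * (Real.exp (Z x) * Real.exp (-(Z x))) + c ^ 2 * Real.exp (-(Z x)) := by ring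
        rw [h8, h3] at h7
        linarith
      have h10 := mul_le_mul_of_nonneg_left h2 (sq_nonneg c)
      simp only [Pi.sub_apply]
      linarith
    rw [integral_sub (integrable_const _) (hint.const_mul _)] at h1
    simp only [integral_const, probReal_univ, smul_eq_mul, one_mul, integral_const_mul] at h1
    have h9 : c ^ 2 * ∫ x, Real.exp |Z x| ∂μ = c := by
      rw [hc]; field_simp
    linarith
  · apply Real.log_le_log hpos
    exact integral_mono hi hint fun x => Real.exp_le_exp.2 (le_abs_self _)

/-- A substitute for Jensen's inequality: `y ↦ exp (K (log y) ^ s)` is not convex near `y = 1`, so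
constants are lost, but `K` is arbitrary in the heart and the loss is harmless. -/
theorem exp_abs_log_integral_exp_le {s K : ℝ} (hs : 1 ≤ s) (hK : 1 ≤ K) {μ : Measure Ω}
    [IsProbabilityMeasure μ] {Z : Ω → ℝ}
    (hZ : AEStronglyMeasurable Z μ) (hint : Integrable (fun x => Real.exp |Z x|) μ)
    (hint' : Integrable (fun x => Real.exp (K * |Z x| ^ s)) μ) :
    Real.exp (K * 2 ^ (-s) * |Real.log (∫ x, Real.exp (Z x) ∂μ)| ^ s) ≤
      Real.exp (K * 2 ^ s) * ∫ x, Real.exp (K * |Z x| ^ s) ∂μ := by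
  set W := ∫ x, Real.exp (K * |Z x| ^ s) ∂μ with hW
  have hs0 : 0 < s := by linarith
  have hK0 : 0 < K := by linarith
  have hW1 : 1 ≤ W := by
    have : ∫ _, (1 : ℝ) ∂μ ≤ W := integral_mono (integrable_const _) hint' fun x =>
      Real.one_le_exp (by positivity)
    simpa using this
  have hlog : 0 ≤ Real.log W := Real.log_nonneg hW1
  -- Chosen so that `exp (K t ^ s) = W`. The second term of the pointwise bound then integrates to
  -- 1, and `∫ exp |Z| ≤ 2 exp (t + 1) ≤ exp (t + 2)`.
  set t := (Real.log W / K) ^ (1 / s) with ht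
  have ht0 : 0 ≤ t := by positivity
  have hts : K * t ^ s = Real.log W := by
    rw [ht, ← Real.rpow_mul (by positivity), one_div_mul_cancel hs0.ne', Real.rpow_one]
    field_simp
  have hL : |Real.log (∫ x, Real.exp (Z x) ∂μ)| ≤ t + 2 := by
    refine (abs_log_integral_exp_le hZ hint).trans ?_
    rw [Real.log_le_iff_le_exp (integral_exp_pos hint)]
    have h1 : ∫ x, Real.exp |Z x| ∂μ ≤
        ∫ x, Real.exp (t + 1) * (1 + W⁻¹ * Real.exp (K * |Z x| ^ s)) ∂μ := by
      apply integral_mono hint (((integrable_const _).add (hint'.const_mul _)).const_mul _)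
      intro x
      have := exp_le_exp_add_one_mul (x := |Z x|) hs hK ht0
      rw [Real.exp_sub, hts, Real.exp_log (by linarith), div_eq_inv_mul] at this
      exact this
    rw [integral_const_mul, integral_add (integrable_const _) (hint'.const_mul _),
      integral_const_mul] at h1
    simp only [integral_const, probReal_univ, smul_eq_mul, one_mul] at h1
    rw [← hW, inv_mul_cancel₀ (by linarith : W ≠ 0)] at h1
    refine h1.trans ?_
    have h2 : t + 2 = t + 1 + 1 := by ring
    rw [h2, Real.exp_add (t + 1) 1]
    have := Real.add_one_le_exp 1
    gcongr
  have h3 : |Real.log (∫ x, Real.exp (Z x) ∂μ)| ^ s ≤ 2 ^ s * (t ^ s + 2 ^ s) := by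
    calc |Real.log (∫ x, Real.exp (Z x) ∂μ)| ^ s ≤ (2 * max t 2) ^ s := by
          apply Real.rpow_le_rpow (abs_nonneg _) _ hs0.le
          have := le_max_left t 2
          have := le_max_right t 2
          linarith
      _ = 2 ^ s * (max t 2) ^ s := Real.mul_rpow (by norm_num) (by positivity)
      _ ≤ 2 ^ s * (t ^ s + 2 ^ s) := by
          gcongr
          have h4 : (0 : ℝ) ≤ 2 ^ s := by positivity
          have h5 : 0 ≤ t ^ s := by positivity
          rcases max_choice t 2 with h | h <;> rw [h] <;> linarith
  calc Real.exp (K * 2 ^ (-s) * |Real.log (∫ x, Real.exp (Z x) ∂μ)| ^ s)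
      ≤ Real.exp (K * 2 ^ (-s) * (2 ^ s * (t ^ s + 2 ^ s))) := by
        apply Real.exp_le_exp.2
        gcongr
    _ = Real.exp (Real.log W + K * 2 ^ s) := by
        rw [← hts]
        congr 1
        have : (2 : ℝ) ^ (-s) * 2 ^ s = 1 := by rw [← Real.rpow_add two_pos]; simp
        linear_combination (K * (t ^ s + 2 ^ s)) * this
    _ = Real.exp (K * 2 ^ s) * W := by
        rw [Real.exp_add, Real.exp_log (by linarith), mul_comm]

theorem abs_exp_sub_one_le_mul (y : ℝ) : |Real.exp y - 1| ≤ |y| * Real.exp |y| := by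
  have h1 := Real.add_one_le_exp y
  have h2 := Real.add_one_le_exp (-y)
  have h3 : Real.exp y * Real.exp (-y) = 1 := by rw [← Real.exp_add]; simp
  have h4 := Real.exp_pos y
  rcases le_total 0 y with h | h
  · rw [abs_of_nonneg h, abs_of_nonneg (by linarith)]
    nlinarith
  · rw [abs_of_nonpos h, abs_of_nonpos (by linarith [Real.exp_le_one_iff.2 h])]
    have := Real.one_le_exp (neg_nonneg.2 h)
    nlinarith

/-- Difference quotients of exponential integrals along perturbations `X + t_n z_n` with
`z_n → z` dominated. -/
theorem tendsto_exp_integral_quotient {μ : Measure Ω} {X H z S : Ω → ℝ} {zn : ℕ → Ω → ℝ}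
    {t : ℕ → ℝ} (ht0 : ∀ n, t n ≠ 0) (ht1 : ∀ n, |t n| ≤ 1) (ht : Tendsto t atTop (𝓝 0))
    (hX : AEStronglyMeasurable X μ) (hH : AEStronglyMeasurable H μ)
    (hzn : ∀ n, AEStronglyMeasurable (zn n) μ)
    (hS : ∀ᵐ x ∂μ, (∀ n, |zn n x| ≤ S x) ∧ Tendsto (fun n => zn n x) atTop (𝓝 (z x)))
    (hint : Integrable (fun x => Real.exp (X x + 2 * S x) * |H x|) μ) :
    (∀ n, Integrable (fun x => Real.exp (X x + t n * zn n x) * H x) μ) ∧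
    Integrable (fun x => Real.exp (X x) * H x) μ ∧
    Tendsto (fun n => (∫ x, Real.exp (X x + t n * zn n x) * H x ∂μ -
      ∫ x, Real.exp (X x) * H x ∂μ) / t n) atTop (𝓝 (∫ x, Real.exp (X x) * z x * H x ∂μ)) := by
  have hI1 : ∀ n, Integrable (fun x => Real.exp (X x + t n * zn n x) * H x) μ := by
    intro n
    refine hint.mono' ((Real.continuous_exp.comp_aestronglyMeasurable
      (hX.add ((hzn n).const_mul _))).mul hH) ?_
    filter_upwards [hS] with x hx
    rw [norm_mul, Real.norm_of_nonneg (Real.exp_pos _).le, Real.norm_eq_abs]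
    have h1 : t n * zn n x ≤ 2 * S x := by
      have h2 := le_abs_self (t n * zn n x)
      rw [abs_mul] at h2
      have h3 := hx.1 n
      have h4 := abs_nonneg (zn n x)
      have h5 := ht1 n
      nlinarith
    gcongr
  have hI2 : Integrable (fun x => Real.exp (X x) * H x) μ := by
    refine hint.mono' ((Real.continuous_exp.comp_aestronglyMeasurable hX).mul hH) ?_
    filter_upwards [hS] with x hx
    rw [norm_mul, Real.norm_of_nonneg (Real.exp_pos _).le, Real.norm_eq_abs]
    have h3 := (abs_nonneg _).trans (hx.1 0)
    gcongr
    linarith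
  refine ⟨hI1, hI2, ?_⟩
  have heq : ∀ n, (∫ x, Real.exp (X x + t n * zn n x) * H x ∂μ -
      ∫ x, Real.exp (X x) * H x ∂μ) / t n =
      ∫ x, Real.exp (X x) * ((Real.exp (t n * zn n x) - 1) / t n) * H x ∂μ := by
    intro n
    rw [← integral_sub (hI1 n) hI2, ← integral_div]
    congr 1
    ext x
    rw [Real.exp_add]
    ring
  simp_rw [heq]
  refine tendsto_integral_of_dominated_convergence _ (fun n => ?_) hint (fun n => ?_) ?_
  · refine ((Real.continuous_exp.comp_aestronglyMeasurable hX).mul ?_).mul hH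
    have h1 : Continuous fun y : ℝ => (Real.exp (t n * y) - 1) / t n := by fun_prop
    exact h1.comp_aestronglyMeasurable (hzn n)
  · filter_upwards [hS] with x hx
    rw [norm_mul, norm_mul, Real.norm_of_nonneg (Real.exp_pos _).le, Real.norm_eq_abs,
      Real.norm_eq_abs, Real.exp_add]
    have hS0 := (abs_nonneg _).trans (hx.1 0)
    -- One factor `exp S` bounds `exp |t zn|`, the other bounds `S` itself; hence the 2 in the
    -- integrability hypothesis.
    have h1 : |(Real.exp (t n * zn n x) - 1) / t n| ≤ Real.exp (2 * S x) := by
      rw [abs_div, div_le_iff₀ (abs_pos.2 (ht0 n))]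
      refine (abs_exp_sub_one_le_mul _).trans ?_
      rw [abs_mul]
      have h2 : |t n| * |zn n x| ≤ S x := by
        have := hx.1 n
        have := abs_nonneg (zn n x)
        nlinarith [ht1 n]
      have h3 : S x ≤ Real.exp (S x) := by linarith [Real.add_one_le_exp (S x)]
      calc |t n| * |zn n x| * Real.exp (|t n| * |zn n x|)
          ≤ |t n| * S x * Real.exp (S x) := by
            gcongr
            exact hx.1 n
        _ ≤ |t n| * Real.exp (S x) * Real.exp (S x) := by gcongr
        _ = Real.exp (2 * S x) * |t n| := by
            rw [two_mul, Real.exp_add]; ring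
    gcongr
  · filter_upwards [hS] with x hx
    refine ((tendsto_const_nhds (x := Real.exp (X x))).mul ?_).mul_const (H x)
    have hS0 := (abs_nonneg _).trans (hx.1 0)
    -- Once `|t n| S x ≤ 1`, the quadratic Taylor remainder divided by `t n` is at most `|t n| (S
    -- x)²`.
    have h1 : Tendsto (fun n => (Real.exp (t n * zn n x) - 1) / t n - zn n x) atTop (𝓝 0) := by
      have h2 : Tendsto (fun n => |t n| * (S x) ^ 2) atTop (𝓝 0) := by
        have := ht.abs.mul_const ((S x) ^ 2)
        simpa using this
      have h3 : ∀ᶠ n in atTop, |t n| * S x ≤ 1 := by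
        have := ht.abs.mul_const (S x)
        simp only [abs_zero, zero_mul] at this
        exact (this.eventually (gt_mem_nhds one_pos)).mono fun n hn => hn.le
      refine squeeze_zero_norm' ?_ h2
      filter_upwards [h3] with n hn
      have h4 : |t n * zn n x| ≤ 1 := by
        rw [abs_mul]
        exact (mul_le_mul_of_nonneg_left (hx.1 n) (abs_nonneg _)).trans hn
      have h5 := Real.norm_exp_sub_one_sub_id_le (x := t n * zn n x) (by simpa using h4)
      rw [Real.norm_eq_abs, Real.norm_eq_abs] at h5
      have h6 : (Real.exp (t n * zn n x) - 1) / t n - zn n x =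
          (Real.exp (t n * zn n x) - 1 - t n * zn n x) / t n := by
        field_simp [ht0 n]
      rw [h6, Real.norm_eq_abs, abs_div, div_le_iff₀ (abs_pos.2 (ht0 n))]
      refine h5.trans ?_
      rw [abs_mul, mul_pow]
      have h7 : |zn n x| ^ 2 ≤ S x ^ 2 := by
        have := hx.1 n
        gcongr
      nlinarith [sq_nonneg (|t n|)]
    have := h1.add hx.2
    simpa using this

end ExponentialMoments

/-! ### The recursion on the Orlicz heart and its derivative. -/

section KernelLemmas

variable {𝓧 : Type*} [MeasurableSpace 𝓧] {Q₀ : Measure 𝓧} [IsProbabilityMeasure Q₀]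
  {Q : Kernel 𝓧 𝓧} [IsMarkovKernel Q]

theorem measurePreserving_fst_compProd : MeasurePreserving Prod.fst (Q₀ ⊗ₘ Q) Q₀ :=
  ⟨measurable_fst, Measure.fst_compProd Q₀ Q⟩

theorem measurePreserving_snd_compProd (hQ : Kernel.Invariant Q Q₀) :
    MeasurePreserving Prod.snd (Q₀ ⊗ₘ Q) Q₀ :=
  ⟨measurable_snd, (Measure.snd_compProd Q₀ Q).trans hQ⟩

/-- Under invariance a function changed on a `Q₀`-null set changes on a `Q x`-null set for almost
every `x`. This makes the conditional operators well defined on classes. -/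
theorem ae_ae_of_invariant (hQ : Kernel.Invariant Q Q₀) {p : 𝓧 → Prop} (h : ∀ᵐ x ∂Q₀, p x) :
    ∀ᵐ x ∂Q₀, ∀ᵐ x' ∂(Q x), p x' :=
  Measure.ae_ae_of_ae_compProd
    ((measurePreserving_snd_compProd hQ).quasiMeasurePreserving.ae h)

theorem ae_integrable_kernel {F : 𝓧 × 𝓧 → ℝ} (hF : Integrable F (Q₀ ⊗ₘ Q)) :
    ∀ᵐ x ∂Q₀, Integrable (fun x' => F (x, x')) (Q x) :=
  ((Measure.integrable_compProd_iff hF.1).1 hF).1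

/-- A single null set serves all real `c`, because integer values of `c` suffice. -/
theorem ae_integrable_exp_kernel {s : ℝ} (hs : 1 ≤ s) {Y : 𝓧 × 𝓧 → ℝ} (hYm : Measurable Y)
    (hY : MemOrliczHeart s (Q₀ ⊗ₘ Q) Y) :
    ∀ᵐ x ∂Q₀, ∀ c : ℝ, Integrable (fun x' => Real.exp (c * |Y (x, x')|)) (Q x) := by
  have h := ae_all_iff.2 fun n : ℕ => ae_integrable_kernel (hY.integrable_exp hs n)
  filter_upwards [h] with x hx c
  obtain ⟨n, hn⟩ := exists_nat_ge c
  refine (hx n).mono' ?_ (Eventually.of_forall fun x' => ?_)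
  · exact (Measurable.aestronglyMeasurable (by fun_prop))
  · rw [Real.norm_of_nonneg (Real.exp_pos _).le]
    gcongr

theorem memOrliczHeart_log_integral_exp {s : ℝ} (hs : 1 ≤ s) {X : 𝓧 × 𝓧 → ℝ} (hXm : Measurable X)
    (hX : MemOrliczHeart s (Q₀ ⊗ₘ Q) X) :
    MemOrliczHeart s Q₀ (fun x => Real.log (∫ x', Real.exp (X (x, x')) ∂(Q x))) := by
  have hI : StronglyMeasurable fun x => ∫ x', Real.exp (X (x, x')) ∂(Q x) :=
    StronglyMeasurable.integral_kernel_prod_right' (f := fun p => Real.exp (X p))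
      (by fun_prop : Measurable fun p => Real.exp (X p)).stronglyMeasurable
  refine memOrliczHeart_of_lintegral_exp_rpow_lt_top
    (Real.measurable_log.comp hI.measurable).aestronglyMeasurable 1 fun K hK => ?_
  -- The factor `2 ^ s` compensates the `2 ^ (-s)` lost in the fibrewise bound under `Q x`.
  set K' := K * 2 ^ s with hK'
  have h2s : (1 : ℝ) ≤ 2 ^ s := Real.one_le_rpow one_le_two (by linarith)
  have hK1 : 1 ≤ K' := by nlinarith
  have hfin := hX.lintegral_exp_rpow_lt_top hs (by linarith : 0 < K')
  have hm : Measurable fun p => ENNReal.ofReal (Real.exp (K' * |X p| ^ s)) := by fun_prop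
  rw [Measure.lintegral_compProd hm] at hfin
  have hae := ae_lt_top hm.lintegral_kernel_prod_right' hfin.ne
  refine lt_of_le_of_lt (lintegral_mono_ae (g := fun x => ENNReal.ofReal (Real.exp (K' * 2 ^ s)) *
    ∫⁻ x', ENNReal.ofReal (Real.exp (K' * |X (x, x')| ^ s)) ∂(Q x)) ?_) ?_
  · filter_upwards [hae, ae_integrable_exp_kernel hs hXm hX] with x hx hx'
    have hint : Integrable (fun x' => Real.exp (K' * |X (x, x')| ^ s)) (Q x) := by
      refine ⟨Measurable.aestronglyMeasurable (by fun_prop), ?_⟩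
      rw [hasFiniteIntegral_iff_ofReal (Eventually.of_forall fun _ => (Real.exp_pos _).le)]
      exact hx
    rw [← ofReal_integral_eq_lintegral_ofReal hint
      (Eventually.of_forall fun _ => (Real.exp_pos _).le), ← ENNReal.ofReal_mul (Real.exp_pos _).le]
    apply ENNReal.ofReal_le_ofReal
    have h1 := exp_abs_log_integral_exp_le (μ := Q x) (Z := fun x' => X (x, x')) hs hK1
      (Measurable.aestronglyMeasurable (by fun_prop)) (by simpa using hx' 1) hint
    have h3 : K' * 2 ^ (-s) = K := by
      rw [hK', mul_assoc, ← Real.rpow_add two_pos]; simp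
    rwa [h3] at h1
  · rw [lintegral_const_mul' _ _ ENNReal.ofReal_ne_top]
    exact ENNReal.mul_lt_top ENNReal.ofReal_lt_top hfin

theorem memOrliczHeart_aggregate {s : ℝ} (hs : 1 ≤ s) (hQ : Kernel.Invariant Q Q₀)
    {u : 𝓧 × 𝓧 → ℝ} (hU : MemOrliczHeart s (Q₀ ⊗ₘ Q) u) {f : 𝓧 → ℝ} (hf : MemOrliczHeart s Q₀ f)
    (α : ℝ) : MemOrliczHeart s (Q₀ ⊗ₘ Q) (fun p => f p.2 + α * u p) :=
  (hf.comp_measurePreserving (measurePreserving_snd_compProd hQ)).add hs (hU.smul hs α)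

theorem memOrliczHeart_recursionOp {s : ℝ} (hs : 1 ≤ s) (hQ : Kernel.Invariant Q Q₀)
    {u : 𝓧 × 𝓧 → ℝ} (hu : Measurable u) (hU : MemOrliczHeart s (Q₀ ⊗ₘ Q) u) {f : 𝓧 → ℝ}
    (hfm : Measurable f) (hf : MemOrliczHeart s Q₀ f) (α β : ℝ) :
    MemOrliczHeart s Q₀ (recursionOp Q u α β f) :=
  (memOrliczHeart_log_integral_exp hs (by fun_prop)
    (memOrliczHeart_aggregate hs hQ hU hf α)).smul hs β

theorem recursionMap_coe {s : ℝ} {hs : 1 ≤ s} (hQ : Kernel.Invariant Q Q₀)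
    {u : 𝓧 × 𝓧 → ℝ} (hu : Measurable u) (hU : MemOrliczHeart s (Q₀ ⊗ₘ Q) u)
    (α β : ℝ) (f : OrliczHeart s hs Q₀) :
    ((recursionMap s hs Q₀ Q u ((α, β), f)).1 : 𝓧 → ℝ) =ᵐ[Q₀] recursionOp Q u α β f.1 :=
  toOrliczHeart_coe (memOrliczHeart_recursionOp hs hQ hu hU (OrliczHeart.measurable_coe f) f.2 α β)

theorem ae_integral_exp_congr (hQ : Kernel.Invariant Q Q₀) (u : 𝓧 × 𝓧 → ℝ) {f g : 𝓧 → ℝ}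
    (h : f =ᵐ[Q₀] g) (α : ℝ) (H : 𝓧 × 𝓧 → ℝ) :
    ∀ᵐ x ∂Q₀, ∫ x', Real.exp (f x' + α * u (x, x')) * H (x, x') ∂(Q x) =
      ∫ x', Real.exp (g x' + α * u (x, x')) * H (x, x') ∂(Q x) := by
  filter_upwards [ae_ae_of_invariant hQ h] with x hx
  apply integral_congr_ae
  filter_upwards [hx] with x' hx'
  rw [hx']

theorem recursionOp_congr (hQ : Kernel.Invariant Q Q₀) (u : 𝓧 × 𝓧 → ℝ) {f g : 𝓧 → ℝ}
    (h : f =ᵐ[Q₀] g) (α β : ℝ) : recursionOp Q u α β f =ᵐ[Q₀] recursionOp Q u α β g := by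
  filter_upwards [ae_integral_exp_congr hQ u h α fun _ => 1] with x hx
  simp only [mul_one] at hx
  rw [recursionOp, hx, recursionOp]

theorem worstCaseExp_eq_div (Q : Kernel 𝓧 𝓧) (u : 𝓧 × 𝓧 → ℝ) (α : ℝ) (v : 𝓧 → ℝ)
    (h : 𝓧 × 𝓧 → ℝ) (x : 𝓧) :
    worstCaseExp Q u α v h x = (∫ x', Real.exp (v x' + α * u (x, x')) * h (x, x') ∂(Q x)) /
      ∫ x', Real.exp (v x' + α * u (x, x')) ∂(Q x) := by
  unfold worstCaseExp worstCaseDistortion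
  rw [← integral_div]
  congr 1
  ext x'
  ring

theorem worstCaseExp_congr (hQ : Kernel.Invariant Q Q₀) (u : 𝓧 × 𝓧 → ℝ) (α : ℝ) {v v' : 𝓧 → ℝ}
    (hv : v =ᵐ[Q₀] v') {h h' : 𝓧 × 𝓧 → ℝ}
    (hh : ∀ᵐ x ∂Q₀, ∀ᵐ x' ∂(Q x), h (x, x') = h' (x, x')) :
    worstCaseExp Q u α v h =ᵐ[Q₀] worstCaseExp Q u α v' h' := by
  filter_upwards [ae_integral_exp_congr hQ u hv α fun _ => 1, ae_integral_exp_congr hQ u hv α h,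
    hh] with x h1 h2 h3
  simp only [mul_one] at h1
  rw [worstCaseExp_eq_div, worstCaseExp_eq_div, h1, h2]
  congr 1
  apply integral_congr_ae
  filter_upwards [h3] with x' hx'
  rw [hx']

/-- The chain rule along a sequence. The slope `dslope` allows `y n = y₀`, where an ordinary
quotient would degenerate. -/
theorem tendsto_log_quotient {y t : ℕ → ℝ} {y₀ d : ℝ} (hy₀ : y₀ ≠ 0) (ht0 : ∀ n, t n ≠ 0)
    (ht : Tendsto t atTop (𝓝 0)) (h : Tendsto (fun n => (y n - y₀) / t n) atTop (𝓝 d)) :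
    Tendsto (fun n => (Real.log (y n) - Real.log y₀) / t n) atTop (𝓝 (d / y₀)) := by
  have hy : Tendsto y atTop (𝓝 y₀) := by
    have h1 := (h.mul ht).add_const y₀
    simp only [mul_zero, zero_add] at h1
    refine h1.congr fun n => ?_
    field_simp [ht0 n]
    ring
  have hd := Real.hasDerivAt_log hy₀
  have hc : ContinuousAt (dslope Real.log y₀) y₀ := continuousAt_dslope_same.2 hd.differentiableAt
  have h2 := (hc.tendsto.comp hy).mul h
  rw [dslope_same, hd.deriv] at h2
  rw [div_eq_inv_mul]
  refine h2.congr fun n => ?_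
  have h3 := sub_smul_dslope Real.log y₀ (y n)
  rw [← h3]
  simp only [Function.comp, smul_eq_mul]
  ring

/-- The Fréchet derivative of the continuation value operator is given by the worst-case
conditional expectation. -/
theorem fderiv_recursionMap_coe {s : ℝ} {hs : 1 ≤ s} (hQ : Kernel.Invariant Q Q₀)
    {u : 𝓧 × 𝓧 → ℝ} (hu : Measurable u) (hU : MemOrliczHeart s (Q₀ ⊗ₘ Q) u)
    {α β : ℝ} {f : OrliczHeart s hs Q₀} {D : (ℝ × ℝ) × OrliczHeart s hs Q₀ →L[ℝ] OrliczHeart s hs Q₀}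
    (hD : HasFDerivAt (recursionMap s hs Q₀ Q u) D ((α, β), f)) (a b : ℝ)
    (k : OrliczHeart s hs Q₀) :
    ((D ((a, b), k)).1 : 𝓧 → ℝ) =ᵐ[Q₀] fun x =>
      β * worstCaseExp Q u α f.1 (fun p => k.1 p.2 + a * u p) x +
        b * Real.log (∫ x', Real.exp (f.1 x' + α * u (x, x')) ∂(Q x)) := by
  set t : ℕ → ℝ := fun n => 1 / ((n : ℝ) + 1) with ht
  have htpos : ∀ n, 0 < t n := fun n => by positivity
  have ht0 : ∀ n, t n ≠ 0 := fun n => (htpos n).ne'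
  have ht1 : ∀ n, |t n| ≤ 1 := fun n => by
    rw [abs_of_pos (htpos n), ht]
    exact div_le_one_of_le₀ (by simp) (by positivity)
  have htt : Tendsto t atTop (𝓝 0) := tendsto_one_div_add_atTop_nhds_zero_nat
  have htw : Tendsto t atTop (𝓝[≠] 0) :=
    tendsto_nhdsWithin_iff.2 ⟨htt, Eventually.of_forall ht0⟩
  -- Differentiability gives norm convergence of these quotients. Along a subsequence they converge
  -- almost everywhere, so their pointwise limit, computed for fixed `x`, must be `D ((a, b), k)`.
  have hq := (hD.hasLineDerivAt ((a, b), k)).tendsto_slope_zero.comp htw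
  obtain ⟨φ, hφ, _, _, hae⟩ := OrliczHeart.exists_subseq_dominated hq
  have hfm := OrliczHeart.measurable_coe f
  have hkm := OrliczHeart.measurable_coe k
  set X : 𝓧 × 𝓧 → ℝ := fun p => f.1 p.2 + α * u p with hX
  set z : 𝓧 × 𝓧 → ℝ := fun p => k.1 p.2 + a * u p with hz
  have hXm : Measurable X := by fun_prop
  have hzm : Measurable z := by fun_prop
  have hXM : MemOrliczHeart s (Q₀ ⊗ₘ Q) X := memOrliczHeart_aggregate hs hQ hU f.2 α
  have hzM : MemOrliczHeart s (Q₀ ⊗ₘ Q) z := memOrliczHeart_aggregate hs hQ hU k.2 a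
  have hI := ae_integrable_exp_kernel (Y := fun p => |X p| + 2 * |z p|) hs (by fun_prop)
    ((hXM.abs hs).add hs ((hzM.abs hs).smul hs 2))
  have hstep : ∀ n, (((t n)⁻¹ • (recursionMap s hs Q₀ Q u (((α, β), f) + t n • ((a, b), k)) -
      recursionMap s hs Q₀ Q u ((α, β), f))).1 : 𝓧 → ℝ) =ᵐ[Q₀] fun x =>
      (t n)⁻¹ * ((β + t n * b) * Real.log (∫ x', Real.exp (X (x, x') + t n * z (x, x')) ∂(Q x)) -
        β * Real.log (∫ x', Real.exp (X (x, x')) ∂(Q x))) := by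
    intro n
    have e1 : ((α, β), f) + t n • ((a, b), k) = ((α + t n * a, β + t n * b), f + t n • k) := rfl
    have e2 : ((f + t n • k).1 : 𝓧 → ℝ) =ᵐ[Q₀] fun x => f.1 x + t n * k.1 x := by
      filter_upwards [OrliczHeart.coeFn_add f (t n • k), OrliczHeart.coeFn_smul (t n) k] with x h1 h2
      rw [h1, h2]
    rw [e1]
    filter_upwards [OrliczHeart.coeFn_smul (t n)⁻¹
      (recursionMap s hs Q₀ Q u ((α + t n * a, β + t n * b), f + t n • k) -
        recursionMap s hs Q₀ Q u ((α, β), f)),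
      OrliczHeart.coeFn_sub (recursionMap s hs Q₀ Q u ((α + t n * a, β + t n * b), f + t n • k))
        (recursionMap s hs Q₀ Q u ((α, β), f)),
      recursionMap_coe hQ hu hU α β f,
      recursionMap_coe hQ hu hU (α + t n * a) (β + t n * b) (f + t n • k),
      recursionOp_congr hQ u e2 (α + t n * a) (β + t n * b)] with x h1 h2 h3 h4 h5
    rw [h1, h2, h3, h4, h5, recursionOp, recursionOp]
    congr 5
    ext x'
    congr 1
    simp only [hX, hz]
    ring
  filter_upwards [hae, ae_all_iff.2 hstep, hI] with x h1 h2 h3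
  have h4 := h1.2
  simp only [Function.comp] at h4
  simp_rw [h2] at h4
  have h5 := (tendsto_exp_integral_quotient (μ := Q x) (X := fun x' => X (x, x'))
    (H := fun _ => 1) (z := fun x' => z (x, x')) (S := fun x' => |z (x, x')|)
    (zn := fun _ x' => z (x, x')) ht0 ht1 htt (Measurable.aestronglyMeasurable (by fun_prop))
    aestronglyMeasurable_const (fun _ => Measurable.aestronglyMeasurable (by fun_prop))
    (Eventually.of_forall fun x' => ⟨fun _ => le_rfl, tendsto_const_nhds⟩) ?_)
  · obtain ⟨_, h6, h7⟩ := h5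
    simp only [mul_one] at h6 h7
    have hpos : 0 < ∫ x', Real.exp (X (x, x')) ∂(Q x) := integral_exp_pos h6
    have h8 := tendsto_log_quotient hpos.ne' ht0 htt h7
    have h9 : Tendsto (fun n => Real.log (∫ x', Real.exp (X (x, x') + t n * z (x, x')) ∂(Q x)))
        atTop (𝓝 (Real.log (∫ x', Real.exp (X (x, x')) ∂(Q x)))) := by
      have h10 := (h8.mul htt).add_const (Real.log (∫ x', Real.exp (X (x, x')) ∂(Q x)))
      simp only [mul_zero, zero_add] at h10
      refine h10.congr fun n => ?_
      field_simp [ht0 n]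
      ring
    have h11 := (h8.const_mul β).add (h9.const_mul b)
    refine tendsto_nhds_unique h4 ?_
    have h12 := h11.comp hφ.tendsto_atTop
    rw [worstCaseExp_eq_div]
    refine h12.congr fun n => ?_
    have := ht0 (φ n)
    simp only [Function.comp]
    field_simp
    ring
  · refine (h3 1).mono' (Measurable.aestronglyMeasurable (by fun_prop))
      (Eventually.of_forall fun x' => ?_)
    simp only [abs_one, mul_one, one_mul]
    rw [Real.norm_of_nonneg (Real.exp_pos _).le]
    apply Real.exp_le_exp.2
    rw [abs_of_nonneg (by positivity : 0 ≤ |X (x, x')| + 2 * |z (x, x')|)]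
    have := le_abs_self (X (x, x'))
    linarith

end KernelLemmas

/-! ### Jensen's inequality for powers and exponentials. -/

section Jensen

variable {Ω : Type*} [MeasurableSpace Ω]

theorem convexOn_exp_rpow {s q : ℝ} (hs : 1 ≤ s) (hq : 0 ≤ q) :
    ConvexOn ℝ (Ici 0) fun y : ℝ => Real.exp (q * y ^ s) :=
  (convexOn_exp.subset (subset_univ _) ((convexOn_rpow hs).smul hq |>.2 |> fun h => by
    rw [convex_iff_ordConnected]
    refine IsPreconnected.ordConnected ?_
    refine isPreconnected_Ici.image _ ?_
    exact (continuous_const.mul (Real.continuous_rpow_const (by linarith))).continuousOn)).comp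
    ((convexOn_rpow hs).smul hq) (Real.exp_monotone.monotoneOn _)

/-- Jensen's inequality for the convex function `exp (q y ^ s)` on the half-line. Integrability of
`h` is not assumed: it follows when the right side is finite, and otherwise nothing is claimed. -/
theorem ofReal_exp_rpow_integral_le {s q : ℝ} (hs : 1 ≤ s) (hq : 0 < q) {μ : Measure Ω}
    [IsProbabilityMeasure μ] {h : Ω → ℝ} (hh : AEStronglyMeasurable h μ) :
    ENNReal.ofReal (Real.exp (q * |∫ x, h x ∂μ| ^ s)) ≤
      ∫⁻ x, ENNReal.ofReal (Real.exp (q * |h x| ^ s)) ∂μ := by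
  by_cases htop : ∫⁻ x, ENNReal.ofReal (Real.exp (q * |h x| ^ s)) ∂μ = ∞
  · rw [htop]
    exact le_top
  have hcont : Continuous fun y : ℝ => Real.exp (q * y ^ s) :=
    Real.continuous_exp.comp (continuous_const.mul (Real.continuous_rpow_const (by linarith)))
  have hint : Integrable (fun x => Real.exp (q * |h x| ^ s)) μ := by
    refine ⟨(hcont.comp continuous_abs).comp_aestronglyMeasurable hh, ?_⟩
    rw [hasFiniteIntegral_iff_ofReal (Eventually.of_forall fun _ => (Real.exp_pos _).le)]
    exact Ne.lt_top htop
  have hint' : Integrable (fun x => |h x|) μ := by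
    refine ((integrable_const 1).add (hint.const_mul q⁻¹)).mono'
      (continuous_abs.comp_aestronglyMeasurable hh) (Eventually.of_forall fun x => ?_)
    rw [Real.norm_of_nonneg (abs_nonneg _)]
    refine (le_one_add_rpow hs (abs_nonneg _)).trans ?_
    have h1 := Real.add_one_le_exp (q * |h x| ^ s)
    have h2 : |h x| ^ s ≤ q⁻¹ * Real.exp (q * |h x| ^ s) := by
      rw [inv_mul_eq_div, le_div_iff₀' hq]
      linarith
    simpa using h2
  rw [← ofReal_integral_eq_lintegral_ofReal hint
    (Eventually.of_forall fun _ => (Real.exp_pos _).le)]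
  apply ENNReal.ofReal_le_ofReal
  have h3 := (convexOn_exp_rpow hs hq.le).map_integral_le (f := fun x => |h x|) (μ := μ)
    hcont.continuousOn isClosed_Ici (Eventually.of_forall fun x => mem_Ici.2 (abs_nonneg _)) hint' hint
  refine le_trans ?_ h3
  have h4 : |∫ x, h x ∂μ| ≤ ∫ x, |h x| ∂μ := abs_integral_le_integral_abs
  gcongr

theorem lintegral_rpow_inv_le {μ : Measure Ω} [IsProbabilityMeasure μ] {F : Ω → ℝ≥0∞}
    (hF : AEMeasurable F μ) {L : ℝ} (hL : 1 < L) :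
    ∫⁻ x, F x ^ (1 / L) ∂μ ≤ (∫⁻ x, F x ∂μ) ^ (1 / L) := by
  have h := ENNReal.lintegral_mul_le_Lp_mul_Lq μ (Real.HolderConjugate.conjExponent hL)
    (hF.pow_const (1 / L)) (aemeasurable_const (b := (1 : ℝ≥0∞)))
  have hL0 : L ≠ 0 := by linarith
  simpa [← ENNReal.rpow_mul, hL0] using h

end Jensen

/-! ### Exponential moments under the worst-case expectation. -/

section StateExp

variable {𝓧 : Type*} [MeasurableSpace 𝓧] {Q₀ : Measure 𝓧} [IsProbabilityMeasure Q₀]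
  {Q : Kernel 𝓧 𝓧} [IsMarkovKernel Q]

/-- The worst-case conditional expectation of a function of the next state. -/
noncomputable def stateExp (Q : Kernel 𝓧 𝓧) (u : 𝓧 × 𝓧 → ℝ) (α : ℝ) (v h : 𝓧 → ℝ) : 𝓧 → ℝ :=
  worstCaseExp Q u α v fun p => h p.2

/-- The distortion is the density of an exponential tilt of `Q x`, which is a probability measure
whenever the exponential is integrable; Jensen's inequality thus applies to the worst-case
expectation. -/
theorem stateExp_eq_integral_tilted (Q : Kernel 𝓧 𝓧) (u : 𝓧 × 𝓧 → ℝ) (α : ℝ) (v h : 𝓧 → ℝ)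
    (x : 𝓧) : stateExp Q u α v h x = ∫ x', h x' ∂((Q x).tilted fun x' => v x' + α * u (x, x')) := by
  rw [integral_tilted]
  rfl

theorem measurable_integral_kernel (Q : Kernel 𝓧 𝓧) [IsMarkovKernel Q] {F : 𝓧 × 𝓧 → ℝ}
    (hF : Measurable F) :
    Measurable fun x => ∫ x', F (x, x') ∂(Q x) :=
  (StronglyMeasurable.integral_kernel_prod_right' (f := F) hF.stronglyMeasurable).measurable

theorem measurable_worstCaseDistortion {u : 𝓧 × 𝓧 → ℝ} (hu : Measurable u) (α : ℝ) {v : 𝓧 → ℝ}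
    (hv : Measurable v) : Measurable (worstCaseDistortion Q u α v) := by
  unfold worstCaseDistortion
  exact Measurable.div (by fun_prop)
    ((measurable_integral_kernel Q (F := fun p => Real.exp (v p.2 + α * u p)) (by fun_prop)).comp
      measurable_fst)

theorem measurable_worstCaseExp {u : 𝓧 × 𝓧 → ℝ} (hu : Measurable u) (α : ℝ) {v : 𝓧 → ℝ}
    (hv : Measurable v) {h : 𝓧 × 𝓧 → ℝ} (hh : Measurable h) :
    Measurable (worstCaseExp Q u α v h) :=
  measurable_integral_kernel Q (F := fun p => worstCaseDistortion Q u α v p * h p)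
    ((measurable_worstCaseDistortion hu α hv).mul hh)

theorem measurable_stateExp {u : 𝓧 × 𝓧 → ℝ} (hu : Measurable u) (α : ℝ) {v : 𝓧 → ℝ}
    (hv : Measurable v) {h : 𝓧 → ℝ} (hh : Measurable h) : Measurable (stateExp Q u α v h) :=
  measurable_worstCaseExp hu α hv (hh.comp measurable_snd)

theorem measurable_stateExp_iterate {u : 𝓧 × 𝓧 → ℝ} (hu : Measurable u) (α : ℝ) {v : 𝓧 → ℝ}
    (hv : Measurable v) {h : 𝓧 → ℝ} (hh : Measurable h) (n : ℕ) :
    Measurable ((stateExp Q u α v)^[n] h) := by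
  induction n with
  | zero => exact hh
  | succ n ih =>
    rw [Function.iterate_succ_apply']
    exact measurable_stateExp hu α hv ih

/-- The logarithm of the worst-case belief distortion. -/
noncomputable def logDistortion (Q : Kernel 𝓧 𝓧) (u : 𝓧 × 𝓧 → ℝ) (α : ℝ) (v : 𝓧 → ℝ)
    (p : 𝓧 × 𝓧) : ℝ :=
  v p.2 + α * u p - Real.log (∫ x', Real.exp (v x' + α * u (p.1, x')) ∂(Q p.1))

theorem ae_integrable_exp_aggregate {s : ℝ} (hs : 1 ≤ s) (hQ : Kernel.Invariant Q Q₀)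
    {u : 𝓧 × 𝓧 → ℝ} (hu : Measurable u) (hU : MemOrliczHeart s (Q₀ ⊗ₘ Q) u) (α : ℝ) {v : 𝓧 → ℝ}
    (hvm : Measurable v) (hv : MemOrliczHeart s Q₀ v) :
    ∀ᵐ x ∂Q₀, Integrable (fun x' => Real.exp (v x' + α * u (x, x'))) (Q x) := by
  filter_upwards [ae_integrable_exp_kernel (Y := fun p => v p.2 + α * u p) hs (by fun_prop)
    (memOrliczHeart_aggregate hs hQ hU hv α)] with x hx
  refine (hx 1).mono' (Measurable.aestronglyMeasurable (by fun_prop))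
    (Eventually.of_forall fun x' => ?_)
  rw [Real.norm_of_nonneg (Real.exp_pos _).le, one_mul]
  exact Real.exp_le_exp.2 (le_abs_self _)

theorem memOrliczHeart_logDistortion {s : ℝ} (hs : 1 ≤ s) (hQ : Kernel.Invariant Q Q₀)
    {u : 𝓧 × 𝓧 → ℝ} (hu : Measurable u) (hU : MemOrliczHeart s (Q₀ ⊗ₘ Q) u) (α : ℝ) {v : 𝓧 → ℝ}
    (hvm : Measurable v) (hv : MemOrliczHeart s Q₀ v) :
    MemOrliczHeart s (Q₀ ⊗ₘ Q) (logDistortion Q u α v) := by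
  have h1 := memOrliczHeart_aggregate hs hQ hU hv α
  have h2 := (memOrliczHeart_log_integral_exp hs (X := fun p => v p.2 + α * u p) (by fun_prop)
    h1).comp_measurePreserving (measurePreserving_fst_compProd (Q := Q))
  have h3 := h1.add hs (h2.smul hs (-1))
  refine h3.congr (Eventually.of_forall fun p => ?_)
  simp [logDistortion, sub_eq_add_neg]

/-- Jensen's inequality under the tilted law, then Hölder's inequality between the distortion and
the exponential. Invariance moves the latter from `X_{t+1}` back to `Q₀`, and its power `1 / σ` is
dropped because the integral is at least 1. -/
theorem lintegral_exp_stateExp_le {s : ℝ} (hs : 1 ≤ s) (hQ : Kernel.Invariant Q Q₀)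
    {u : 𝓧 × 𝓧 → ℝ} (hu : Measurable u) (hU : MemOrliczHeart s (Q₀ ⊗ₘ Q) u) (α : ℝ) {v : 𝓧 → ℝ}
    (hvm : Measurable v) (hv : MemOrliczHeart s Q₀ v) {ρ σ : ℝ} (hρσ : ρ.HolderConjugate σ)
    {h : 𝓧 → ℝ} (hh : Measurable h) {q : ℝ} (hq : 0 < q) :
    ∫⁻ x, ENNReal.ofReal (Real.exp (q * |stateExp Q u α v h x| ^ s)) ∂Q₀ ≤
      (∫⁻ p, ENNReal.ofReal (Real.exp (ρ * |logDistortion Q u α v p|)) ∂(Q₀ ⊗ₘ Q)) ^ (1 / ρ) *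
        ∫⁻ x, ENNReal.ofReal (Real.exp (q * σ * |h x| ^ s)) ∂Q₀ := by
  have hint := ae_integrable_exp_aggregate hs hQ hu hU α hvm hv
  have hmm := measurable_worstCaseDistortion (Q := Q) hu α hvm
  set m := worstCaseDistortion Q u α v with hm
  have hρ0 : 0 < ρ := hρσ.pos
  have hσ0 : 0 < σ := hρσ.symm.pos
  have hG : Measurable fun x => ENNReal.ofReal (Real.exp (q * |h x| ^ s)) := by fun_prop
  have hmκ : ∀ᵐ p ∂(Q₀ ⊗ₘ Q), m p = Real.exp (logDistortion Q u α v p) := by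
    have h1 := (measurePreserving_fst_compProd (Q₀ := Q₀) (Q := Q)).quasiMeasurePreserving.ae hint
    filter_upwards [h1] with p hp
    rw [logDistortion, Real.exp_sub, Real.exp_log (integral_exp_pos hp), hm, worstCaseDistortion]
  calc ∫⁻ x, ENNReal.ofReal (Real.exp (q * |stateExp Q u α v h x| ^ s)) ∂Q₀
      ≤ ∫⁻ x, ∫⁻ x', ENNReal.ofReal (m (x, x')) * ENNReal.ofReal (Real.exp (q * |h x'| ^ s))
          ∂(Q x) ∂Q₀ := by
        apply lintegral_mono_ae
        filter_upwards [hint] with x hx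
        have := isProbabilityMeasure_tilted hx
        have h1 := ofReal_exp_rpow_integral_le hs hq
          (μ := (Q x).tilted fun x' => v x' + α * u (x, x')) (h := h) hh.aestronglyMeasurable
        rw [lintegral_tilted, ← stateExp_eq_integral_tilted] at h1
        exact h1
    _ = ∫⁻ p, ((fun p => ENNReal.ofReal (m p)) *
          fun p : 𝓧 × 𝓧 => ENNReal.ofReal (Real.exp (q * |h p.2| ^ s))) p ∂(Q₀ ⊗ₘ Q) := by
        exact (Measure.lintegral_compProd (f := fun p : 𝓧 × 𝓧 => ENNReal.ofReal (m p) *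
          ENNReal.ofReal (Real.exp (q * |h p.2| ^ s)))
          (hmm.ennreal_ofReal.mul (hG.comp measurable_snd))).symm
    _ ≤ (∫⁻ p, ENNReal.ofReal (m p) ^ ρ ∂(Q₀ ⊗ₘ Q)) ^ (1 / ρ) *
          (∫⁻ p, ENNReal.ofReal (Real.exp (q * |h p.2| ^ s)) ^ σ ∂(Q₀ ⊗ₘ Q)) ^ (1 / σ) :=
        ENNReal.lintegral_mul_le_Lp_mul_Lq _ hρσ hmm.ennreal_ofReal.aemeasurable
          (hG.comp measurable_snd).aemeasurable
    _ ≤ _ := by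
        gcongr ?_ * ?_
        · gcongr ?_ ^ _
          apply lintegral_mono_ae
          filter_upwards [hmκ] with p hp
          rw [hp, ENNReal.ofReal_rpow_of_pos (Real.exp_pos _), ← Real.exp_mul, mul_comm]
          apply ENNReal.ofReal_le_ofReal
          have := le_abs_self (logDistortion Q u α v p)
          gcongr
        · have h1 : ∫⁻ p : 𝓧 × 𝓧, ENNReal.ofReal (Real.exp (q * |h p.2| ^ s)) ^ σ ∂(Q₀ ⊗ₘ Q) =
              ∫⁻ x, ENNReal.ofReal (Real.exp (q * σ * |h x| ^ s)) ∂Q₀ := by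
            rw [← (measurePreserving_snd_compProd hQ).lintegral_comp (by fun_prop)]
            apply lintegral_congr
            intro p
            rw [ENNReal.ofReal_rpow_of_pos (Real.exp_pos _), ← Real.exp_mul]
            congr 2
            ring
          rw [h1]
          have h2 : 1 ≤ ∫⁻ x, ENNReal.ofReal (Real.exp (q * σ * |h x| ^ s)) ∂Q₀ := by
            calc (1 : ℝ≥0∞) = ∫⁻ _, 1 ∂Q₀ := by simp
              _ ≤ _ := by
                apply lintegral_mono
                intro x
                exact ENNReal.one_le_ofReal.2 (Real.one_le_exp (by positivity))
          refine (ENNReal.rpow_le_rpow_of_exponent_le h2 (?_ : 1 / σ ≤ 1)).trans_eq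
            (ENNReal.rpow_one _)
          rw [div_le_one hσ0]
          exact hρσ.symm.lt.le

/-- Each application costs one factor of the distortion's `L^ρ` bound and multiplies `q` by `σ`. -/
theorem lintegral_exp_stateExp_iterate_le {s : ℝ} (hs : 1 ≤ s) (hQ : Kernel.Invariant Q Q₀)
    {u : 𝓧 × 𝓧 → ℝ} (hu : Measurable u) (hU : MemOrliczHeart s (Q₀ ⊗ₘ Q) u) (α : ℝ) {v : 𝓧 → ℝ}
    (hvm : Measurable v) (hv : MemOrliczHeart s Q₀ v) {ρ σ : ℝ} (hρσ : ρ.HolderConjugate σ)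
    {h : 𝓧 → ℝ} (hh : Measurable h) (n : ℕ) {q : ℝ} (hq : 0 < q) :
    ∫⁻ x, ENNReal.ofReal (Real.exp (q * |(stateExp Q u α v)^[n] h x| ^ s)) ∂Q₀ ≤
      ((∫⁻ p, ENNReal.ofReal (Real.exp (ρ * |logDistortion Q u α v p|)) ∂(Q₀ ⊗ₘ Q)) ^ (1 / ρ)) ^ n *
        ∫⁻ x, ENNReal.ofReal (Real.exp (q * σ ^ n * |h x| ^ s)) ∂Q₀ := by
  induction n generalizing q with
  | zero => simp
  | succ n ih =>
    rw [Function.iterate_succ_apply']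
    refine (lintegral_exp_stateExp_le hs hQ hu hU α hvm hv hρσ
      (measurable_stateExp_iterate hu α hvm hh n) hq).trans ?_
    have h1 := ih (mul_pos hq hρσ.symm.pos)
    rw [pow_succ', mul_assoc, pow_succ', ← mul_assoc q]
    gcongr

end StateExp

/-! ### Polynomial growth of the iterated worst-case expectations. -/

section SpectralBound

variable {𝓧 : Type*} [MeasurableSpace 𝓧] {Q₀ : Measure 𝓧} [IsProbabilityMeasure Q₀]
  {Q : Kernel 𝓧 𝓧} [IsMarkovKernel Q]

/-- If `N ≤ y ^ (s - 1)` the first term dominates; otherwise `y ≤ N ^ (1 / (s - 1))` and the second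
does. The exponent `J` depends on `s > 1` only. -/
theorem exists_natCast_mul_le_rpow_add_pow {s : ℝ} (hs : 1 < s) :
    ∃ J : ℕ, ∀ (N : ℕ) (y : ℝ), 0 ≤ y → (N : ℝ) * y ≤ y ^ s + (N : ℝ) ^ J := by
  refine ⟨⌈1 + 1 / (s - 1)⌉₊, fun N y hy => ?_⟩
  have hys : 0 ≤ y ^ s := by positivity
  rcases Nat.eq_zero_or_pos N with rfl | hN
  · have : (0 : ℝ) ≤ ((0 : ℕ) : ℝ) ^ ⌈1 + 1 / (s - 1)⌉₊ := by positivity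
    simp only [CharP.cast_eq_zero, zero_mul] at this ⊢
    linarith
  have hN1 : (1 : ℝ) ≤ N := by exact_mod_cast hN
  have hs1 : 0 < s - 1 := by linarith
  rcases le_total (N : ℝ) (y ^ (s - 1)) with h | h
  · have hy0 : 0 < y := by
      rcases hy.eq_or_lt with rfl | h'
      · rw [Real.zero_rpow hs1.ne'] at h
        linarith
      · exact h'
    have h1 : y ^ s = y ^ (s - 1) * y := by
      rw [← Real.rpow_add_one hy0.ne', sub_add_cancel]
    have h2 : (0 : ℝ) ≤ (N : ℝ) ^ ⌈1 + 1 / (s - 1)⌉₊ := by positivity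
    rw [h1]
    nlinarith
  · have h1 : y ≤ (N : ℝ) ^ (1 / (s - 1)) := by
      have h2 := Real.rpow_le_rpow (by positivity) h (by positivity : 0 ≤ 1 / (s - 1))
      rwa [← Real.rpow_mul hy, mul_one_div_cancel hs1.ne', Real.rpow_one] at h2
    have h3 : (N : ℝ) * y ≤ (N : ℝ) ^ ⌈1 + 1 / (s - 1)⌉₊ := by
      calc (N : ℝ) * y ≤ (N : ℝ) ^ (1 : ℝ) * (N : ℝ) ^ (1 / (s - 1)) := by
            rw [Real.rpow_one]; gcongr
        _ = (N : ℝ) ^ (1 + 1 / (s - 1)) := (Real.rpow_add (by linarith) _ _).symm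
        _ ≤ (N : ℝ) ^ ((⌈1 + 1 / (s - 1)⌉₊ : ℕ) : ℝ) :=
            Real.rpow_le_rpow_of_exponent_le hN1 (Nat.le_ceil _)
        _ = _ := Real.rpow_natCast _ _
    linarith

/-- Bernoulli's inequality: `(1 - 1 / (2n)) ^ n ≥ 1 / 2`. -/
theorem conjExponent_two_mul_pow_le {n : ℕ} (hn : 0 < n) :
    (2 * (n : ℝ)).conjExponent ^ n ≤ 2 := by
  have hn1 : (1 : ℝ) ≤ n := by exact_mod_cast hn
  have h1 := one_add_mul_le_pow (a := -(1 / (2 * (n : ℝ)))) (by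
    have : 1 / (2 * (n : ℝ)) ≤ 1 := by
      rw [div_le_one (by linarith)]; linarith
    linarith) n
  have h2 : 1 + (n : ℝ) * -(1 / (2 * (n : ℝ))) = 1 / 2 := by
    field_simp
    norm_num
  rw [h2] at h1
  have h3 : (2 * (n : ℝ)).conjExponent = (1 + -(1 / (2 * (n : ℝ))))⁻¹ := by
    have : 1 + -(1 / (2 * (n : ℝ))) = (2 * (n : ℝ) - 1) / (2 * (n : ℝ)) := by
      field_simp
      ring
    rw [Real.conjExponent, this, inv_div]
  rw [h3, inv_pow]
  exact inv_le_of_inv_le₀ two_pos (by rwa [one_div] at h1)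

/-- The Hölder exponent is tied to the number of iterations: `ρ = 2n` keeps `σ ^ n ≤ 2`, so `q` at
most doubles for every `n`. The price is the moment of order `2n` of the distortion, whose logarithm
is polynomial in `n`. -/
theorem exists_lintegral_exp_stateExp_iterate_bound {s : ℝ} (hs : 1 < s)
    (hQ : Kernel.Invariant Q Q₀)
    {u : 𝓧 × 𝓧 → ℝ} (hu : Measurable u) (hU : MemOrliczHeart s (Q₀ ⊗ₘ Q) u) (α : ℝ) {v : 𝓧 → ℝ}
    (hvm : Measurable v) (hv : MemOrliczHeart s Q₀ v) :
    ∃ (a : ℝ) (J : ℕ), 1 ≤ a ∧ ∀ (n : ℕ) (h : 𝓧 → ℝ), Measurable h → ∀ q : ℝ, 0 < q →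
      ∫⁻ x, ENNReal.ofReal (Real.exp (q * |(stateExp Q u α v)^[n] h x| ^ s)) ∂Q₀ ≤
        ENNReal.ofReal (Real.exp ((2 * (n : ℝ)) ^ J) * a) *
          ∫⁻ x, ENNReal.ofReal (Real.exp (2 * q * |h x| ^ s)) ∂Q₀ := by
  obtain ⟨J, hJ⟩ := exists_natCast_mul_le_rpow_add_pow hs
  have hκ := (memOrliczHeart_logDistortion hs.le hQ hu hU α hvm hv).lintegral_exp_rpow_lt_top
    hs.le one_pos
  set A := ∫⁻ p, ENNReal.ofReal (Real.exp (1 * |logDistortion Q u α v p| ^ s)) ∂(Q₀ ⊗ₘ Q) with hA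
  have hone : ∀ (F : 𝓧 × 𝓧 → ℝ), (∀ p, 0 ≤ F p) →
      1 ≤ ∫⁻ p, ENNReal.ofReal (Real.exp (F p)) ∂(Q₀ ⊗ₘ Q) := by
    intro F hF
    calc (1 : ℝ≥0∞) = ∫⁻ _, 1 ∂(Q₀ ⊗ₘ Q) := by simp
      _ ≤ _ := lintegral_mono fun p => ENNReal.one_le_ofReal.2 (Real.one_le_exp (hF p))
  have hA1 : 1 ≤ A := hone _ fun p => by positivity
  have hAa : A = ENNReal.ofReal A.toReal := (ENNReal.ofReal_toReal hκ.ne).symm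
  have ha1 : 1 ≤ A.toReal := by
    rw [← ENNReal.toReal_one]
    exact ENNReal.toReal_mono hκ.ne hA1
  refine ⟨A.toReal, J, ha1, fun n h hh q hq => ?_⟩
  rcases Nat.eq_zero_or_pos n with rfl | hn
  · rw [Function.iterate_zero_apply]
    have h1 : 1 ≤ Real.exp ((2 * ((0 : ℕ) : ℝ)) ^ J) * A.toReal := by
      have := Real.one_le_exp (by positivity : 0 ≤ (2 * ((0 : ℕ) : ℝ)) ^ J)
      nlinarith
    calc _ ≤ ∫⁻ x, ENNReal.ofReal (Real.exp (2 * q * |h x| ^ s)) ∂Q₀ := by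
          apply lintegral_mono
          intro x
          beta_reduce
          gcongr
          linarith
      _ ≤ _ := le_mul_of_one_le_left' (ENNReal.one_le_ofReal.2 h1)
  have hn1 : (1 : ℝ) ≤ n := by exact_mod_cast hn
  have hρσ := Real.HolderConjugate.conjExponent (p := 2 * (n : ℝ)) (by linarith)
  refine (lintegral_exp_stateExp_iterate_le hs.le hQ hu hU α hvm hv hρσ hh n hq).trans ?_
  gcongr ?_ * ?_
  -- The total exponent is `n / (2n) = 1 / 2`, and the base is at least 1, so the power can be
  -- dropped.
  · rw [← ENNReal.rpow_natCast, ← ENNReal.rpow_mul]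
    have h1 : 1 / (2 * (n : ℝ)) * n ≤ 1 := by
      have : 1 / (2 * (n : ℝ)) * n = 1 / 2 := by field_simp
      rw [this]; norm_num
    refine (ENNReal.rpow_le_rpow_of_exponent_le (hone _ fun p => by positivity) h1).trans ?_
    rw [ENNReal.rpow_one, ENNReal.ofReal_mul (Real.exp_pos _).le, ← hAa, hA,
      ← lintegral_const_mul' _ _ ENNReal.ofReal_ne_top]
    apply lintegral_mono
    intro p
    beta_reduce
    rw [← ENNReal.ofReal_mul (Real.exp_pos _).le, ← Real.exp_add]
    gcongr
    have := hJ (2 * n) |logDistortion Q u α v p| (abs_nonneg _)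
    push_cast at this
    linarith
  · apply lintegral_mono
    intro x
    have := conjExponent_two_mul_pow_le hn
    beta_reduce
    gcongr ENNReal.ofReal (Real.exp (?_ * _))
    nlinarith

/-- The factor `exp B` is removed by a root of order `L`, comparable to `B`. A root rescales the
argument, so a multiplicative constant `exp B` costs only a factor linear in `B` in the norm. -/
theorem luxemburgNorm_le_of_lintegral_exp_le {s : ℝ} (hs : 1 ≤ s) {h k : 𝓧 → ℝ}
    (hkm : Measurable k) (hh : MemOrliczHeart s Q₀ h) {B : ℝ} (hB : 0 ≤ B)
    (hbound : ∀ q : ℝ, 0 < q → ∫⁻ x, ENNReal.ofReal (Real.exp (q * |k x| ^ s)) ∂Q₀ ≤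
      ENNReal.ofReal (Real.exp B) * ∫⁻ x, ENNReal.ofReal (Real.exp (2 * q * |h x| ^ s)) ∂Q₀) :
    MemOrliczHeart s Q₀ k ∧ luxemburgNorm s Q₀ k ≤ (4 + 4 * B) * luxemburgNorm s Q₀ h := by
  have hs0 : 0 < s := by linarith
  constructor
  · refine memOrliczHeart_of_lintegral_exp_rpow_lt_top hkm.aestronglyMeasurable 1 fun K hK => ?_
    refine (hbound K (by linarith)).trans_lt (ENNReal.mul_lt_top ENNReal.ofReal_lt_top ?_)
    exact hh.lintegral_exp_rpow_lt_top hs (by linarith)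
  set L := 2 + 2 * B with hL
  have hL1 : 1 < L := by linarith
  have h2L : 2 * L = 4 + 4 * B := by rw [hL]; ring
  rw [← h2L]
  have hcoef : ∀ c, luxemburgNorm s Q₀ h < c → luxemburgNorm s Q₀ k ≤ 2 * L * c := by
    intro c hc
    have hc0 : 0 < c := (luxemburgNorm_nonneg s Q₀ h).trans_lt hc
    have h1 : ∫⁻ x, ENNReal.ofReal (Real.exp ((|h x| / c) ^ s)) ∂Q₀ ≤ 2 := by
      rw [lintegral_exp_rpow hc0, ← one_add_one_eq_two]
      gcongr
      exact orliczModular_le_one_of_lt hs hh hc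
    -- With this `q` the right side of the bound involves exactly `(|h| / c) ^ s`, whose exponential
    -- integrates to at most 2.
    set q := (c ^ s)⁻¹ / 2 with hq
    have hq0 : 0 < q := by positivity
    have h2 := hbound q hq0
    have h3 : ∀ x, 2 * q * |h x| ^ s = (|h x| / c) ^ s := by
      intro x
      rw [Real.div_rpow (abs_nonneg _) hc0.le, hq]
      field_simp
    simp_rw [h3] at h2
    -- Since `l ^ s = 2L`, passing from scale `c` to `l c` and taking the `L`-th root are the same
    -- operation.
    set l := (2 * L) ^ (1 / s) with hl
    have hl0 : 0 < l := by positivity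
    have hls : l ^ s = 2 * L := by
      rw [hl, ← Real.rpow_mul (by linarith), one_div_mul_cancel hs0.ne', Real.rpow_one]
    have hlL : l ≤ 2 * L := by
      rw [hl]
      refine (Real.rpow_le_rpow_of_exponent_le (by linarith) ((div_le_one hs0).2 hs)).trans_eq
        (Real.rpow_one _)
    refine le_trans (luxemburgNorm_le (mul_pos hl0 hc0) ?_)
      (mul_le_mul_of_nonneg_right hlL hc0.le)
    have h4 : ∫⁻ x, ENNReal.ofReal (Real.exp ((|k x| / (l * c)) ^ s)) ∂Q₀ ≤ 2 := by
      calc ∫⁻ x, ENNReal.ofReal (Real.exp ((|k x| / (l * c)) ^ s)) ∂Q₀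
          = ∫⁻ x, ENNReal.ofReal (Real.exp (q * |k x| ^ s)) ^ (1 / L) ∂Q₀ := by
            apply lintegral_congr
            intro x
            rw [ENNReal.ofReal_rpow_of_pos (Real.exp_pos _), ← Real.exp_mul,
              Real.div_rpow (abs_nonneg _) (by positivity), Real.mul_rpow hl0.le hc0.le, hls, hq]
            congr 2
            field_simp
        _ ≤ (∫⁻ x, ENNReal.ofReal (Real.exp (q * |k x| ^ s)) ∂Q₀) ^ (1 / L) :=
            lintegral_rpow_inv_le (by fun_prop) hL1
        _ ≤ (ENNReal.ofReal (Real.exp B) * 2) ^ (1 / L) := by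
            gcongr
            exact h2.trans (by gcongr)
        _ ≤ 2 := by
            have e2 : (2 : ℝ≥0∞) = ENNReal.ofReal 2 := by norm_num
            rw [e2, ← ENNReal.ofReal_mul (Real.exp_pos _).le,
              ENNReal.ofReal_rpow_of_pos (by positivity)]
            apply ENNReal.ofReal_le_ofReal
            -- This is `B + log 2 ≤ (2 + 2B) log 2`, true because `2 log 2 > 1`; it explains the
            -- choice of `L`.
            have h5 : Real.exp B * 2 ≤ 2 ^ L := by
              rw [Real.rpow_def_of_pos two_pos]
              nth_rw 1 [← Real.exp_log two_pos]
              rw [← Real.exp_add]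
              apply Real.exp_le_exp.2
              have := Real.log_two_gt_d9
              rw [hL]
              nlinarith
            calc (Real.exp B * 2) ^ (1 / L) ≤ (2 ^ L) ^ (1 / L) := by
                  apply Real.rpow_le_rpow (by positivity) h5 (by positivity)
              _ = 2 := by
                  rw [← Real.rpow_mul two_pos.le, mul_one_div_cancel (by linarith), Real.rpow_one]
    rw [lintegral_exp_rpow (mul_pos hl0 hc0), ← one_add_one_eq_two] at h4
    exact ENNReal.le_of_add_le_add_right ENNReal.one_ne_top h4
  refine le_of_forall_pos_le_add fun ε hε => ?_
  have h6 := hcoef (luxemburgNorm s Q₀ h + ε / (2 * L)) (by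
    have : 0 < ε / (2 * L) := by positivity
    linarith)
  have h7 : 2 * L * (luxemburgNorm s Q₀ h + ε / (2 * L)) = 2 * L * luxemburgNorm s Q₀ h + ε := by
    field_simp
  linarith

/-- The iterates of the worst-case conditional expectation grow at most polynomially on the Orlicz
heart. -/
theorem exists_stateExp_iterate_bound {s : ℝ} (hs : 1 < s) (hQ : Kernel.Invariant Q Q₀)
    {u : 𝓧 × 𝓧 → ℝ} (hu : Measurable u) (hU : MemOrliczHeart s (Q₀ ⊗ₘ Q) u) (α : ℝ) {v : 𝓧 → ℝ}
    (hvm : Measurable v) (hv : MemOrliczHeart s Q₀ v) :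
    ∃ (C : ℝ) (J : ℕ), 0 ≤ C ∧ ∀ (n : ℕ) (h : 𝓧 → ℝ), Measurable h → MemOrliczHeart s Q₀ h →
      MemOrliczHeart s Q₀ ((stateExp Q u α v)^[n] h) ∧
      luxemburgNorm s Q₀ ((stateExp Q u α v)^[n] h) ≤
        C * ((n : ℝ) + 1) ^ J * luxemburgNorm s Q₀ h := by
  obtain ⟨a, J, ha, hb⟩ := exists_lintegral_exp_stateExp_iterate_bound hs hQ hu hU α hvm hv
  have hla : 0 ≤ Real.log a := Real.log_nonneg ha
  refine ⟨4 + 4 * (2 ^ J + Real.log a), J, by positivity, fun n h hh hm => ?_⟩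
  have h1 := luxemburgNorm_le_of_lintegral_exp_le (B := (2 * (n : ℝ)) ^ J + Real.log a) hs.le
    (measurable_stateExp_iterate hu α hvm hh n) hm (by positivity) (fun q hq => by
      rw [Real.exp_add, Real.exp_log (by linarith)]
      exact hb n h hh q hq)
  refine ⟨h1.1, h1.2.trans ?_⟩
  have h2 := luxemburgNorm_nonneg s Q₀ h
  have h3 : (1 : ℝ) ≤ ((n : ℝ) + 1) ^ J := one_le_pow₀ (by linarith [Nat.cast_nonneg (α := ℝ) n])
  have h4 : (2 * (n : ℝ)) ^ J ≤ 2 ^ J * ((n : ℝ) + 1) ^ J := by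
    rw [← mul_pow]
    gcongr
    linarith
  gcongr
  nlinarith

end SpectralBound

/-! ### Uniqueness of the continuation value. -/

section Uniqueness

variable {𝓧 : Type*} [MeasurableSpace 𝓧] {Q₀ : Measure 𝓧} [IsProbabilityMeasure Q₀]
  {Q : Kernel 𝓧 𝓧} [IsMarkovKernel Q]

theorem ae_integrable_exp_aggregate_mul {s : ℝ} (hs : 1 ≤ s) (hQ : Kernel.Invariant Q Q₀)
    {u : 𝓧 × 𝓧 → ℝ} (hu : Measurable u) (hU : MemOrliczHeart s (Q₀ ⊗ₘ Q) u) (α : ℝ) {v : 𝓧 → ℝ}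
    (hvm : Measurable v) (hv : MemOrliczHeart s Q₀ v) {w : 𝓧 × 𝓧 → ℝ} (hwm : Measurable w)
    (hw : MemOrliczHeart s (Q₀ ⊗ₘ Q) w) :
    ∀ᵐ x ∂Q₀, Integrable (fun x' => Real.exp (v x' + α * u (x, x')) * w (x, x')) (Q x) := by
  filter_upwards [ae_integrable_exp_kernel (Y := fun p => |v p.2 + α * u p| + |w p|) hs
    (by fun_prop) (((memOrliczHeart_aggregate hs hQ hU hv α).abs hs).add hs (hw.abs hs))] with x hx
  refine (hx 1).mono' (Measurable.aestronglyMeasurable (by fun_prop))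
    (Eventually.of_forall fun x' => ?_)
  rw [norm_mul, Real.norm_of_nonneg (Real.exp_pos _).le, Real.norm_eq_abs, one_mul,
    abs_of_nonneg (by positivity : 0 ≤ |v x' + α * u (x, x')| + |w (x, x')|),
    Real.exp_add |v x' + α * u (x, x')|]
  have h1 := Real.add_one_le_exp |w (x, x')|
  have h2 := le_abs_self (v x' + α * u (x, x'))
  gcongr
  linarith

theorem ae_integrable_tilted {s : ℝ} (hs : 1 ≤ s) (hQ : Kernel.Invariant Q Q₀)
    {u : 𝓧 × 𝓧 → ℝ} (hu : Measurable u) (hU : MemOrliczHeart s (Q₀ ⊗ₘ Q) u) (α : ℝ) {v : 𝓧 → ℝ}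
    (hvm : Measurable v) (hv : MemOrliczHeart s Q₀ v) {h : 𝓧 → ℝ} (hhm : Measurable h)
    (hh : MemOrliczHeart s Q₀ h) :
    ∀ᵐ x ∂Q₀, Integrable h ((Q x).tilted fun x' => v x' + α * u (x, x')) := by
  filter_upwards [ae_integrable_exp_aggregate hs hQ hu hU α hvm hv,
    ae_integrable_exp_aggregate_mul hs hQ hu hU α hvm hv (w := fun p => h p.2) (by fun_prop)
      (hh.comp_measurePreserving (measurePreserving_snd_compProd hQ))] with x h1 h2
  rw [integrable_tilted_iff h1]
  exact h2

theorem stateExp_congr (hQ : Kernel.Invariant Q Q₀) (u : 𝓧 × 𝓧 → ℝ) (α : ℝ) {v v' : 𝓧 → ℝ}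
    (hv : v =ᵐ[Q₀] v') {h h' : 𝓧 → ℝ} (hh : h =ᵐ[Q₀] h') :
    stateExp Q u α v h =ᵐ[Q₀] stateExp Q u α v' h' :=
  worstCaseExp_congr hQ u α hv (ae_ae_of_invariant hQ hh)

theorem stateExp_const_mul (Q : Kernel 𝓧 𝓧) (u : 𝓧 × 𝓧 → ℝ) (α : ℝ) (v h : 𝓧 → ℝ) (c : ℝ)
    (x : 𝓧) : stateExp Q u α v (fun y => c * h y) x = c * stateExp Q u α v h x := by
  rw [stateExp_eq_integral_tilted, stateExp_eq_integral_tilted, integral_const_mul]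

theorem stateExp_mono {s : ℝ} (hs : 1 ≤ s) (hQ : Kernel.Invariant Q Q₀)
    {u : 𝓧 × 𝓧 → ℝ} (hu : Measurable u) (hU : MemOrliczHeart s (Q₀ ⊗ₘ Q) u) (α : ℝ) {v : 𝓧 → ℝ}
    (hvm : Measurable v) (hv : MemOrliczHeart s Q₀ v) {h h' : 𝓧 → ℝ} (hhm : Measurable h)
    (hh : MemOrliczHeart s Q₀ h) (hhm' : Measurable h') (hh' : MemOrliczHeart s Q₀ h')
    (hle : ∀ᵐ x ∂Q₀, h x ≤ h' x) :
    ∀ᵐ x ∂Q₀, stateExp Q u α v h x ≤ stateExp Q u α v h' x := by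
  filter_upwards [ae_integrable_tilted hs hQ hu hU α hvm hv hhm hh,
    ae_integrable_tilted hs hQ hu hU α hvm hv hhm' hh', ae_ae_of_invariant hQ hle] with x h1 h2 h3
  rw [stateExp_eq_integral_tilted, stateExp_eq_integral_tilted]
  exact integral_mono_ae h1 h2 ((tilted_absolutelyContinuous _ _).ae_le h3)

theorem summable_pow_mul_add_one_pow {β : ℝ} (hβ : β ∈ Ioo (0 : ℝ) 1) (J : ℕ) :
    Summable fun n : ℕ => β ^ n * ((n : ℝ) + 1) ^ J := by
  have h := summable_pow_mul_geometric_of_norm_lt_one J (r := β)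
    (by rw [Real.norm_of_nonneg hβ.1.le]; exact hβ.2)
  have h1 := ((summable_nat_add_iff 1).2 h).mul_left β⁻¹
  refine h1.congr fun n => ?_
  have := hβ.1.ne'
  push_cast
  rw [pow_succ]
  field_simp

/-- A function of the Orlicz heart dominating its own discounted worst-case conditional expectation
is nonnegative. -/
theorem nonneg_of_stateExp_le {s : ℝ} (hs : 1 < s) (hQ : Kernel.Invariant Q Q₀)
    {u : 𝓧 × 𝓧 → ℝ} (hu : Measurable u) (hU : MemOrliczHeart s (Q₀ ⊗ₘ Q) u) (α : ℝ) {β : ℝ}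
    (hβ : β ∈ Ioo (0 : ℝ) 1) {v : 𝓧 → ℝ} (hvm : Measurable v) (hv : MemOrliczHeart s Q₀ v)
    {h : 𝓧 → ℝ} (hhm : Measurable h) (hh : MemOrliczHeart s Q₀ h)
    (hle : ∀ᵐ x ∂Q₀, β * stateExp Q u α v h x ≤ h x) : ∀ᵐ x ∂Q₀, 0 ≤ h x := by
  obtain ⟨C, J, hC, hb⟩ := exists_stateExp_iterate_bound hs hQ hu hU α hvm hv
  have hiter : ∀ n : ℕ, ∀ᵐ x ∂Q₀, β ^ n * (stateExp Q u α v)^[n] h x ≤ h x := by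
    intro n
    induction n with
    | zero => simp
    | succ n ih =>
      have h1 := stateExp_mono hs.le hQ hu hU α hvm hv
        (h := fun x => β ^ n * (stateExp Q u α v)^[n] h x)
        ((measurable_stateExp_iterate hu α hvm hhm n).const_mul _)
        ((hb n h hhm hh).1.smul hs.le _) hhm hh ih
      filter_upwards [h1, hle] with x h2 h3
      rw [stateExp_const_mul] at h2
      rw [Function.iterate_succ_apply', pow_succ']
      have := mul_le_mul_of_nonneg_left h2 hβ.1.le
      linarith
  have hneg : MemOrliczHeart s Q₀ fun x => min (h x) 0 := by
    refine hh.mono hs.le (Measurable.aestronglyMeasurable (by fun_prop))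
      (Eventually.of_forall fun x => ?_)
    rcases le_total (h x) 0 with h1 | h1
    · rw [min_eq_left h1]
    · rw [min_eq_right h1, abs_zero]
      exact abs_nonneg _
  -- Where `h < 0` the iterated inequality reads `|h| ≤ β ^ n |E_v^n h|`, so the negative part has
  -- norm at most a quantity tending to 0.
  have hnorm : ∀ n : ℕ, luxemburgNorm s Q₀ (fun x => min (h x) 0) ≤
      β ^ n * ((n : ℝ) + 1) ^ J * (C * luxemburgNorm s Q₀ h) := by
    intro n
    have h1 := luxemburgNorm_mono hs.le ((hb n h hhm hh).1.smul hs.le (β ^ n))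
      (f := fun x => min (h x) 0) (by
        filter_upwards [hiter n] with x hx
        simp only [Pi.smul_apply, smul_eq_mul]
        rcases le_total (h x) 0 with h1 | h1
        · rw [min_eq_left h1, abs_of_nonpos h1, abs_of_nonpos (hx.trans h1)]
          linarith
        · rw [min_eq_right h1, abs_zero]
          exact abs_nonneg _)
    rw [luxemburgNorm_smul hs.le (hb n h hhm hh).1, abs_of_pos (pow_pos hβ.1 n)] at h1
    have h2 := mul_le_mul_of_nonneg_left (hb n h hhm hh).2 (pow_pos hβ.1 n).le
    linarith
  have hlim := (summable_pow_mul_add_one_pow hβ J).tendsto_atTop_zero.mul_const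
    (C * luxemburgNorm s Q₀ h)
  rw [zero_mul] at hlim
  have h0 := le_antisymm (ge_of_tendsto' hlim hnorm) (luxemburgNorm_nonneg s Q₀ _)
  filter_upwards [ae_eq_zero_of_luxemburgNorm_eq_zero hs.le hneg h0] with x hx
  simpa using hx

/-- The recursion is convex in `f`: `v - v' = β log E_{v'} exp (v - v')`, and Jensen's inequality
bounds the logarithm below by `E_{v'} (v - v')`. Exchanging `v` and `v'` gives the other sign. -/
theorem stateExp_sub_le {s : ℝ} (hs : 1 < s) (hQ : Kernel.Invariant Q Q₀)
    {u : 𝓧 × 𝓧 → ℝ} (hu : Measurable u) (hU : MemOrliczHeart s (Q₀ ⊗ₘ Q) u) (α : ℝ)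
    {β : ℝ} (hβ : β ∈ Ioo (0 : ℝ) 1) {v v' : 𝓧 → ℝ} (hvm : Measurable v)
    (hv : MemOrliczHeart s Q₀ v) (hvm' : Measurable v') (hv' : MemOrliczHeart s Q₀ v')
    (hfix : v =ᵐ[Q₀] recursionOp Q u α β v) (hfix' : v' =ᵐ[Q₀] recursionOp Q u α β v') :
    ∀ᵐ x ∂Q₀, β * stateExp Q u α v' (fun y => v y - v' y) x ≤ v x - v' x := by
  have hd : MemOrliczHeart s Q₀ fun y => v y - v' y := by
    have := hv.add hs.le (hv'.smul hs.le (-1))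
    refine this.congr (Eventually.of_forall fun y => ?_)
    simp [sub_eq_add_neg]
  filter_upwards [hfix, hfix', ae_integrable_exp_aggregate hs.le hQ hu hU α hvm hv,
    ae_integrable_exp_aggregate hs.le hQ hu hU α hvm' hv',
    ae_integrable_tilted hs.le hQ hu hU α hvm' hv' (hvm.sub hvm') hd] with x h1 h2 h3 h4 h5
  have hp := isProbabilityMeasure_tilted h4
  have hadd : ∀ x', Real.exp (v' x' + α * u (x, x')) * Real.exp (v x' - v' x') =
      Real.exp (v x' + α * u (x, x')) := fun x' => by
    rw [← Real.exp_add]; ring_nf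
  have h6 : Integrable (fun x' => Real.exp (v x' - v' x'))
      ((Q x).tilted fun x' => v' x' + α * u (x, x')) := by
    rw [integrable_tilted_iff h4]
    simpa only [smul_eq_mul, hadd] using h3
  have h7 := convexOn_exp.map_integral_le (f := fun y => v y - v' y)
    (μ := (Q x).tilted fun x' => v' x' + α * u (x, x')) Real.continuous_exp.continuousOn
    isClosed_univ (Eventually.of_forall fun _ => mem_univ _) h5 h6
  have h8 : ∫ x', Real.exp (v x' - v' x') ∂((Q x).tilted fun x' => v' x' + α * u (x, x')) =
      (∫ x', Real.exp (v x' + α * u (x, x')) ∂(Q x)) /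
        ∫ x', Real.exp (v' x' + α * u (x, x')) ∂(Q x) := by
    rw [integral_tilted, ← integral_div]
    congr 1
    ext x'
    rw [← hadd, smul_eq_mul]
    ring
  rw [h8, ← stateExp_eq_integral_tilted] at h7
  have hI := integral_exp_pos h3
  have hI' := integral_exp_pos h4
  rw [← Real.le_log_iff_exp_le (by positivity), Real.log_div hI.ne' hI'.ne'] at h7
  rw [h1, h2, recursionOp, recursionOp, ← mul_sub]
  exact mul_le_mul_of_nonneg_left h7 hβ.1.le

/-- Uniqueness of the continuation value in the Orlicz heart. -/
theorem recursionOp_fixedPoint_unique {s : ℝ} (hs : 1 < s) (hQ : Kernel.Invariant Q Q₀)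
    {u : 𝓧 × 𝓧 → ℝ} (hu : Measurable u) (hU : MemOrliczHeart s (Q₀ ⊗ₘ Q) u) (α : ℝ)
    {β : ℝ} (hβ : β ∈ Ioo (0 : ℝ) 1) {v v' : 𝓧 → ℝ} (hvm : Measurable v)
    (hv : MemOrliczHeart s Q₀ v) (hvm' : Measurable v') (hv' : MemOrliczHeart s Q₀ v')
    (hfix : v =ᵐ[Q₀] recursionOp Q u α β v) (hfix' : v' =ᵐ[Q₀] recursionOp Q u α β v') :
    v =ᵐ[Q₀] v' := by
  have hd : ∀ {f g : 𝓧 → ℝ}, MemOrliczHeart s Q₀ f → MemOrliczHeart s Q₀ g →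
      MemOrliczHeart s Q₀ fun y => f y - g y := fun {f g} hf hg => by
    have := hf.add hs.le (hg.smul hs.le (-1))
    refine this.congr (Eventually.of_forall fun y => ?_)
    simp [sub_eq_add_neg]
  have h1 := nonneg_of_stateExp_le hs hQ hu hU α hβ hvm' hv' (hvm.sub hvm') (hd hv hv')
    (stateExp_sub_le hs hQ hu hU α hβ hvm hv hvm' hv' hfix hfix')
  have h2 := nonneg_of_stateExp_le hs hQ hu hU α hβ hvm hv (hvm'.sub hvm) (hd hv' hv)
    (stateExp_sub_le hs hQ hu hU α hβ hvm' hv' hvm hv hfix' hfix)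
  filter_upwards [h1, h2] with x h3 h4
  simp only [Pi.sub_apply] at h3 h4
  linarith

end Uniqueness

/-! ### Summability of the Neumann series. -/

section Resolvent

variable {𝓧 : Type*} [MeasurableSpace 𝓧] {Q₀ : Measure 𝓧} [IsProbabilityMeasure Q₀]
  {Q : Kernel 𝓧 𝓧} [IsMarkovKernel Q]

theorem pow_coe_of_stateExp {s : ℝ} {hs : 1 ≤ s} (hQ : Kernel.Invariant Q Q₀)
    {u : 𝓧 × 𝓧 → ℝ} {α β : ℝ} {v : 𝓧 → ℝ}
    {A : OrliczHeart s hs Q₀ →L[ℝ] OrliczHeart s hs Q₀}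
    (hA : ∀ k, ((A k).1 : 𝓧 → ℝ) =ᵐ[Q₀] fun x => β * stateExp Q u α v k.1 x) (n : ℕ)
    (k : OrliczHeart s hs Q₀) :
    (((A ^ n) k).1 : 𝓧 → ℝ) =ᵐ[Q₀] fun x => β ^ n * (stateExp Q u α v)^[n] k.1 x := by
  induction n with
  | zero => simp
  | succ n ih =>
    rw [pow_succ']
    filter_upwards [hA ((A ^ n) k), stateExp_congr hQ u α (EventuallyEq.refl _ v) ih] with x h1 h2
    change (A ((A ^ n) k)).1 x = _
    rw [h1, h2, stateExp_const_mul, Function.iterate_succ_apply']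
    ring

/-- The factor `β ^ n` beats the polynomial growth of the iterates; no bound below 1 on `‖A‖` itself
is needed. -/
theorem summable_norm_pow_of_stateExp {s : ℝ} (hs : 1 < s) (hQ : Kernel.Invariant Q Q₀)
    {u : 𝓧 × 𝓧 → ℝ} (hu : Measurable u) (hU : MemOrliczHeart s (Q₀ ⊗ₘ Q) u) {α β : ℝ}
    (hβ : β ∈ Ioo (0 : ℝ) 1) {v : 𝓧 → ℝ} (hvm : Measurable v) (hv : MemOrliczHeart s Q₀ v)
    {A : OrliczHeart s hs.le Q₀ →L[ℝ] OrliczHeart s hs.le Q₀}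
    (hA : ∀ k, ((A k).1 : 𝓧 → ℝ) =ᵐ[Q₀] fun x => β * stateExp Q u α v k.1 x) :
    Summable fun n => ‖A ^ n‖ := by
  obtain ⟨C, J, hC, hb⟩ := exists_stateExp_iterate_bound hs hQ hu hU α hvm hv
  refine Summable.of_nonneg_of_le (fun n => norm_nonneg _) (fun n => ?_)
    ((summable_pow_mul_add_one_pow hβ J).mul_left C)
  have hβn := pow_pos hβ.1 n
  refine ContinuousLinearMap.opNorm_le_bound _ (by positivity) fun k => ?_
  have h1 := hb n k.1 (OrliczHeart.measurable_coe k) k.2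
  rw [OrliczHeart.norm_def, OrliczHeart.norm_def,
    luxemburgNorm_congr (pow_coe_of_stateExp hQ hA n k)]
  have h2 := luxemburgNorm_smul hs.le h1.1 (β ^ n)
  rw [abs_of_pos hβn] at h2
  change luxemburgNorm s Q₀ (β ^ n • (stateExp Q u α v)^[n] k.1) ≤ _
  rw [h2]
  have h3 := mul_le_mul_of_nonneg_left h1.2 hβn.le
  linarith

end Resolvent

/-! ### Implicit function theorem for fixed points. -/

section Branch

/-- Implicit function theorem for a parametrized fixed-point equation. -/
theorem exists_fixedPoint_branch {P E : Type*} [NormedAddCommGroup P] [NormedSpace ℝ P]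
    [CompleteSpace P] [NormedAddCommGroup E] [NormedSpace ℝ E] [CompleteSpace E] {T : P × E → E}
    {D : P × E →L[ℝ] E} {p₀ : P} {f₀ : E} (hT : HasStrictFDerivAt T D (p₀, f₀))
    (hfix : T (p₀, f₀) = f₀)
    (hsum : Summable fun n => ‖(D ∘L ContinuousLinearMap.inr ℝ P E) ^ n‖) :
    ∃ (V : P → E) (W : P →L[ℝ] E), V p₀ = f₀ ∧ (∀ᶠ p in 𝓝 p₀, T (p, V p) = V p) ∧
      HasFDerivAt V W p₀ ∧
      ∀ h, W h = ∑' n, ((D ∘L ContinuousLinearMap.inr ℝ P E) ^ n) (D (h, 0)) := by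
  set A := D ∘L ContinuousLinearMap.inr ℝ P E with hA
  have hs : Summable fun n => A ^ n := hsum.of_norm
  set S := ∑' n, A ^ n with hS
  have hS1 : S * (1 - A) = 1 := hs.tsum_pow_mul_one_sub
  have hS2 : (1 - A) * S = 1 := hs.one_sub_mul_tsum_pow
  -- The partial derivative of `f - T (p, f)` in `f` is `1 - A`, inverted by the Neumann series `S`.
  have hF : HasStrictFDerivAt (fun p : P × E => p.2 - T p)
      (ContinuousLinearMap.snd ℝ P E - D) (p₀, f₀) := hasStrictFDerivAt_snd.sub hT
  have hinr : (ContinuousLinearMap.snd ℝ P E - D) ∘L ContinuousLinearMap.inr ℝ P E = 1 - A := by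
    ext x
    simp [hA]
  have hinv : ((ContinuousLinearMap.snd ℝ P E - D) ∘L
      ContinuousLinearMap.inr ℝ P E).IsInvertible := by
    rw [hinr]
    exact ContinuousLinearMap.IsInvertible.of_inverse (g := S) hS2 hS1
  have h0 : hF.implicitFunctionOfProdDomain hinv p₀ = f₀ :=
    (hF.eventually_apply_eq_iff_implicitFunctionOfProdDomain hinv).self_of_nhds.mp rfl
  refine ⟨hF.implicitFunctionOfProdDomain hinv, _, h0, ?_,
    (hF.hasStrictFDerivAt_implicitFunctionOfProdDomain hinv).hasFDerivAt, fun h => ?_⟩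
  · filter_upwards [hF.eventually_apply_implicitFunctionOfProdDomain hinv] with p hp
    simp only [hfix, sub_self] at hp
    exact (sub_eq_zero.1 hp).symm
  · have h1 : (1 - A).inverse = S := ContinuousLinearMap.inverse_eq hS2 hS1
    have h2 : S (D (h, 0)) = ∑' n, (A ^ n) (D (h, 0)) :=
      (ContinuousLinearMap.apply ℝ E (D (h, 0))).map_tsum hs
    rw [hinr, h1, ← h2]
    simp

end Branch

/-! ### Derivatives of the continuation value in the parameters. -/

section BranchDerivative

variable {𝓧 : Type*} [MeasurableSpace 𝓧] {Q₀ : Measure 𝓧} [IsProbabilityMeasure Q₀]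
  {Q : Kernel 𝓧 𝓧} [IsMarkovKernel Q]

theorem iterWorstCaseExp_eq_iterate (Q : Kernel 𝓧 𝓧) (u : 𝓧 × 𝓧 → ℝ) (α : ℝ) (v : 𝓧 → ℝ)
    (h : 𝓧 × 𝓧 → ℝ) (n : ℕ) :
    iterWorstCaseExp Q u α v h n = (stateExp Q u α v)^[n] (worstCaseExp Q u α v h) := by
  induction n with
  | zero => rfl
  | succ n ih =>
    rw [Function.iterate_succ_apply', ← ih]
    rfl

theorem stateExp_iterate_const_mul (Q : Kernel 𝓧 𝓧) (u : 𝓧 × 𝓧 → ℝ) (α : ℝ) (v h : 𝓧 → ℝ) (c : ℝ)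
    (n : ℕ) : (stateExp Q u α v)^[n] (fun y => c * h y) =
      fun x => c * (stateExp Q u α v)^[n] h x := by
  induction n with
  | zero => rfl
  | succ n ih =>
    rw [Function.iterate_succ_apply', ih, Function.iterate_succ_apply']
    ext x
    exact stateExp_const_mul Q u α v _ c x

theorem stateExp_iterate_congr (hQ : Kernel.Invariant Q Q₀) (u : 𝓧 × 𝓧 → ℝ) (α : ℝ) {v : 𝓧 → ℝ}
    {h h' : 𝓧 → ℝ} (hh : h =ᵐ[Q₀] h') (n : ℕ) :
    (stateExp Q u α v)^[n] h =ᵐ[Q₀] (stateExp Q u α v)^[n] h' := by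
  induction n with
  | zero => exact hh
  | succ n ih =>
    rw [Function.iterate_succ_apply', Function.iterate_succ_apply']
    exact stateExp_congr hQ u α (EventuallyEq.refl _ v) ih

/-- Local branch of continuation values, differentiable in the parameters, with derivatives given by
discounted sums of worst-case expectations. -/
theorem exists_continuationValue_branch {s : ℝ} (hs : 1 < s) (hQ : Kernel.Invariant Q Q₀)
    {u : 𝓧 × 𝓧 → ℝ} (hu : Measurable u) (hU : MemOrliczHeart s (Q₀ ⊗ₘ Q) u) {α β : ℝ}
    (hβ : β ∈ Ioo (0 : ℝ) 1) {v : 𝓧 → ℝ} (hvm : Measurable v) (hv : MemOrliczHeart s Q₀ v)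
    (hfix : v =ᵐ[Q₀] recursionOp Q u α β v)
    (hT : ContFrechetDifferentiableAt (recursionMap s hs.le Q₀ Q u)
      ((α, β), toOrliczHeart s hs.le Q₀ v)) :
    ∃ (V : ℝ × ℝ → OrliczHeart s hs.le Q₀) (W : ℝ × ℝ →L[ℝ] OrliczHeart s hs.le Q₀),
      V (α, β) = toOrliczHeart s hs.le Q₀ v ∧
      (∀ᶠ q in 𝓝 (α, β), recursionMap s hs.le Q₀ Q u (q, V q) = V q) ∧
      HasFDerivAt V W (α, β) ∧
      ((W (1, 0)).1 : 𝓧 → ℝ) =ᵐ[Q₀] discountedSum Q u α β v u ∧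
      ((W (0, 1)).1 : 𝓧 → ℝ) =ᵐ[Q₀] fun x =>
        β⁻¹ * (v x + discountedSum Q u α β v (fun q => v q.2) x) := by
  set f := toOrliczHeart s hs.le Q₀ v with hf
  have hfv : (f.1 : 𝓧 → ℝ) =ᵐ[Q₀] v := toOrliczHeart_coe hv
  set D := fderiv ℝ (recursionMap s hs.le Q₀ Q u) ((α, β), f) with hDdef
  have hstrict : HasStrictFDerivAt (recursionMap s hs.le Q₀ Q u) D ((α, β), f) :=
    hasStrictFDerivAt_of_hasFDerivAt_of_continuousAt
      (hT.1.mono fun q hq => hq.hasFDerivAt) hT.2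
  have hD := hstrict.hasFDerivAt
  have hfixE : recursionMap s hs.le Q₀ Q u ((α, β), f) = f := by
    apply orliczHeart_ext
    exact (recursionMap_coe hQ hu hU α β f).trans
      ((recursionOp_congr hQ u hfv α β).trans (hfix.symm.trans hfv.symm))
  set A := D ∘L ContinuousLinearMap.inr ℝ (ℝ × ℝ) (OrliczHeart s hs.le Q₀) with hAdef
  have hA : ∀ k, ((A k).1 : 𝓧 → ℝ) =ᵐ[Q₀] fun x => β * stateExp Q u α v k.1 x := by
    intro k
    filter_upwards [fderiv_recursionMap_coe hQ hu hU hD 0 0 k,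
      stateExp_congr hQ u α hfv (EventuallyEq.refl _ (k.1 : 𝓧 → ℝ))] with x h1 h2
    change (D ((0, 0), k)).1 x = _
    rw [h1, ← h2]
    simp [stateExp]
  have hsumA := summable_norm_pow_of_stateExp hs hQ hu hU hβ hvm hv hA
  obtain ⟨V, W, hV0, hVfix, hVW, hW⟩ := exists_fixedPoint_branch hstrict hfixE hsumA
  have hsumk : ∀ k, Summable fun n => ‖(A ^ n) k‖ := fun k =>
    Summable.of_nonneg_of_le (fun n => norm_nonneg _) (fun n => (A ^ n).le_opNorm k)
      (hsumA.mul_right ‖k‖)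
  refine ⟨V, W, hV0, hVfix, hVW, ?_, ?_⟩
  -- The `α`-derivative of the recursion already carries one factor `β` and one expectation, so the
  -- `n`-th Neumann term is the summand of index `n + 1` of the discounted sum.
  · have hB : ((D ((1, 0), 0)).1 : 𝓧 → ℝ) =ᵐ[Q₀] fun x => β * worstCaseExp Q u α v u x := by
      filter_upwards [fderiv_recursionMap_coe hQ hu hU hD 1 0 0,
        worstCaseExp_congr hQ u α hfv (h := fun p =>
          ((0 : OrliczHeart s hs.le Q₀).1 : 𝓧 → ℝ) p.2 + 1 * u p) (h' := u) (by
            filter_upwards [ae_ae_of_invariant hQ (OrliczHeart.coeFn_zero (hs := hs.le))]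
              with x hx
            filter_upwards [hx] with x' hx'
            rw [hx']
            ring)] with x h1 h2
      rw [h1, h2]
      ring
    rw [hW]
    filter_upwards [OrliczHeart.ae_hasSum (hsumk (D ((1, 0), 0))),
      ae_all_iff.2 fun n => pow_coe_of_stateExp hQ hA n (D ((1, 0), 0)),
      ae_all_iff.2 fun n => stateExp_iterate_congr (v := v) hQ u α hB n] with x h1 h2 h3
    rw [← h1.tsum_eq, discountedSum]
    congr 1
    ext n
    rw [h2, h3, stateExp_iterate_const_mul, iterWorstCaseExp_eq_iterate]
    ring
  -- The `β`-derivative of the recursion is the logarithm of the exponential integral, which equals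
  -- `v / β` at the fixed point.
  · have hB : ((D ((0, 1), 0)).1 : 𝓧 → ℝ) =ᵐ[Q₀] fun x => β⁻¹ * v x := by
      filter_upwards [fderiv_recursionMap_coe hQ hu hU hD 0 1 0,
        worstCaseExp_congr hQ u α hfv (h := fun p =>
          ((0 : OrliczHeart s hs.le Q₀).1 : 𝓧 → ℝ) p.2 + 0 * u p) (h' := fun _ => 0) (by
            filter_upwards [ae_ae_of_invariant hQ (OrliczHeart.coeFn_zero (hs := hs.le))]
              with x hx
            filter_upwards [hx] with x' hx'
            rw [hx']
            ring), hfix, recursionOp_congr hQ u hfv α β] with x h1 h2 h3 h4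
      have h5 : worstCaseExp Q u α v (fun _ => 0) x = 0 := by simp [worstCaseExp]
      rw [h1, h2, h5, h3, ← h4, recursionOp]
      have := hβ.1.ne'
      field_simp
      ring
    rw [hW]
    filter_upwards [OrliczHeart.ae_hasSum (hsumk (D ((0, 1), 0))),
      ae_all_iff.2 fun n => pow_coe_of_stateExp hQ hA n (D ((0, 1), 0)),
      ae_all_iff.2 fun n => stateExp_iterate_congr (v := v) hQ u α hB n] with x h1 h2 h3
    -- Here the term of index 0 is `β⁻¹ v`, with no expectation; it is split off as the summand
    -- outside the discounted sum.
    rw [← h1.tsum_eq, h1.summable.tsum_eq_zero_add, discountedSum, mul_add, ← tsum_mul_left]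
    congr 1
    · rw [h2, h3]
      simp
    · congr 1
      ext n
      rw [h2, h3, stateExp_iterate_const_mul, iterWorstCaseExp_eq_iterate,
        Function.iterate_succ_apply]
      change _ = β⁻¹ * (β ^ (n + 1) * (stateExp Q u α v)^[n] (stateExp Q u α v v) x)
      ring

end BranchDerivative

/-! ### A degenerate direction from accumulating solutions. -/

section Identification

variable {𝓧 : Type*} [MeasurableSpace 𝓧] {Q₀ : Measure 𝓧}
  [IsProbabilityMeasure Q₀] {Q : Kernel 𝓧 𝓧} [IsMarkovKernel Q]

theorem MemOrliczHeart.integrable_exp_mul {Ω : Type*} [MeasurableSpace Ω] {μ : Measure Ω}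
    [IsProbabilityMeasure μ] {s : ℝ} (hs : 1 ≤ s) {Y H : Ω → ℝ} (hY : MemOrliczHeart s μ Y)
    (hH : MemLp H 2 μ) : Integrable (fun x => Real.exp |Y x| * |H x|) μ := by
  refine MemLp.integrable_mul (p := 2) (q := 2) ?_ hH.abs
  have hm : AEStronglyMeasurable (fun x => Real.exp |Y x|) μ :=
    (Real.continuous_exp.comp continuous_abs).comp_aestronglyMeasurable hY.1
  rw [memLp_two_iff_integrable_sq hm]
  refine (hY.integrable_exp hs 2).congr (Eventually.of_forall fun x => ?_)
  beta_reduce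
  rw [← Real.exp_nat_mul]
  norm_num

theorem ae_integrable_exp_aggregate_mul_mul {s : ℝ} (hs : 1 ≤ s) (hQ : Kernel.Invariant Q Q₀)
    {u : 𝓧 × 𝓧 → ℝ} (hu : Measurable u) (hU : MemOrliczHeart s (Q₀ ⊗ₘ Q) u) (α : ℝ) {v : 𝓧 → ℝ}
    (hvm : Measurable v) (hv : MemOrliczHeart s Q₀ v) {w : 𝓧 × 𝓧 → ℝ}
    (hw : MemOrliczHeart s (Q₀ ⊗ₘ Q) w) {H : 𝓧 × 𝓧 → ℝ} (hH : MemLp H 2 (Q₀ ⊗ₘ Q)) :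
    ∀ᵐ x ∂Q₀, Integrable (fun x' => Real.exp (v x' + α * u (x, x')) * (H (x, x') * w (x, x')))
      (Q x) := by
  have h := (((memOrliczHeart_aggregate hs hQ hU hv α).abs hs).add hs
    (hw.abs hs)).integrable_exp_mul hs hH
  refine ae_integrable_kernel (F := fun p => Real.exp (v p.2 + α * u p) * (H p * w p)) ?_
  refine h.mono' ?_ (Eventually.of_forall fun p => ?_)
  · exact (Measurable.aestronglyMeasurable (by fun_prop)).mul (hH.1.mul hw.1)
  · simp only [Pi.add_apply]
    rw [norm_mul, Real.norm_of_nonneg (Real.exp_pos _).le, norm_mul, Real.norm_eq_abs,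
      Real.norm_eq_abs, abs_of_nonneg (by positivity : 0 ≤ |v p.2 + α * u p| + |w p|),
      Real.exp_add |v p.2 + α * u p|, mul_assoc, mul_comm |H p|]
    have h1 := Real.add_one_le_exp |w p|
    have h2 := le_abs_self (v p.2 + α * u p)
    gcongr
    linarith

/-- The function `v` is a continuation value for `(α, β)` in `E^{φ_s}` at which the conditional
moment restriction holds, for conditional moments `G`. -/
def MomentEquation {d : ℕ} (s : ℝ) (Q₀ : Measure 𝓧) (Q : Kernel 𝓧 𝓧) (u : 𝓧 × 𝓧 → ℝ)
    (G : Fin d → 𝓧 × 𝓧 → ℝ) (q : ℝ × ℝ) (v : 𝓧 → ℝ) : Prop :=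
  IsContinuationValue s Q₀ Q u q.1 q.2 v ∧ ∀ᵐ x ∂Q₀, ∀ i,
    q.2 * ∫ x', Real.exp (v x' + q.1 * u (x, x')) * G i (x, x') ∂(Q x) =
      ∫ x', Real.exp (v x' + q.1 * u (x, x')) ∂(Q x)

theorem MomentEquation.congr {d : ℕ} {s : ℝ} (hQ : Kernel.Invariant Q Q₀) {u : 𝓧 × 𝓧 → ℝ}
    {G : Fin d → 𝓧 × 𝓧 → ℝ} {q : ℝ × ℝ} {v v' : 𝓧 → ℝ} (h : MomentEquation s Q₀ Q u G q v)
    (hv' : IsContinuationValue s Q₀ Q u q.1 q.2 v') (hvv : v =ᵐ[Q₀] v') :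
    MomentEquation s Q₀ Q u G q v' := by
  refine ⟨hv', ?_⟩
  filter_upwards [h.2, ae_all_iff.2 fun i => ae_integral_exp_congr hQ u hvv q.1 (G i),
    ae_integral_exp_congr hQ u hvv q.1 fun _ => 1] with x h1 h2 h3 i
  simp only [mul_one] at h3
  rw [← h2, ← h3, h1]

/-- The restriction is used with its denominator cleared, so only exponential integrals are
differentiated, for almost every fixed `x`. The limit is the product rule for `β ∫ exp(·) G - ∫
exp(·)` in the direction `e`, with `(W e)(x') + e₁ u` the derivative of the exponent. -/
theorem exists_direction_of_momentEquation {d : ℕ} {s : ℝ} (hs : 1 < s)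
    (hQ : Kernel.Invariant Q Q₀) {u : 𝓧 × 𝓧 → ℝ} (hu : Measurable u)
    (hU : MemOrliczHeart s (Q₀ ⊗ₘ Q) u) {G : Fin d → 𝓧 × 𝓧 → ℝ}
    (hGm : ∀ i, Measurable (G i)) (hG : ∀ i, MemLp (G i) 2 (Q₀ ⊗ₘ Q)) {α β : ℝ}
    {v : 𝓧 → ℝ} (hv : MomentEquation s Q₀ Q u G (α, β) v)
    {V : ℝ × ℝ → OrliczHeart s hs.le Q₀} {W : ℝ × ℝ →L[ℝ] OrliczHeart s hs.le Q₀}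
    (hV0 : V (α, β) = toOrliczHeart s hs.le Q₀ v) (hVW : HasFDerivAt V W (α, β))
    (hfreq : ∃ᶠ q in 𝓝[≠] (α, β), MomentEquation s Q₀ Q u G q (V q).1) :
    ∃ e : ℝ × ℝ, e ≠ 0 ∧ ∀ᵐ x ∂Q₀, ∀ i,
      ∫ x', Real.exp (v x' + α * u (x, x')) *
        ((β * G i (x, x') - 1) * ((W e).1 x' + e.1 * u (x, x'))) ∂(Q x) +
      e.2 * ∫ x', Real.exp (v x' + α * u (x, x')) * G i (x, x') ∂(Q x) = 0 := by
  obtain ⟨hvcv, hveq⟩ := hv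
  obtain ⟨hvm, hvM, -⟩ := hvcv
  have hball : ∀ᶠ q in 𝓝[≠] (α, β), ‖q - (α, β)‖ ≤ 1 := by
    refine nhdsWithin_le_nhds ?_
    filter_upwards [Metric.closedBall_mem_nhds (α, β) one_pos] with q hq
    rwa [mem_closedBall_iff_norm] at hq
  obtain ⟨q, hqlim, hq⟩ := exists_seq_forall_of_frequently
    (hfreq.and_eventually (hball.and self_mem_nhdsWithin))
  have hq0 : ∀ n, 0 < ‖q n - (α, β)‖ := fun n => norm_pos_iff.2 (sub_ne_zero.2 (hq n).2.2)
  have hsph : ∀ n, ‖q n - (α, β)‖⁻¹ • (q n - (α, β)) ∈ Metric.sphere (0 : ℝ × ℝ) 1 := by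
    intro n
    rw [mem_sphere_zero_iff_norm, norm_smul, norm_inv, norm_norm, inv_mul_cancel₀ (hq0 n).ne']
  -- Compactness of the unit sphere in the parameter plane supplies the limit direction.
  obtain ⟨e, he, φ, hφ, hφe⟩ := (isCompact_sphere (0 : ℝ × ℝ) 1).tendsto_subseq hsph
  have he0 : e ≠ 0 := by
    rintro rfl
    simp at he
  have hqn : Tendsto (fun n => q n - (α, β)) atTop (𝓝 0) := by
    have := (tendsto_nhds_of_tendsto_nhdsWithin hqlim).sub_const (α, β)
    rwa [sub_self] at this
  have hw : Tendsto (fun n => ‖q (φ n) - (α, β)‖⁻¹ • (V (q (φ n)) - V (α, β))) atTop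
      (𝓝 (W e)) := by
    have h3 := (hasFDerivWithinAt_univ.2 hVW).lim (c := fun n => ‖q (φ n) - (α, β)‖⁻¹)
      (d := fun n => q (φ n) - (α, β)) (v := e) (hqn.comp hφ.tendsto_atTop)
      (Eventually.of_forall fun _ => mem_univ _) hφe
    simpa using h3
  obtain ⟨ψ, hψ, S, hSM, hSae⟩ := OrliczHeart.exists_subseq_dominated hw
  set t : ℕ → ℝ := fun n => ‖q (φ (ψ n)) - (α, β)‖ with ht
  set w : ℕ → OrliczHeart s hs.le Q₀ :=
    fun n => ‖q (φ (ψ n)) - (α, β)‖⁻¹ • (V (q (φ (ψ n))) - V (α, β)) with hwdef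
  set ee : ℕ → ℝ × ℝ := fun n => (t n)⁻¹ • (q (φ (ψ n)) - (α, β)) with hee
  have htpos : ∀ n, 0 < t n := fun n => hq0 _
  have ht0 : ∀ n, t n ≠ 0 := fun n => (htpos n).ne'
  have ht1 : ∀ n, |t n| ≤ 1 := fun n => by
    rw [abs_of_pos (htpos n)]
    exact (hq _).2.1
  have hφψ : Tendsto (fun n => φ (ψ n)) atTop atTop := hφ.tendsto_atTop.comp hψ.tendsto_atTop
  have htt : Tendsto t atTop (𝓝 0) := by simpa using (hqn.comp hφψ).norm
  have heelim : Tendsto ee atTop (𝓝 e) := hφe.comp hψ.tendsto_atTop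
  have hqee : ∀ n, q (φ (ψ n)) = (α + t n * (ee n).1, β + t n * (ee n).2) := by
    intro n
    have h1 : t n • ee n = q (φ (ψ n)) - (α, β) := by
      rw [hee]
      exact smul_inv_smul₀ (ht0 n) _
    exact sub_eq_iff_eq_add'.1 h1.symm
  have hee1 : ∀ n, |(ee n).1| ≤ 1 := by
    intro n
    have h1 := hsph (φ (ψ n))
    rw [mem_sphere_zero_iff_norm] at h1
    exact (norm_fst_le (ee n)).trans_eq h1
  have hVq : ∀ n, ((V (q (φ (ψ n)))).1 : 𝓧 → ℝ) =ᵐ[Q₀] fun x => v x + t n * (w n).1 x := by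
    intro n
    have h1 : V (q (φ (ψ n))) = V (α, β) + t n • w n := by
      simp only [hwdef]
      rw [smul_inv_smul₀ (ht0 n)]
      abel
    rw [h1, hV0]
    filter_upwards [OrliczHeart.coeFn_add (toOrliczHeart s hs.le Q₀ v) (t n • w n),
      OrliczHeart.coeFn_smul (t n) (w n), toOrliczHeart_coe (hs := hs.le) hvM] with x h2 h3 h4
    rw [h2, h3, h4]
  set X : 𝓧 × 𝓧 → ℝ := fun p => v p.2 + α * u p with hX
  have hXm : Measurable X := by fun_prop
  have hXM : MemOrliczHeart s (Q₀ ⊗ₘ Q) X := memOrliczHeart_aggregate hs.le hQ hU hvM α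
  set zn : ℕ → 𝓧 × 𝓧 → ℝ := fun n p => (w n).1 p.2 + (ee n).1 * u p with hzn
  set z : 𝓧 × 𝓧 → ℝ := fun p => (W e).1 p.2 + e.1 * u p with hz
  have hznm : ∀ n, Measurable (zn n) := fun n => by
    have := OrliczHeart.measurable_coe (w n)
    fun_prop
  -- Majorant for all perturbed exponents: `S` dominates the quotients of `V`, and the
  -- `α`-components of the unit directions are at most 1 in absolute value.
  set S' : 𝓧 × 𝓧 → ℝ := fun p => S p.2 + |u p| with hS'
  have hS'M : MemOrliczHeart s (Q₀ ⊗ₘ Q) S' :=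
    (hSM.comp_measurePreserving (measurePreserving_snd_compProd hQ)).add hs.le (hU.abs hs.le)
  have hYM : MemOrliczHeart s (Q₀ ⊗ₘ Q) fun p => |X p| + 2 * |S' p| :=
    (hXM.abs hs.le).add hs.le ((hS'M.abs hs.le).smul hs.le 2)
  have hint : ∀ {H : 𝓧 × 𝓧 → ℝ}, MemLp H 2 (Q₀ ⊗ₘ Q) →
      ∀ᵐ x ∂Q₀, Integrable (fun x' => Real.exp (X (x, x') + 2 * S' (x, x')) * |H (x, x')|)
        (Q x) := by
    intro H hH
    refine ae_integrable_kernel (F := fun p => Real.exp (X p + 2 * S' p) * |H p|) ?_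
    refine (hYM.integrable_exp_mul hs.le hH).mono' ?_ (Eventually.of_forall fun p => ?_)
    · exact (Real.continuous_exp.comp_aestronglyMeasurable (hXM.1.add (hS'M.1.const_mul 2))).mul
        (continuous_abs.comp_aestronglyMeasurable hH.1)
    · rw [norm_mul, Real.norm_of_nonneg (Real.exp_pos _).le, Real.norm_of_nonneg (abs_nonneg _),
        abs_of_nonneg (by positivity : 0 ≤ |X p| + 2 * |S' p|)]
      have h1 := le_abs_self (X p)
      have h2 := le_abs_self (S' p)
      gcongr
  have hzM : MemOrliczHeart s (Q₀ ⊗ₘ Q) z := memOrliczHeart_aggregate hs.le hQ hU (W e).2 e.1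
  refine ⟨e, he0, ?_⟩
  filter_upwards [hveq, ae_all_iff.2 fun n => (hq (φ (ψ n))).1.2,
    ae_all_iff.2 fun i => hint (hG i), hint (memLp_const (1 : ℝ)),
    ae_all_iff.2 fun i => ae_integrable_exp_aggregate_mul_mul hs.le hQ hu hU α hvm hvM hzM (hG i),
    ae_integrable_exp_aggregate_mul_mul hs.le hQ hu hU α hvm hvM hzM (memLp_const (1 : ℝ)),
    ae_ae_of_invariant hQ hSae, ae_all_iff.2 fun n => ae_ae_of_invariant hQ (hVq n)]
    with x h0 hn hiG hi1 hizG hiz hdom hVx i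
  have hdom' : ∀ᵐ x' ∂(Q x), (∀ n, |zn n (x, x')| ≤ S' (x, x')) ∧
      Tendsto (fun n => zn n (x, x')) atTop (𝓝 (z (x, x'))) := by
    filter_upwards [hdom] with x' hx'
    refine ⟨fun n => ?_, ?_⟩
    · have h1 := hx'.1 n
      have h2 : |(ee n).1 * u (x, x')| ≤ |u (x, x')| := by
        rw [abs_mul]
        exact mul_le_of_le_one_left (abs_nonneg _) (hee1 n)
      exact (abs_add_le _ _).trans (add_le_add h1 h2)
    · exact hx'.2.add (((continuous_fst.tendsto e).comp heelim).mul_const _)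
  have hexp : ∀ (n : ℕ) (H : 𝓧 → ℝ), ∫ x', Real.exp ((V (q (φ (ψ n)))).1 x' +
      (q (φ (ψ n))).1 * u (x, x')) * H x' ∂(Q x) =
      ∫ x', Real.exp (X (x, x') + t n * zn n (x, x')) * H x' ∂(Q x) := by
    intro n H
    apply integral_congr_ae
    filter_upwards [hVx n] with x' hx'
    rw [hx', hqee n]
    congr 2
    simp only [hX, hzn]
    ring
  have hquot : ∀ {H : 𝓧 → ℝ}, Measurable H →
      Integrable (fun x' => Real.exp (X (x, x') + 2 * S' (x, x')) * |H x'|) (Q x) → _ :=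
    fun {H} hHm hHi => tendsto_exp_integral_quotient (μ := Q x) (X := fun x' => X (x, x'))
      (H := H) (z := fun x' => z (x, x')) (S := fun x' => S' (x, x'))
      (zn := fun n x' => zn n (x, x')) ht0 ht1 htt (Measurable.aestronglyMeasurable (by fun_prop))
      hHm.aestronglyMeasurable
      (fun n => ((hznm n).comp measurable_prodMk_left).aestronglyMeasurable) hdom' hHi
  obtain ⟨-, iG0, qG⟩ := hquot (H := fun x' => G i (x, x')) ((hGm i).comp measurable_prodMk_left)
    (hiG i)
  obtain ⟨-, i10, q1⟩ := hquot (H := fun _ => 1) measurable_const hi1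
  simp only [mul_one, one_mul] at i10 q1 hiz
  have hJ : Tendsto (fun n => ∫ x', Real.exp (X (x, x') + t n * zn n (x, x')) * G i (x, x') ∂(Q x))
      atTop (𝓝 (∫ x', Real.exp (X (x, x')) * G i (x, x') ∂(Q x))) := by
    have h1 := (qG.mul htt).add_const (∫ x', Real.exp (X (x, x')) * G i (x, x') ∂(Q x))
    simp only [mul_zero, zero_add] at h1
    refine h1.congr fun n => ?_
    rw [div_mul_cancel₀ _ (ht0 n), sub_add_cancel]
  -- Product rule for the varying factor `β + t n * (ee n).2`. Both sides of the restriction agree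
  -- at `(α, β)` and at each `q (φ (ψ n))`, so their quotients have the same limit.
  have hlim := (qG.const_mul β).add (((continuous_snd.tendsto e).comp heelim).mul hJ)
  have hkey := tendsto_nhds_unique hlim (q1.congr fun n => ?_)
  · have h1 : ∫ x', Real.exp (v x' + α * u (x, x')) *
        ((β * G i (x, x') - 1) * ((W e).1 x' + e.1 * u (x, x'))) ∂(Q x) =
        β * ∫ x', Real.exp (X (x, x')) * z (x, x') * G i (x, x') ∂(Q x) -
          ∫ x', Real.exp (X (x, x')) * z (x, x') ∂(Q x) := by
      rw [← integral_const_mul, ← integral_sub]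
      · congr 1
        ext x'
        simp only [hX, hz]
        ring
      · refine ((hizG i).const_mul β).congr (Eventually.of_forall fun x' => ?_)
        simp only [hX]
        ring
      · exact hiz
    rw [h1]
    linarith
  · have h1 := hn n i
    have h2 := hexp n fun _ => 1
    simp only [mul_one] at h2
    rw [hexp n fun x' => G i (x, x'), h2] at h1
    have h3 := h0 i
    have h4 : (q (φ (ψ n))).2 = β + t n * (ee n).2 := by rw [hqee n]
    rw [h4] at h1
    simp only [Function.comp]
    rw [← h1]
    change _ = _ * ((_ - ∫ x', Real.exp (v x' + α * u (x, x')) * G i (x, x') ∂(Q x)) / _) + _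
    change (_ - ∫ x', Real.exp (v x' + α * u (x, x')) ∂(Q x)) / _ = _
    rw [← h3]
    have := ht0 n
    field_simp
    ring

end Identification

/-! ### The moment restriction, the moment matrix and the change of parameters. -/

section MomentMap

variable {𝓧 𝓨 : Type*} [MeasurableSpace 𝓧] [MeasurableSpace 𝓨] {Q₀ : Measure 𝓧}
  {Q : Kernel 𝓧 𝓧} {d : ℕ}

theorem IsContinuationValue.of_le {r s : ℝ} (hs : 1 ≤ s) (hsr : s ≤ r) [IsProbabilityMeasure Q₀]
    {u : 𝓧 × 𝓧 → ℝ} {α β : ℝ} {v : 𝓧 → ℝ} (h : IsContinuationValue r Q₀ Q u α β v) :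
    IsContinuationValue s Q₀ Q u α β v :=
  ⟨h.1, h.2.1.of_le hs hsr, h.2.2⟩

theorem isContinuationValue_continuationValue {r : ℝ} {u : 𝓧 × 𝓧 → ℝ} {α β : ℝ}
    (h : ∃ v, IsContinuationValue r Q₀ Q u α β v) :
    IsContinuationValue r Q₀ Q u α β (continuationValue r Q₀ Q u α β) := by
  unfold continuationValue
  rw [dif_pos h]
  exact h.choose_spec

theorem momentMatrix_apply (R : Kernel (𝓧 × 𝓧) 𝓨) (u : 𝓧 × 𝓧 → ℝ)
    (g : (𝓧 × 𝓧) × 𝓨 → Fin d → ℝ) (α β : ℝ) (v : 𝓧 → ℝ) (j k : Fin 2) :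
    momentMatrix Q₀ Q R u g α β v j k = ∫ x, ∑ i,
      (![fun i => momentDerivAlpha Q R u g α β v i x, fun i => momentDerivBeta Q R u g α β v i x] :
        Fin 2 → Fin d → ℝ) j i *
      (![fun i => momentDerivAlpha Q R u g α β v i x, fun i => momentDerivBeta Q R u g α β v i x] :
        Fin 2 → Fin d → ℝ) k i ∂Q₀ := by
  simp only [momentMatrix, Matrix.of_apply, Matrix.mul_apply, Matrix.transpose_apply]

/-- A constant leaves the Bochner integral even when the integrand is not integrable, so no moments
of the derivatives are needed. -/
theorem integral_sum_mul_eq {a b : 𝓧 → Fin d → ℝ} {c : ℝ} (h : ∀ᵐ x ∂Q₀, ∀ i, a x i = c * b x i) :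
    (∫ x, ∑ i, a x i * a x i ∂Q₀) = c ^ 2 * ∫ x, ∑ i, b x i * b x i ∂Q₀ ∧
    (∫ x, ∑ i, a x i * b x i ∂Q₀) = c * ∫ x, ∑ i, b x i * b x i ∂Q₀ ∧
    (∫ x, ∑ i, b x i * a x i ∂Q₀) = c * ∫ x, ∑ i, b x i * b x i ∂Q₀ := by
  simp only [← integral_const_mul]
  refine ⟨integral_congr_ae ?_, integral_congr_ae ?_, integral_congr_ae ?_⟩ <;>
  · filter_upwards [h] with x hx
    rw [Finset.mul_sum]
    refine Finset.sum_congr rfl fun i _ => ?_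
    rw [hx i]
    ring

/-- One row is a constant multiple of the other, so the determinant vanishes. The determinant is
used rather than the quadratic form at `e`, because splitting the integral of a square would require
integrable entries. -/
theorem momentMatrix_not_posDef {R : Kernel (𝓧 × 𝓧) 𝓨} {u : 𝓧 × 𝓧 → ℝ}
    {g : (𝓧 × 𝓧) × 𝓨 → Fin d → ℝ} {α β : ℝ} {v : 𝓧 → ℝ} {e : ℝ × ℝ} (he : e ≠ 0)
    (h : ∀ᵐ x ∂Q₀, ∀ i, e.1 * momentDerivAlpha Q R u g α β v i x +
      e.2 * momentDerivBeta Q R u g α β v i x = 0) :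
    ¬ (momentMatrix Q₀ Q R u g α β v).PosDef := by
  intro hpos
  have hdet := hpos.det_pos
  rw [Matrix.det_fin_two, momentMatrix_apply, momentMatrix_apply, momentMatrix_apply,
    momentMatrix_apply] at hdet
  simp only [Matrix.cons_val_zero, Matrix.cons_val_one] at hdet
  by_cases h1 : e.1 = 0
  · have h2 : e.2 ≠ 0 := fun h2 => he (Prod.ext h1 h2)
    obtain ⟨k1, k2, k3⟩ := integral_sum_mul_eq (Q₀ := Q₀)
      (a := fun x i => momentDerivBeta Q R u g α β v i x)
      (b := fun x i => momentDerivAlpha Q R u g α β v i x) (c := 0) (by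
        filter_upwards [h] with x hx i
        have := hx i
        rw [h1, zero_mul, zero_add] at this
        rw [zero_mul]
        exact (mul_eq_zero.1 this).resolve_left h2)
    rw [k1, k2, k3] at hdet
    simp at hdet
  · obtain ⟨k1, k2, k3⟩ := integral_sum_mul_eq (Q₀ := Q₀)
      (a := fun x i => momentDerivAlpha Q R u g α β v i x)
      (b := fun x i => momentDerivBeta Q R u g α β v i x) (c := -e.2 / e.1) (by
        filter_upwards [h] with x hx i
        have := hx i
        field_simp
        linarith)
    rw [k1, k2, k3] at hdet
    refine absurd hdet (le_of_eq ?_).not_gt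
    ring

theorem measurable_condMoment {R : Kernel (𝓧 × 𝓧) 𝓨} [IsMarkovKernel R]
    {g : (𝓧 × 𝓧) × 𝓨 → Fin d → ℝ} (hg : Measurable g) (i : Fin d) :
    Measurable (condMoment R g i) :=
  (StronglyMeasurable.integral_kernel_prod_right' (f := fun z => g z i)
    ((measurable_pi_apply i).comp hg).stronglyMeasurable).measurable

theorem alphaOf_injective {β : ℝ} (hβ : β < 1) : Function.Injective (alphaOf β) := by
  intro θ θ' h
  have h1 : 1 - β ≠ 0 := by linarith
  simp only [alphaOf, neg_inj, one_div, inv_inj] at h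
  exact mul_right_cancel₀ h1 h

theorem tendsto_alphaOf {β₀ θ₀ : ℝ} (hβ₀ : β₀ ∈ Ioo (0 : ℝ) 1) (hθ₀ : 0 < θ₀) :
    Tendsto (fun p : ℝ × ℝ => (alphaOf p.1 p.2, p.1)) (𝓝[≠] (β₀, θ₀))
      (𝓝[≠] (alphaOf β₀ θ₀, β₀)) := by
  refine tendsto_nhdsWithin_iff.2 ⟨?_, ?_⟩
  · refine Tendsto.mono_left ?_ nhdsWithin_le_nhds
    have h1 : θ₀ * (1 - β₀) ≠ 0 := (mul_pos hθ₀ (by linarith [hβ₀.2])).ne'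
    have h2 : ContinuousAt (fun p : ℝ × ℝ => p.2 * (1 - p.1)) (β₀, θ₀) := by fun_prop
    have h3 : ContinuousAt (fun p : ℝ × ℝ => 1 / (p.2 * (1 - p.1))) (β₀, θ₀) :=
      continuousAt_const.div h2 h1
    exact h3.neg.prodMk continuousAt_fst
  -- Equality of images forces equal `β`, and then `θ` is recovered from `α`.
  · filter_upwards [self_mem_nhdsWithin] with p hp heq
    simp only [mem_singleton_iff, Prod.mk.injEq] at heq
    refine hp (Prod.ext heq.2 ?_)
    have h3 := heq.1
    rw [heq.2] at h3
    exact alphaOf_injective hβ₀.2 h3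

/-- Integrating out `Y_{t+1}` by Fubini's theorem replaces `g` by its conditional mean; the positive
denominator of the distortion is then multiplied out. -/
theorem MomentRestriction.exists_momentEquation [IsProbabilityMeasure Q₀] [IsMarkovKernel Q]
    {R : Kernel (𝓧 × 𝓧) 𝓨} [IsMarkovKernel R]
    {r s : ℝ} (hs : 1 ≤ s) (hsr : s ≤ r) (hQ : Kernel.Invariant Q Q₀)
    {u : 𝓧 × 𝓧 → ℝ} (hu : Measurable u) (hU : MemOrliczHeart s (Q₀ ⊗ₘ Q) u)
    {g : (𝓧 × 𝓧) × 𝓨 → Fin d → ℝ} {β θ : ℝ} (h : MomentRestriction r Q₀ Q R u g β θ) :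
    (∃ v, IsContinuationValue r Q₀ Q u (alphaOf β θ) β v) ∧
    ∃ v, MomentEquation s Q₀ Q u (condMoment R g) (alphaOf β θ, β) v := by
  obtain ⟨v, hv, hm⟩ := h
  refine ⟨⟨v, hv⟩, v, hv.of_le hs hsr, ?_⟩
  filter_upwards [hm, ae_integrable_exp_aggregate hs hQ hu hU (alphaOf β θ) hv.1
    (hv.2.1.of_le hs hsr)] with x hx hI i
  obtain ⟨h1, h2⟩ := hx i
  rw [integral_sub h1 (integrable_const _), integral_compProd h1] at h2
  have hpos := integral_exp_pos hI
  simp only [integral_const_mul, integral_const, probReal_univ, smul_eq_mul, mul_one] at h2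
  have h3 : ∫ x', worstCaseDistortion Q u (alphaOf β θ) v (x, x') *
      (β * ∫ y, g ((x, x'), y) i ∂(R (x, x'))) ∂(Q x) =
      (β * ∫ x', Real.exp (v x' + alphaOf β θ * u (x, x')) * condMoment R g i (x, x') ∂(Q x)) /
        ∫ x', Real.exp (v x' + alphaOf β θ * u (x, x')) ∂(Q x) := by
    rw [← integral_const_mul, ← integral_div]
    congr 1
    ext x'
    simp only [worstCaseDistortion, condMoment]
    ring
  rw [h3, sub_eq_zero, div_eq_one_iff_eq hpos.ne'] at h2
  exact h2

end MomentMap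

end WorstCase

/-! ### Proof of local identification. -/

open WorstCase

theorem proposition3p2
    {𝓧 𝓨 : Type*} [MeasurableSpace 𝓧] [MeasurableSpace 𝓨] {d : ℕ}
    (Q₀ : Measure 𝓧) [IsProbabilityMeasure Q₀]
    (Q : Kernel 𝓧 𝓧) [IsMarkovKernel Q] (hQ : Kernel.Invariant Q Q₀)
    (R : Kernel (𝓧 × 𝓧) 𝓨) [IsMarkovKernel R]
    (u : 𝓧 × 𝓧 → ℝ) (hu : Measurable u)
    (g : (𝓧 × 𝓧) × 𝓨 → Fin d → ℝ) (hg : Measurable g)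
    (β₀ θ₀ : ℝ) (hβ₀ : β₀ ∈ Ioo (0 : ℝ) 1) (hθ₀ : 0 < θ₀)
    (r : ℝ) (hr : 1 < r) (hU : MemOrliczHeart r (Q₀ ⊗ₘ Q) u)
    (s : ℝ) (hs : 1 < s) (hsr : s ≤ r)
    (hT : ContFrechetDifferentiableAt (recursionMap s hs.le Q₀ Q u)
      ((alphaOf β₀ θ₀, β₀),
        toOrliczHeart s hs.le Q₀ (continuationValue r Q₀ Q u (alphaOf β₀ θ₀) β₀)))
    (hgint : ∀ᵐ p ∂(Q₀ ⊗ₘ Q), ∀ i : Fin d, Integrable (fun y => g (p, y) i) (R p))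
    (ε : ℝ) (hε : 0 < ε)
    (hgmom : ∀ i : Fin d, MemLp (condMoment R g i) (ENNReal.ofReal (2 + ε)) (Q₀ ⊗ₘ Q))
    (hV : (momentMatrix Q₀ Q R u g (alphaOf β₀ θ₀) β₀
      (continuationValue r Q₀ Q u (alphaOf β₀ θ₀) β₀)).PosDef) :
    LocallyIdentified r Q₀ Q R u g (β₀, θ₀) := by
  have hUs : MemOrliczHeart s (Q₀ ⊗ₘ Q) u := hU.of_le hs.le hsr
  have hG : ∀ i, MemLp (condMoment R g i) 2 (Q₀ ⊗ₘ Q) := fun i =>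
    (hgmom i).mono_exponent (by
      rw [← ENNReal.ofReal_ofNat 2]
      exact ENNReal.ofReal_le_ofReal (by linarith))
  by_contra hnot
  have hdom : Ioo (0 : ℝ) 1 ×ˢ Ioi (0 : ℝ) ∈ 𝓝 (β₀, θ₀) :=
    prod_mem_nhds (Ioo_mem_nhds hβ₀.1 hβ₀.2) (Ioi_mem_nhds hθ₀)
  have hfreq : ∃ᶠ p in 𝓝[≠] (β₀, θ₀), ObservationallyEquivalent r Q₀ Q R u g p (β₀, θ₀) := by
    intro hev
    rw [eventually_nhdsWithin_iff] at hev
    exact hnot ⟨_, inter_mem hdom hev, inter_subset_left, fun p hp hne => hp.2 hne⟩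
  obtain ⟨p, hp⟩ := hfreq.exists
  -- Equivalence includes the restriction at `(β₀, θ₀)` itself. A continuation value therefore
  -- exists there, and the default 0 of `continuationValue` is not taken.
  obtain ⟨hex, v', hv'⟩ := hp.2.exists_momentEquation hs.le hsr hQ hu hUs
  have hcv := isContinuationValue_continuationValue hex
  set α₀ := alphaOf β₀ θ₀ with hα₀
  set v := continuationValue r Q₀ Q u α₀ β₀ with hvdef
  have hcvs : IsContinuationValue s Q₀ Q u α₀ β₀ v := hcv.of_le hs.le hsr
  have hv : MomentEquation s Q₀ Q u (condMoment R g) (α₀, β₀) v :=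
    hv'.congr hQ hcvs (recursionOp_fixedPoint_unique hs hQ hu hUs α₀ hβ₀ hv'.1.1 hv'.1.2.1
      hcvs.1 hcvs.2.1 hv'.1.2.2 hcvs.2.2)
  obtain ⟨V, W, hV0, hVfix, hVW, hW1, hW2⟩ :=
    exists_continuationValue_branch hs hQ hu hUs hβ₀ hcvs.1 hcvs.2.1 hcvs.2.2 hT
  have hfreq' : ∃ᶠ q in 𝓝[≠] (α₀, β₀),
      MomentEquation s Q₀ Q u (condMoment R g) q (V q).1 := by
    have h1 : ∃ᶠ q in 𝓝[≠] (α₀, β₀), ∃ w, MomentEquation s Q₀ Q u (condMoment R g) q w :=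
      (tendsto_alphaOf hβ₀ hθ₀).frequently (hfreq.mono fun p hp =>
        (hp.1.exists_momentEquation hs.le hsr hQ hu hUs).2)
    have h2 : ∀ᶠ q : ℝ × ℝ in 𝓝 (α₀, β₀), q.2 ∈ Ioo (0 : ℝ) 1 :=
      continuousAt_snd.eventually (Ioo_mem_nhds hβ₀.1 hβ₀.2)
    refine (h1.and_eventually (nhdsWithin_le_nhds (h2.and hVfix))).mono ?_
    rintro q ⟨⟨w, hw⟩, hqβ, hqV⟩
    have h3 : IsContinuationValue s Q₀ Q u q.1 q.2 (V q).1 := by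
      refine ⟨OrliczHeart.measurable_coe _, (V q).2, ?_⟩
      have h4 := recursionMap_coe hQ hu hUs q.1 q.2 (V q)
      rw [Prod.mk.eta, hqV] at h4
      exact h4
    -- The restriction at `q` holds for some continuation value `w`; uniqueness identifies it with
    -- the branch.
    exact hw.congr hQ h3 (recursionOp_fixedPoint_unique hs hQ hu hUs q.1 hqβ hw.1.1 hw.1.2.1
      h3.1 h3.2.1 hw.1.2.2 h3.2.2)
  obtain ⟨e, he, hdir⟩ := exists_direction_of_momentEquation hs hQ hu hUs
    (measurable_condMoment hg) hG hv hV0 hVW hfreq'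
  refine momentMatrix_not_posDef he ?_ hV
  have hWe : ((W e).1 : 𝓧 → ℝ) =ᵐ[Q₀] fun x => e.1 * discountedSum Q u α₀ β₀ v u x +
      e.2 * (β₀⁻¹ * (v x + discountedSum Q u α₀ β₀ v (fun q => v q.2) x)) := by
    have h1 : W e = e.1 • W (1, 0) + e.2 • W (0, 1) := by
      rw [← map_smul, ← map_smul, ← map_add]
      congr 1
      ext <;> simp
    rw [h1]
    filter_upwards [OrliczHeart.coeFn_add (e.1 • W (1, 0)) (e.2 • W (0, 1)),
      OrliczHeart.coeFn_smul e.1 (W (1, 0)), OrliczHeart.coeFn_smul e.2 (W (0, 1)), hW1, hW2]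
      with x k1 k2 k3 k4 k5
    rw [k1, k2, k3, k4, k5]
  have hsnd := measurePreserving_snd_compProd (Q₀ := Q₀) (Q := Q) hQ
  -- The discounted sums lie in the heart because they represent derivatives of the branch; this
  -- gives the integrability needed to split the integral along `e`.
  have hA : MemOrliczHeart s (Q₀ ⊗ₘ Q) fun p => u p + discountedSum Q u α₀ β₀ v u p.2 :=
    hUs.add hs.le (((W (1, 0)).2.congr hW1).comp_measurePreserving hsnd)
  have hB : MemOrliczHeart s (Q₀ ⊗ₘ Q)
      fun p => β₀⁻¹ * (v p.2 + discountedSum Q u α₀ β₀ v (fun q => v q.2) p.2) :=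
    ((W (0, 1)).2.congr hW2).comp_measurePreserving hsnd
  have hH : ∀ i, MemLp (fun p => β₀ * condMoment R g i p - 1) 2 (Q₀ ⊗ₘ Q) := fun i =>
    ((hG i).const_mul β₀).sub (memLp_const 1)
  filter_upwards [hdir, hv.2, ae_integrable_exp_aggregate hs.le hQ hu hUs α₀ hcvs.1 hcvs.2.1,
    ae_all_iff.2 fun i =>
      ae_integrable_exp_aggregate_mul_mul hs.le hQ hu hUs α₀ hcvs.1 hcvs.2.1 hA (hH i),
    ae_all_iff.2 fun i =>
      ae_integrable_exp_aggregate_mul_mul hs.le hQ hu hUs α₀ hcvs.1 hcvs.2.1 hB (hH i),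
    ae_ae_of_invariant hQ hWe] with x h1 h2 h3 h4 h5 h6 i
  have hpos := integral_exp_pos h3
  have hβ0 := hβ₀.1.ne'
  have k1 := h1 i
  have k2 : ∫ x', Real.exp (v x' + α₀ * u (x, x')) *
      ((β₀ * condMoment R g i (x, x') - 1) * ((W e).1 x' + e.1 * u (x, x'))) ∂(Q x) =
      e.1 * (∫ x', Real.exp (v x' + α₀ * u (x, x')) * ((β₀ * condMoment R g i (x, x') - 1) *
        (u (x, x') + discountedSum Q u α₀ β₀ v u x')) ∂(Q x)) +
      e.2 * ∫ x', Real.exp (v x' + α₀ * u (x, x')) * ((β₀ * condMoment R g i (x, x') - 1) *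
        (β₀⁻¹ * (v x' + discountedSum Q u α₀ β₀ v (fun q => v q.2) x'))) ∂(Q x) := by
    rw [← integral_const_mul, ← integral_const_mul, ← integral_add ((h4 i).const_mul _)
      ((h5 i).const_mul _)]
    apply integral_congr_ae
    filter_upwards [h6] with x' hx'
    rw [hx']
    ring
  have k3 : ∫ x', Real.exp (v x' + α₀ * u (x, x')) * ((β₀ * condMoment R g i (x, x') - 1) *
        (β₀⁻¹ * (v x' + discountedSum Q u α₀ β₀ v (fun q => v q.2) x'))) ∂(Q x) =
      β₀⁻¹ * ∫ x', Real.exp (v x' + α₀ * u (x, x')) * ((β₀ * condMoment R g i (x, x') - 1) *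
        (v x' + discountedSum Q u α₀ β₀ v (fun q => v q.2) x')) ∂(Q x) := by
    rw [← integral_const_mul]
    congr 1
    ext x'
    ring
  have k4 := h2 i
  rw [k2, k3] at k1
  rw [momentDerivAlpha, momentDerivBeta, worstCaseExp_eq_div, worstCaseExp_eq_div]
  simp only at k4 ⊢
  -- The restriction at the base point turns the term from differentiating the factor `β` into
  -- `β₀⁻¹` times the denominator, which is the `+ 1` in the `β`-derivative.
  have k5 : ∫ x', Real.exp (v x' + α₀ * u (x, x')) * condMoment R g i (x, x') ∂(Q x) =
      β₀⁻¹ * ∫ x', Real.exp (v x' + α₀ * u (x, x')) ∂(Q x) := by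
    rw [← k4, inv_mul_cancel_left₀ hβ0]
  rw [k5] at k1
  field_simp at k1 ⊢
  linarith
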